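/- \textbf{Setting.} Tier $i\in\{1,2\}$ consists of base stations (BSs) at the points of a homogeneous Poisson process $\Phi_i$ of intensity $\lambda_i>0$ in $\mathbb R^2$; the two tiers are independent, and the typical user is at the origin. Each BS of tier $i$ independently caches file $f$ with probability $p_{i,f}\in[0,1]$. Link gains $|h|^2$ are independent, Gamma distributed with shape $N_i^p$ and mean $1$, where $N_1^p=1$ and $N_2^p\ge1$ is an integer. The angle offset of each BS is independent and uniform on $[-d/\lambda,d/\lambda]$ (antenna spacing $d>0$, wavelength $\lambda>0$). The path loss is $L_1(r)=C_1r^{-\alpha_1}$ with $\alpha_1>2$, and $L_2(r)=\mathbf U(R_L-r)\,C_2r^{-\alpha_2}$ with $\alpha_2\ge2$, where $\mathbf U(x)=1$ for $x\ge0$ and $0$ otherwise. The array gain is $G_1=1$, $G_2(\omega)=\frac{\sin^2(\pi N_2\omega)}{N_2^2\sin^2(\pi\omega)}$, and the gain of the serving BS is $G_0=1$. The transmit powers $P_i$, the antenna numbers $N_i\in\mathbb N$, the bandwidths $B_i$, the bias factors $b_i^P$, $C_i$ and the radius $R_L$ are positive. File $f\in\{1,\dots,N_c\}$ is requested with probability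 $P_f=f^{-\delta}/\sum_{n=1}^{N_c}n^{-\delta}$, $\delta\ge0$, and only the files $f\le H_c$ are cached, $H_c\le N_c$. Under Max-RP a request for $f\le H_c$ is served by the BS, among those of both tiers that cache $f$, with the largest positive value of $b_i^PP_iL_i(\|x\|)N_iG_0$. If BS $x_0$ of tier $i$ serves, then $$\Upsilon_{i,f}=\frac{P_iL_i(\|x_0\|)G_0N_i|h_{x_0}|^2}{\sigma_i^2+\sum_{x\in\Phi_i\setminus x_0}P_iL_i(\|x\|)N_i|h_x|^2G_i(\omega_x)} .$$ Let $\mathcal A_{i,f}$ be the probability that tier $i$ serves the request for $f$. A file $f>H_c$ is requested from the core server via the nearest tier-1 BS; the request succeeds if $R_{th}\le C_{bh}$ and the rate of that link exceeds $R_{th}$; let $P_S^{\sigma}(R_{th})$ be the contribution $\sum_{f=H_c+1}^{N_c}P_f\,\mathbb P[\text{success}]$ of these requests. The success probability for noise powers $\sigma=(\sigma_1^2,\sigma_2^2)$ is $$\mathcal P_P^{\sigma}(R_{th})=\sum_{f=1}^{H_c}\sum_{i=1}^2P_f\,\mathcal A_{i,f}\,\mathbb P\big[B_i\log_2(1+\Upsilon_{i,f})>R_{th}\,\big|\,\text{tier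 }i\text{ serves}\big]+P_S^{\sigma}(R_{th}).$$ \textbf{Expression.} Let $S_i^0(z)={}_2F_1(-\tfrac2{\alpha_i},N_i^p;1-\tfrac2{\alpha_i};-z)$, $\Delta_i(z)=\Gamma(1-\tfrac2{\alpha_i})\Gamma(N_i^p+\tfrac2{\alpha_i})\Gamma(N_i^p)^{-1}z^{2/\alpha_i}$, $\eta=N_2^p(N_2^p!)^{-1/N_2^p}$, $P^r_{j,i}=\frac{b_j^PP_jC_jN_j}{b_i^PP_iC_iN_i}$, $R_r=(P^r_{1,2}R_L^{\alpha_2})^{1/\alpha_1}$. The serving-distance densities are $$f_{1,f}(r)=2\pi p_{1,f}\lambda_1r\Big[e^{-\pi p_{1,f}\lambda_1r^2-\pi p_{2,f}\lambda_2(P^r_{2,1})^{2/\alpha_2}r^{2\alpha_1/\alpha_2}}\,\mathbf U(R_r-r)+e^{-\pi p_{2,f}\lambda_2R_L^2-\pi p_{1,f}\lambda_1r^2}\,\mathbf U(r-R_r)\Big],$$ $$f_{2,f}(r)=2\pi p_{2,f}\lambda_2r\,e^{-\pi p_{2,f}\lambda_2r^2-\pi p_{1,f}\lambda_1(P^r_{1,2})^{2/\alpha_1}r^{2\alpha_2/\alpha_1}}\,\mathbf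 U(R_L-r).$$ Put $$\Theta_{1,f}(\tau)=\int_0^\infty e^{-\pi\lambda_1r^2(p_{1,f}(S_1^0(\tau)-1)+(1-p_{1,f})\Delta_1(\tau))}f_{1,f}(r)\,dr,$$ and, with the Gauss--Chebyshev nodes $x_k^{(u)}=\cos\frac{(2k-1)\pi}{2u}$, $$\Theta^{u_1,u_2}_{2,f}(\tau)=\frac{\pi R_L}{2u_2}\sum_{n=1}^{N_2^p}(-1)^{n+1}\binom{N_2^p}{n}\sum_{k=1}^{u_2}\sqrt{1-(x_k^{(u_2)})^2}\;\big[\mathcal L_2(n\eta r^{\alpha_2}/G_0,\tau)f_{2,f}(r)\big]_{r=(x_k^{(u_2)}+1)R_L/2},$$ $$\mathcal L_2(s,\tau)=\exp\Big(-\pi\lambda_2(R_L^2-p_{2,f}r^2)-\frac{\pi^2\lambda_2}{2u_1}\sum_{k=1}^{u_1}W_f\big(x_k^{(u_1)}d/\lambda,s,\tau\big)\sqrt{1-(x_k^{(u_1)})^2}\Big).$$ Here, with $X=sG_2(\omega)\tau/N_2^p$: if $\alpha_2>2$, $W_f=p_{2,f}S_2^0(X/r^{\alpha_2})r^2+(1-p_{2,f})\Delta_2(X)-S_2^0(X/R_L^{\alpha_2})R_L^2$;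 if $\alpha_2=2$, $W_f=X\big(F_y(X/R_L^2)-p_{2,f}F_y(X/r^2)\big)$ (continuously extended by $p_{2,f}r^2-R_L^2$ to $X=0$), with $F_y(y)=N_2^p\ln(1+\frac1y)-\frac1{y(1+y)^{N_2^p-1}}-\sum_{m=1}^{N_2^p-1}\frac{N_2^p}{(1+y)^{N_2^p-m}(N_2^p-m)}$. Finally let $$P_S(R_{th})=\mathbf U(C_{bh}-R_{th})\,\mathbf U(N_c-H_c-1)\sum_{f=H_c+1}^{N_c}\frac{P_f}{S_1^0(2^{R_{th}/B_1}-1)}$$ and, writing $\Theta_{1,f}^{u_1,u_2}=\Theta_{1,f}$, $$E_{u_1,u_2}(R_{th})=\sum_{f=1}^{H_c}\sum_{i=1}^2P_f\,\Theta^{u_1,u_2}_{i,f}\big(2^{R_{th}/B_i}-1\big)+P_S(R_{th}).$$ \textbf{Theorem.} For every $R_{th}>0$ one has $\mathcal P_P(R_{th})\approx E_{u_1,u_2}(R_{th})$ in the following sense. Let $\tilde{\mathcal P}_P(R_{th})$ be obtained from the noise-free success probability $\mathcal P_P^{0}(R_{th})$ by replacing the conditional probability $\mathbb P[|h_{x_0}|^2>\gamma]$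 for the serving link in tier $2$ (where $\gamma$ is the gain required for the rate $R_{th}$, given all positions, caches and interfering links) by $1-(1-e^{-\eta\gamma})^{N_2^p}$. Then (1) $E_{u_1,u_2}(R_{th})\to\tilde{\mathcal P}_P(R_{th})$ as $u_1,u_2\to\infty$ jointly; (2) $0\le\tilde{\mathcal P}_P(R_{th})-\mathcal P_P^{0}(R_{th})\le\varepsilon\sum_{f=1}^{H_c}P_f\mathcal A_{2,f}$, where $\varepsilon=\sup_{\gamma\ge0}\big|\mathbb P[|h_2|^2<\gamma]-(1-e^{-\eta\gamma})^{N_2^p}\big|$ and $|h_2|^2$ is Gamma distributed with shape $N_2^p$ and mean $1$ (so there is equality if $N_2^p=1$); (3) $\mathcal P_P^{\sigma}(R_{th})\to\mathcal P_P^{0}(R_{th})$ as $\sigma_1^2,\sigma_2^2\to0$, $\sigma_i^2\ge0$. -/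

import Mathlib

open MeasureTheory ProbabilityTheory Filter Topology
open scoped ENNReal NNReal

noncomputable section

/-- The plane in which base stations (BSs) live; the typical user is at the origin. -/
abbrev Plane : Type := EuclideanSpace ℝ (Fin 2)

/-- The unit step function, with value `1` at the origin. -/
def unitStep (x : ℝ) : ℝ := if 0 ≤ x then 1 else 0

/-- The Gauss hypergeometric function `₂F₁(a, b; c; z)` for real `z < 1`: the power series on
`[0, 1)`, and its analytic continuation to `(-∞, 0)`, given by Pfaff's transformation
`₂F₁(a, b; c; z) = (1 - z)^(-b) ₂F₁(c - a, b; c; z / (z - 1))`. -/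
def gaussHyp (a b c z : ℝ) : ℝ :=
  if z < 0 then (1 - z) ^ (-b) * ordinaryHypergeometric (c - a) b c (z / (z - 1))
  else ordinaryHypergeometric a b c z

/-- `pointCount X A ω` is the number of indices `k` with `X k ω ∈ A`. -/
def pointCount {Ω : Type*} (X : ℕ → Ω → Plane) (A : Set Plane) (ω : Ω) : ℕ∞ :=
  {k | X k ω ∈ A}.encard

/-- The points `X 0, X 1, …` form a homogeneous Poisson point process of intensity `lam`. -/
structure IsHPPP {Ω : Type*} [MeasurableSpace Ω] (μ : Measure Ω) (X : ℕ → Ω → Plane)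
    (lam : ℝ) : Prop where
  measurable : ∀ k, Measurable (X k)
  count_law : ∀ A : Set Plane, MeasurableSet A → volume A ≠ ∞ → ∀ n : ℕ,
    μ {ω | pointCount X A ω = n} =
      ENNReal.ofReal (Real.exp (-(lam * volume.real A)) * (lam * volume.real A) ^ n
        / (n.factorial : ℝ))
  count_indep : ∀ (m : ℕ) (A : Fin m → Set Plane), (∀ i, MeasurableSet (A i)) →
    Pairwise (fun i j => Disjoint (A i) (A j)) → iIndepFun (fun i => pointCount X (A i)) μ

/-- Parameters of the two-tier network. Tier `0` is the sub-6 GHz tier of large cells ("first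
tier"), tier `1` is the mmWave pico tier ("second tier"). Files are indexed from `1`. -/
structure HetNet where
  /-- BS densities -/
  lam : Fin 2 → ℝ
  /-- path loss exponents -/
  alpha : Fin 2 → ℝ
  /-- path loss intercepts -/
  inter : Fin 2 → ℝ
  /-- transmit powers -/
  pow : Fin 2 → ℝ
  /-- numbers of antenna elements -/
  ant : Fin 2 → ℕ
  /-- bandwidths per resource block -/
  bw : Fin 2 → ℝ
  /-- bias factors of the Max-RP association -/
  bias : Fin 2 → ℝ
  /-- Nakagami parameter of the second tier (that of the first tier is `1`) -/
  nak : ℕ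
  /-- radius of the line-of-sight ball -/
  RL : ℝ
  /-- antenna spacing -/
  spacing : ℝ
  /-- wavelength -/
  wavelength : ℝ
  /-- backhaul capacity -/
  Cbh : ℝ
  /-- number of files in the catalog -/
  Nc : ℕ
  /-- number of files that are cached in the network -/
  Hc : ℕ
  /-- skew of the popularity distribution -/
  delta : ℝ
  /-- `p i f` is the probability that a BS of tier `i` caches the file `f` -/
  p : Fin 2 → ℕ → ℝ

namespace HetNet

/-- Admissible parameters. -/
structure Valid (S : HetNet) : Prop where
  lam_pos : ∀ i, 0 < S.lam i
  alpha_first : 2 < S.alpha 0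
  alpha_second : 2 ≤ S.alpha 1
  inter_pos : ∀ i, 0 < S.inter i
  pow_pos : ∀ i, 0 < S.pow i
  ant_pos : ∀ i, 0 < S.ant i
  bw_pos : ∀ i, 0 < S.bw i
  bias_pos : ∀ i, 0 < S.bias i
  nak_pos : 0 < S.nak
  RL_pos : 0 < S.RL
  spacing_pos : 0 < S.spacing
  wavelength_pos : 0 < S.wavelength
  Hc_le : S.Hc ≤ S.Nc
  delta_nonneg : 0 ≤ S.delta
  p_nonneg : ∀ i f, 0 ≤ S.p i f
  p_le_one : ∀ i f, S.p i f ≤ 1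

/-- Maximum directivity gain. -/
def G0 : ℝ := 1

/-- Requesting probability of the file `f` (Zipf distribution). -/
def zipf (S : HetNet) (f : ℕ) : ℝ :=
  (f : ℝ) ^ (-S.delta) / ∑ n ∈ Finset.Icc 1 S.Nc, (n : ℝ) ^ (-S.delta)

/-- Nakagami parameter of each tier; the first tier has Rayleigh fading. -/
def nakOf (S : HetNet) (i : Fin 2) : ℕ := if i = 0 then 1 else S.nak

/-- Path loss laws; in the second tier only line-of-sight links are counted. -/
def pathLoss (S : HetNet) (i : Fin 2) (r : ℝ) : ℝ :=
  if i = 0 then S.inter 0 * r ^ (-S.alpha 0)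
  else unitStep (S.RL - r) * S.inter 1 * r ^ (-S.alpha 1)

/-- Array gain: `1` for the omnidirectional antennas of the first tier, the uniform linear array
pattern `sin² (π N ω) / (N² sin² (π ω))` in the second tier, continuously extended (by `1`) to
integer `ω`. -/
def arrayGain (S : HetNet) (i : Fin 2) (w : ℝ) : ℝ :=
  if i = 0 then 1
  else if Real.sin (Real.pi * w) = 0 then 1
  else Real.sin (Real.pi * S.ant 1 * w) ^ 2 / ((S.ant 1 : ℝ) ^ 2 * Real.sin (Real.pi * w) ^ 2)

/-- SINR threshold of tier `i` for the rate threshold `R`. -/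
def threshold (S : HetNet) (i : Fin 2) (R : ℝ) : ℝ := 2 ^ (R / S.bw i) - 1

/-! ### The random network -/

/-- A realization of the network over a sample space: for tier `i` and BS number `k`, its
position, the set of files it caches, the small-scale fading power gain `|h|²` of its link to the
typical user, and its angle of departure offset, which determines its array gain as interferer. -/
structure Deployment (Ω : Type*) where
  pos : Fin 2 → ℕ → Ω → Plane
  cache : Fin 2 → ℕ → Ω → ℕ → Bool
  gain : Fin 2 → ℕ → Ω → ℝ
  aod : Fin 2 → ℕ → Ω → ℝ

variable {Ω : Type*}

namespace Deployment

/-- The marks of a BS: its cache, fading gain and angle offset. -/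
def mark (D : Deployment Ω) (i : Fin 2) (k : ℕ) (ω : Ω) : (ℕ → Bool) × ℝ × ℝ :=
  (D.cache i k ω, D.gain i k ω, D.aod i k ω)

/-- The law of the random network: in each tier the positions form a homogeneous Poisson process
and carry independent marks (cache, normalized Gamma fading gain, uniform angle offset, mutually
independent); the tiers are independent. -/
structure Law [MeasurableSpace Ω] (S : HetNet) (D : Deployment Ω) (μ : Measure Ω) : Prop where
  poisson : ∀ i, IsHPPP μ (D.pos i) (S.lam i)
  measurable_cache : ∀ i k, Measurable (D.cache i k)
  measurable_gain : ∀ i k, Measurable (D.gain i k)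
  measurable_aod : ∀ i k, Measurable (D.aod i k)
  cache_law : ∀ i k f, μ {ω | D.cache i k ω f = true} = ENNReal.ofReal (S.p i f)
  gain_law : ∀ i k, μ.map (D.gain i k) = gammaMeasure (S.nakOf i) (S.nakOf i)
  aod_law : ∀ i k, μ.map (D.aod i k) =
    cond volume (Set.Icc (-(S.spacing / S.wavelength)) (S.spacing / S.wavelength))
  indep_gain_aod : ∀ i k, IndepFun (D.gain i k) (D.aod i k) μ
  indep_cache : ∀ i k, IndepFun (D.cache i k) (fun ω => (D.gain i k ω, D.aod i k ω)) μ
  indep_marks : ∀ i, iIndepFun (D.mark i) μ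
  indep_pos_marks : ∀ i, IndepFun (fun ω k => D.pos i k ω) (fun ω k => D.mark i k ω) μ
  indep_tiers : IndepFun (fun ω => ((fun k => D.pos 0 k ω), (fun k => D.mark 0 k ω)))
    (fun ω => ((fun k => D.pos 1 k ω), (fun k => D.mark 1 k ω))) μ

/-- Biased average received power at the typical user from BS `k` of tier `i`. -/
def avgPower (S : HetNet) (D : Deployment Ω) (i : Fin 2) (k : ℕ) (ω : Ω) : ℝ :=
  S.bias i * S.pow i * S.pathLoss i ‖D.pos i k ω‖ * S.ant i * G0

/-- Max-RP association: BS `k` of tier `i` serves the request for file `f`, since among all BSs of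
both tiers that cache `f` it provides the maximum biased average received power. -/
def Serves (S : HetNet) (D : Deployment Ω) (i : Fin 2) (k f : ℕ) (ω : Ω) : Prop :=
  D.cache i k ω f = true ∧ 0 < D.avgPower S i k ω ∧
    ∀ j l, (j, l) ≠ (i, k) → D.cache j l ω f = true → D.avgPower S j l ω < D.avgPower S i k ω

/-- BS `k` is the nearest BS of the first tier. -/
def Nearest (D : Deployment Ω) (k : ℕ) (ω : Ω) : Prop :=
  ∀ l, l ≠ k → ‖D.pos 0 k ω‖ < ‖D.pos 0 l ω‖

/-- Interference at the typical user served by BS `k` of tier `i`, from all other BSs of that tier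
(whether or not they cache the requested file). -/
def interference (S : HetNet) (D : Deployment Ω) (i : Fin 2) (k : ℕ) (ω : Ω) : ℝ≥0∞ :=
  ∑' l, if l = k then 0 else
    ENNReal.ofReal (S.pow i * S.pathLoss i ‖D.pos i l ω‖ *
      (S.ant i * D.gain i l ω * S.arrayGain i (D.aod i l ω)))

/-- Received SINR when served by BS `k` of tier `i`, with noise powers `noise i = σᵢ²`. -/
def sinr (S : HetNet) (D : Deployment Ω) (noise : Fin 2 → ℝ) (i : Fin 2) (k : ℕ) (ω : Ω) : ℝ≥0∞ :=
  ENNReal.ofReal (S.pow i * S.pathLoss i ‖D.pos i k ω‖ * G0 * S.ant i * D.gain i k ω) /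
    (ENNReal.ofReal (noise i) + D.interference S i k ω)

/-- Data rate `Bᵢ log₂ (1 + SINR)`. -/
def rate (S : HetNet) (D : Deployment Ω) (noise : Fin 2 → ℝ) (i : Fin 2) (k : ℕ) (ω : Ω) : EReal :=
  (S.bw i : EReal) * (ENNReal.log (1 + D.sinr S noise i k ω) / ((Real.log 2 : ℝ) : EReal))

/-- The event that the request for file `f` is served by tier `i`. -/
def assocEvent (S : HetNet) (D : Deployment Ω) (i : Fin 2) (f : ℕ) : Set Ω :=
  {ω | ∃ k, D.Serves S i k f ω}

/-- The event that tier `i` serves file `f` at a rate above `R`. -/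
def rateEvent (S : HetNet) (D : Deployment Ω) (noise : Fin 2 → ℝ) (R : ℝ) (i : Fin 2) (f : ℕ) :
    Set Ω :=
  {ω | ∃ k, D.Serves S i k f ω ∧ (R : EReal) < D.rate S noise i k ω}

variable [MeasurableSpace Ω]

/-- Max-RP association probability. -/
def assocProb (S : HetNet) (D : Deployment Ω) (μ : Measure Ω) (i : Fin 2) (f : ℕ) : ℝ :=
  μ.real (D.assocEvent S i f)

/-- Success probability in the server mode: the request is for a file that is not cached in the
network, the backhaul supports the rate `R`, and the rate from the nearest BS of the first tier
exceeds `R`. -/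
def serverSuccess (S : HetNet) (D : Deployment Ω) (μ : Measure Ω) (noise : Fin 2 → ℝ)
    (R : ℝ) : ℝ :=
  ∑ f ∈ Finset.Icc (S.Hc + 1) S.Nc, S.zipf f *
    μ.real {ω | R ≤ S.Cbh ∧ ∃ k, D.Nearest k ω ∧ (R : EReal) < D.rate S noise 0 k ω}

/-- Success probability under Max-RP: association probability times the conditional probability,
given the association, that the rate exceeds `R`, averaged over the requests, plus the
contribution of the server mode. -/
def success (S : HetNet) (D : Deployment Ω) (μ : Measure Ω) (noise : Fin 2 → ℝ) (R : ℝ) : ℝ :=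
  (∑ f ∈ Finset.Icc 1 S.Hc, ∑ i : Fin 2, S.zipf f *
    (D.assocProb S μ i f * (cond μ (D.assocEvent S i f)).real (D.rateEvent S noise R i f)))
  + D.serverSuccess S μ noise R

end Deployment

/-! ### The approximation of the Gamma tail -/

/-- `N (N!)^(-1/N)` -/
def etaL (N : ℕ) : ℝ := N * (N.factorial : ℝ) ^ (-(1 / (N : ℝ)))

/-- The approximation `(1 - exp (-η γ)) ^ N` of the distribution function of the normalized Gamma
variable with integer parameter `N`. -/
def gammaApprox (N : ℕ) (x : ℝ) : ℝ := (1 - Real.exp (-(etaL N * x))) ^ N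

/-- Uniform error of this approximation over `x ≥ 0`. -/
def gammaError (N : ℕ) : ℝ :=
  ⨆ x : ℝ≥0, |(gammaMeasure N N).real (Set.Iio (x : ℝ)) - gammaApprox N x|

namespace Deployment

variable [MeasurableSpace Ω]

/-- The serving fading gain that is needed in tier `1` for the rate `R`, without noise. -/
def requiredGain (S : HetNet) (D : Deployment Ω) (R : ℝ) (k : ℕ) (ω : Ω) : ℝ :=
  S.threshold 1 R * (D.interference S 1 k ω).toReal /
    (S.pow 1 * S.pathLoss 1 ‖D.pos 1 k ω‖ * G0 * S.ant 1)

/-- Joint probability that the second tier serves file `f` at a rate above `R`, without noise, when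
the tail of the fading gain of the serving link is replaced by its approximation
`1 - (1 - exp (-η γ)) ^ N`, all else being unchanged. -/
def approxCovered (S : HetNet) (D : Deployment Ω) (μ : Measure Ω) (R : ℝ) (f : ℕ) : ℝ :=
  (∫⁻ ω, ∑' k, {ω | D.Serves S 1 k f ω}.indicator
    (fun ω => ENNReal.ofReal (1 - gammaApprox S.nak (D.requiredGain S R k ω))) ω ∂μ).toReal

/-- Noise-free success probability under Max-RP in which only the tail of the fading gain of the
serving mmWave link is replaced by its approximation. -/
def tailSuccess (S : HetNet) (D : Deployment Ω) (μ : Measure Ω) (R : ℝ) : ℝ :=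
  (∑ f ∈ Finset.Icc 1 S.Hc, S.zipf f *
    (D.assocProb S μ 0 f * (cond μ (D.assocEvent S 0 f)).real (D.rateEvent S 0 R 0 f)
      + D.approxCovered S μ R f))
  + D.serverSuccess S μ 0 R

end Deployment

/-! ### The analytical expression -/

/-- `S_i^0 (z)` -/
def hypS (S : HetNet) (i : Fin 2) (z : ℝ) : ℝ :=
  gaussHyp (-(2 / S.alpha i)) (S.nakOf i) (1 - 2 / S.alpha i) (-z)

/-- `Δ_i (z)` -/
def Del (S : HetNet) (i : Fin 2) (z : ℝ) : ℝ :=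
  Real.Gamma (1 - 2 / S.alpha i) * Real.Gamma (S.nakOf i + 2 / S.alpha i)
    * (Real.Gamma (S.nakOf i))⁻¹ * z ^ (2 / S.alpha i)

/-- `P^r_{j,i}` -/
def powRatio (S : HetNet) (j i : Fin 2) : ℝ :=
  (S.bias j * S.pow j * S.inter j * S.ant j) / (S.bias i * S.pow i * S.inter i * S.ant i)

/-- `α^r_{j,i}` -/
def alphaRatio (S : HetNet) (j i : Fin 2) : ℝ := S.alpha j / S.alpha i

/-- `R_r` -/
def Rr (S : HetNet) : ℝ := (S.powRatio 0 1 * S.RL ^ S.alpha 1) ^ (1 / S.alpha 0)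

/-- Serving distance density of the first tier under Max-RP. -/
def dens1 (S : HetNet) (f : ℕ) (r : ℝ) : ℝ :=
  2 * Real.pi * S.p 0 f * S.lam 0 * r
      * Real.exp (-(Real.pi * ∑ j : Fin 2, S.p j f * S.lam j
          * S.powRatio j 0 ^ (2 / S.alpha 1) * r ^ (2 / S.alphaRatio j 0)) )
      * unitStep (S.Rr - r)
  + 2 * Real.pi * S.p 0 f * S.lam 0 * r
      * Real.exp (-(Real.pi * S.p 1 f * S.lam 1 * S.RL ^ 2) - Real.pi * S.p 0 f * S.lam 0 * r ^ 2)
      * unitStep (r - S.Rr)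

/-- Serving distance density of the second tier under Max-RP. -/
def dens2 (S : HetNet) (f : ℕ) (r : ℝ) : ℝ :=
  2 * Real.pi * S.p 1 f * S.lam 1 * r
      * Real.exp (-(Real.pi * ∑ j : Fin 2, S.p j f * S.lam j
          * S.powRatio j 1 ^ (2 / S.alpha 0) * r ^ (2 / S.alphaRatio j 1)))
      * unitStep (S.RL - r)

/-- Gauss-Chebyshev nodes. -/
def chebNode (u k : ℕ) : ℝ := Real.cos ((2 * (k : ℝ) - 1) / (2 * (u : ℝ)) * Real.pi)

/-- `F_y (y)` -/
def Fy (N : ℕ) (y : ℝ) : ℝ :=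
  N * Real.log (1 + 1 / y) - 1 / (y * (1 + y) ^ (N - 1))
    - ∑ m ∈ Finset.Icc 1 (N - 1), (N : ℝ) / ((1 + y) ^ (N - m) * ((N : ℝ) - m))

/-- `W_f (ω, s, τ)` at the distance `r`. For `α₂ = 2` the expression is undefined at the zeros of
the array gain; there it is given its limit. -/
def Wf (S : HetNet) (f : ℕ) (r w s t : ℝ) : ℝ :=
  let X := s * S.arrayGain 1 w * t / S.nak
  if S.alpha 1 = 2 then
    if X = 0 then S.p 1 f * r ^ 2 - S.RL ^ 2
    else X * (Fy S.nak (X / S.RL ^ 2) - S.p 1 f * Fy S.nak (X / r ^ 2))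
  else
    S.p 1 f * S.hypS 1 (X / r ^ S.alpha 1) * r ^ 2 + (1 - S.p 1 f) * S.Del 1 X
      - S.hypS 1 (X / S.RL ^ S.alpha 1) * S.RL ^ 2

/-- `𝓛₂ (s, τ)` at the distance `r`, with `u₁` quadrature nodes. -/
def laplace2 (S : HetNet) (u₁ f : ℕ) (r s t : ℝ) : ℝ :=
  Real.exp (-(Real.pi * S.lam 1 * (S.RL ^ 2 - S.p 1 f * r ^ 2))
    - Real.pi ^ 2 * S.lam 1 / (2 * u₁) * ∑ k ∈ Finset.Icc 1 u₁,
        S.Wf f r (chebNode u₁ k * S.spacing / S.wavelength) s t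
          * Real.sqrt (1 - chebNode u₁ k ^ 2))

/-- `Θ_{1,f} (τ)` -/
def Theta1 (S : HetNet) (f : ℕ) (t : ℝ) : ℝ :=
  ∫ r in Set.Ioi (0 : ℝ),
    Real.exp (-(Real.pi * S.lam 0 * r ^ 2
      * (S.p 0 f * (S.hypS 0 t - 1) + (1 - S.p 0 f) * S.Del 0 t))) * S.dens1 f r

/-- `F_R (r, τ)`, for the summation index `n`. -/
def FR (S : HetNet) (u₁ f n : ℕ) (r t : ℝ) : ℝ :=
  S.laplace2 u₁ f r (n * etaL S.nak * r ^ S.alpha 1 / G0) t * S.dens2 f r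

/-- The expression for `Θ_{2,f} (τ)`, with `u₁` and `u₂` quadrature nodes. -/
def Theta2 (S : HetNet) (u₁ u₂ f : ℕ) (t : ℝ) : ℝ :=
  Real.pi * S.RL / (2 * u₂) * ∑ n ∈ Finset.Icc 1 S.nak,
    (-1 : ℝ) ^ (n + 1) * (S.nak.choose n : ℝ) * ∑ k ∈ Finset.Icc 1 u₂,
      S.FR u₁ f n ((chebNode u₂ k + 1) * S.RL / 2) t * Real.sqrt (1 - chebNode u₂ k ^ 2)

/-- Noise-free coverage probability of the first tier without cache restriction (all BSs are
eligible, i.e. caching probability one), at the threshold `t`. -/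
def coverFirst (S : HetNet) (t : ℝ) : ℝ := 1 / S.hypS 0 t

/-- The expression for `P_S (R)`. -/
def serverExpr (S : HetNet) (R : ℝ) : ℝ :=
  unitStep (S.Cbh - R) * unitStep ((S.Nc : ℝ) - S.Hc - 1)
    * ∑ f ∈ Finset.Icc (S.Hc + 1) S.Nc, S.zipf f * S.coverFirst (S.threshold 0 R)

/-- The expression for the success probability under Max-RP, with `u₁` and `u₂` nodes. -/
def successExpr (S : HetNet) (u₁ u₂ : ℕ) (R : ℝ) : ℝ :=
  (∑ f ∈ Finset.Icc 1 S.Hc, (S.zipf f * S.Theta1 f (S.threshold 0 R)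
      + S.zipf f * S.Theta2 u₁ u₂ f (S.threshold 1 R)))
  + S.serverExpr R

end HetNet

end

/-! Both ingredients of a success probability are multiplicative over base stations (BSs). That a
given BS serves is a product of indicators, one for each possible blocker, and an exponential of
minus the interference is a product of exponentials. The quantities to compute are therefore means
of sums over the points of a Poisson process of products over all other points. The generating
functional (`IsHPPP.lintegral_count_mul_iprod`) and a Mecke formula (`IsHPPP.lintegral_tsum_iprod`,
with marks and a second tier `lintegral_tsum_marked`) turn them into radial integrals of
exponentials, see `Law.lintegral_selected`.

The exponents are integrals of `2 y (1 - (1 + X y ^ (-α)) ^ (-N))`. A primitive is `y² (1 + Ψ (X y ^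
(-α)))`, where `Ψ` solves a first-order linear equation (`IsRadialPrimitive`): minus a
hypergeometric function for `α > 2`, an elementary function for `α = 2`. The constants with Gamma
functions come from a beta integral.

The serving gain is independent of the rest of the network (`Law.indep_gain_masked`), so it may be
replaced by its tail. In the first tier the tail is an exponential, and the expressions are exact.
In the second tier the approximate tail `1 - (1 - exp (-η γ)) ^ N` expands binomially into
exponentials, and the approximate probability is a finite sum of radial integrals over `[0, R_L]`
whose exponents average over the angle. Under `x = cos θ`, Gauss–Chebyshev quadrature is the
midpoint rule. The inner quadrature converges uniformly in the serving distance, so the nested one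
converges jointly (`tendsto_Theta2`).

The sign of the tail error is Alzer's inequality `gammaApprox_le_gammaMeasure`. Its size is obtained
by integrating a pointwise gap of at most `ε` over the association event. As the noise vanishes, the
indicators of the rate events converge pointwise and so do their probabilities. -/

noncomputable section

/-! ### Infinite products of factors in `[0, 1]` -/

/-- The infinite product of a sequence of factors in `[0, 1]`. -/
def iprod (w : ℕ → ℝ≥0∞) : ℝ≥0∞ := ⨅ n, ∏ l ∈ Finset.range n, w l

lemma antitone_prod_range {w : ℕ → ℝ≥0∞} (hw : ∀ l, w l ≤ 1) :
    Antitone fun n => ∏ l ∈ Finset.range n, w l := by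
  refine antitone_nat_of_succ_le fun n => ?_
  rw [Finset.prod_range_succ]
  exact mul_le_of_le_one_right' (hw n)

lemma tendsto_iprod {w : ℕ → ℝ≥0∞} (hw : ∀ l, w l ≤ 1) :
    Tendsto (fun n => ∏ l ∈ Finset.range n, w l) atTop (𝓝 (iprod w)) :=
  tendsto_atTop_iInf (antitone_prod_range hw)

lemma iprod_le_one (w : ℕ → ℝ≥0∞) : iprod w ≤ 1 :=
  (iInf_le _ 0).trans (by simp)

lemma iprod_mono {w w' : ℕ → ℝ≥0∞} (h : ∀ l, w l ≤ w' l) : iprod w ≤ iprod w' :=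
  iInf_mono fun _ => Finset.prod_le_prod' fun l _ => h l

lemma iprod_mul {w w' : ℕ → ℝ≥0∞} (hw : ∀ l, w l ≤ 1) (hw' : ∀ l, w' l ≤ 1) :
    iprod (fun l => w l * w' l) = iprod w * iprod w' := by
  have h := ENNReal.Tendsto.mul (tendsto_iprod hw)
    (Or.inr ((iprod_le_one w').trans_lt ENNReal.one_lt_top).ne) (tendsto_iprod hw')
    (Or.inr ((iprod_le_one w).trans_lt ENNReal.one_lt_top).ne)
  simp_rw [← Finset.prod_mul_distrib] at h
  exact tendsto_nhds_unique (tendsto_iprod fun l => mul_le_one' (hw l) (hw' l)) h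

lemma iprod_ite_eq (k : ℕ) (a : ℝ≥0∞) (ha : a ≤ 1) :
    iprod (fun l => if l = k then a else 1) = a := by
  refine tendsto_nhds_unique (tendsto_iprod fun l => by split_ifs <;> simp [ha]) ?_
  refine tendsto_const_nhds.congr' ?_
  filter_upwards [eventually_gt_atTop k] with n hn
  rw [Finset.prod_ite_eq' (Finset.range n) k]
  simp [hn]

/-- Separates the factor of the serving point from those of the other points. -/
lemma iprod_ite (k : ℕ) (a : ℝ≥0∞) (ha : a ≤ 1) {w : ℕ → ℝ≥0∞} (hw : ∀ l, w l ≤ 1) :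
    iprod (fun l => if l = k then a else w l) = a * iprod (fun l => if l = k then 1 else w l) := by
  conv_rhs => rw [← iprod_ite_eq k a ha]
  rw [← iprod_mul]
  · congr 1; ext l; split_ifs <;> simp
  · intro l; split_ifs <;> simp [ha]
  · intro l; split_ifs <;> simp [hw]

/-- Makes a condition on all points multiplicative, so that it can be merged with Laplace factors.
-/
lemma iprod_indicator (P : ℕ → Prop) [DecidablePred P] [Decidable (∀ l, P l)] :
    iprod (fun l => if P l then 1 else 0) = if ∀ l, P l then 1 else 0 := by
  split_ifs with h
  · simp [iprod, h]
  · push Not at h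
    obtain ⟨k, hk⟩ := h
    refine le_antisymm ((iInf_le _ (k + 1)).trans ?_) bot_le
    rw [Finset.prod_range_succ]; simp [hk]

lemma iprod_one : iprod (fun _ => 1) = 1 := by simp [iprod]

/-- Infima commute, and for a fixed number of factors the limit of the product is the product of the
limits; the bound by one excludes `0 * ∞`. This carries the generating functional from step
functions to general ones. -/
lemma iprod_iInf {w : ℕ → ℕ → ℝ≥0∞} (hw : ∀ n l, w n l ≤ 1) (ha : ∀ l, Antitone fun n => w n l) :
    ⨅ n, iprod (w n) = iprod (fun l => ⨅ n, w n l) := by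
  unfold iprod
  rw [iInf_comm]
  congr 1; ext m
  refine tendsto_nhds_unique (tendsto_atTop_iInf fun a b hab =>
    Finset.prod_le_prod' fun l _ => ha l hab) ?_
  induction m with
  | zero => simp
  | succ m ih =>
    simp_rw [Finset.prod_range_succ]
    refine ENNReal.Tendsto.mul ih (Or.inr ?_) (tendsto_atTop_iInf (ha m)) (Or.inr ?_)
    · exact (((iInf_le _ 0).trans (hw 0 m)).trans_lt ENNReal.one_lt_top).ne
    · refine ((Finset.prod_le_one' fun l _ => ?_).trans_lt ENNReal.one_lt_top).ne
      exact (iInf_le _ 0).trans (hw 0 l)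

@[fun_prop]
lemma measurable_iprod {α : Type*} [MeasurableSpace α] {w : ℕ → α → ℝ≥0∞}
    (hw : ∀ l, Measurable (w l)) : Measurable fun x => iprod fun l => w l x := by
  unfold iprod
  exact Measurable.iInf fun n => Finset.measurable_fun_prod _ fun l _ => hw l

/-! ### The exponential of a negative extended number -/

/-- `exp (-x)`, which is `0` for `x = ∞`. -/
def expNeg (x : ℝ≥0∞) : ℝ≥0∞ := if x = ∞ then 0 else ENNReal.ofReal (Real.exp (-x.toReal))

lemma expNeg_top : expNeg ∞ = 0 := by simp [expNeg]

lemma expNeg_of_ne_top {x : ℝ≥0∞} (hx : x ≠ ∞) :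
    expNeg x = ENNReal.ofReal (Real.exp (-x.toReal)) := by simp [expNeg, hx]

lemma expNeg_ofReal {x : ℝ} (hx : 0 ≤ x) :
    expNeg (ENNReal.ofReal x) = ENNReal.ofReal (Real.exp (-x)) := by
  rw [expNeg_of_ne_top ENNReal.ofReal_ne_top, ENNReal.toReal_ofReal hx]

lemma expNeg_zero : expNeg 0 = 1 := by simp [expNeg]

lemma expNeg_antitone : Antitone expNeg := by
  intro x y hxy
  by_cases hy : y = ∞
  · simp [hy, expNeg_top]
  have hx : x ≠ ∞ := (hxy.trans_lt (lt_top_iff_ne_top.2 hy)).ne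
  rw [expNeg_of_ne_top hx, expNeg_of_ne_top hy]
  exact ENNReal.ofReal_le_ofReal (Real.exp_le_exp.2 (neg_le_neg (ENNReal.toReal_mono hy hxy)))

lemma expNeg_le_one (x : ℝ≥0∞) : expNeg x ≤ 1 :=
  (expNeg_antitone zero_le).trans expNeg_zero.le

lemma expNeg_ne_top (x : ℝ≥0∞) : expNeg x ≠ ∞ :=
  ((expNeg_le_one x).trans_lt ENNReal.one_lt_top).ne

@[fun_prop]
lemma measurable_expNeg : Measurable expNeg := expNeg_antitone.measurable

lemma expNeg_add (x y : ℝ≥0∞) : expNeg (x + y) = expNeg x * expNeg y := by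
  by_cases hx : x = ∞
  · simp [hx, expNeg_top]
  by_cases hy : y = ∞
  · simp [hy, expNeg_top]
  rw [expNeg_of_ne_top hx, expNeg_of_ne_top hy, expNeg_of_ne_top (ENNReal.add_ne_top.2 ⟨hx, hy⟩),
    ENNReal.toReal_add hx hy, neg_add, Real.exp_add, ENNReal.ofReal_mul (Real.exp_pos _).le]

lemma expNeg_sum {ι : Type*} (s : Finset ι) (a : ι → ℝ≥0∞) :
    expNeg (∑ i ∈ s, a i) = ∏ i ∈ s, expNeg (a i) := by
  classical
  induction s using Finset.induction_on with
  | empty => simp [expNeg_zero]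
  | insert i s hi ih => rw [Finset.sum_insert hi, Finset.prod_insert hi, expNeg_add, ih]

lemma continuous_expNeg : Continuous expNeg := by
  refine continuous_iff_continuousAt.2 fun x => ?_
  by_cases hx : x = ∞
  · subst hx
    rw [ContinuousAt, expNeg_top, ENNReal.tendsto_nhds_zero]
    intro ε hε
    have h1 : Tendsto (fun t : ℝ => ENNReal.ofReal (Real.exp (-t))) atTop (𝓝 0) := by
      rw [← ENNReal.ofReal_zero]
      exact ENNReal.tendsto_ofReal (Real.tendsto_exp_neg_atTop_nhds_zero)
    obtain ⟨t, ht, ht0⟩ := ((h1.eventually (ge_mem_nhds hε)).and (eventually_ge_atTop 0)).exists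
    filter_upwards [lt_mem_nhds (ENNReal.ofReal_lt_top (r := t))] with y hy
    refine (expNeg_antitone hy.le).trans ?_
    rwa [expNeg_ofReal ht0]
  · have h1 : ContinuousAt (fun y : ℝ≥0∞ => ENNReal.ofReal (Real.exp (-y.toReal))) x :=
      ENNReal.continuous_ofReal.continuousAt.comp
        (Real.continuous_exp.continuousAt.comp (ENNReal.continuousAt_toReal hx).neg)
    refine h1.congr ?_
    filter_upwards [Iio_mem_nhds (lt_top_iff_ne_top.2 hx)] with y hy
    rw [expNeg_of_ne_top hy.ne]

lemma expNeg_tsum (a : ℕ → ℝ≥0∞) : expNeg (∑' l, a l) = iprod fun l => expNeg (a l) := by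
  refine tendsto_nhds_unique ?_ (tendsto_iprod fun l => expNeg_le_one _)
  simp_rw [← expNeg_sum]
  exact (continuous_expNeg.tendsto _).comp ENNReal.summable.hasSum.tendsto_sum_nat

lemma expNeg_iSup {a : ℕ → ℝ≥0∞} (ha : Monotone a) : expNeg (⨆ n, a n) = ⨅ n, expNeg (a n) :=
  tendsto_nhds_unique ((continuous_expNeg.tendsto _).comp (tendsto_atTop_iSup ha))
    (tendsto_atTop_iInf fun _ _ h => expNeg_antitone (ha h))

/-! ### Counts of a point process -/

lemma pointCount_toENNReal {Ω : Type*} (X : ℕ → Ω → Plane) (A : Set Plane) (ω : Ω) :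
    (pointCount X A ω : ℝ≥0∞) = ∑' k, A.indicator (fun _ => 1) (X k ω) := by
  have h := Measure.count_apply (α := ℕ) (s := {k | X k ω ∈ A}) (MeasurableSet.of_discrete)
  rw [pointCount, ← h, ← lintegral_indicator_one (MeasurableSet.of_discrete),
    lintegral_count]
  rfl

/-- The power `c ^ n`, with value `0` at `n = ⊤`. -/
def countPow (c : ℝ≥0∞) (n : ℕ∞) : ℝ≥0∞ := if n = ⊤ then 0 else c ^ n.toNat

/-- Beyond the last index in `A` all factors are one. Finiteness matters for `c = 1`: there the
product is one, while `countPow 1 ⊤ = 0`. -/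
lemma iprod_ite_mem {Ω : Type*} {X : ℕ → Ω → Plane} {ω : Ω} {A : Set Plane} (h : pointCount X A ω ≠ ⊤) {c : ℝ≥0∞} (hc : c ≤ 1)
    [DecidablePred (· ∈ A)] :
    iprod (fun l => if X l ω ∈ A then c else 1) = countPow c (pointCount X A ω) := by
  have hfin : {k | X k ω ∈ A}.Finite := Set.encard_ne_top_iff.1 h
  rw [countPow, if_neg h]
  refine tendsto_nhds_unique (tendsto_iprod fun l => by split_ifs <;> simp [hc]) ?_
  refine tendsto_const_nhds.congr' ?_
  obtain ⟨m, hm⟩ := hfin.bddAbove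
  filter_upwards [eventually_gt_atTop m] with n hn
  rw [Finset.prod_ite, Finset.prod_const, Finset.prod_const_one, mul_one]
  congr 1
  rw [pointCount, hfin.encard_eq_coe_toFinset_card, ENat.toNat_natCast]
  congr 1
  ext k
  simp only [Set.Finite.mem_toFinset, Set.mem_ofPred_eq, Finset.mem_filter, Finset.mem_range]
  exact ⟨fun hk => ⟨(hm hk).trans_lt hn, hk⟩, fun hk => hk.2⟩

section Counts

variable {Ω : Type*} [MeasurableSpace Ω] {μ : Measure Ω} {X : ℕ → Ω → Plane} {lam : ℝ}

lemma measurable_pointCount (hX : ∀ k, Measurable (X k)) {A : Set Plane} (hA : MeasurableSet A) :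
    Measurable (pointCount X A) := by
  refine measurable_to_countable' fun n => ?_
  have h : pointCount X A ⁻¹' {n} =
      {ω | ∑' k, A.indicator (fun _ => (1 : ℝ≥0∞)) (X k ω) = (n : ℝ≥0∞)} := by
    ext ω
    simp only [Set.mem_preimage, Set.mem_singleton_iff, Set.mem_ofPred_eq,
      ← pointCount_toENNReal, ENat.toENNReal_inj]
  rw [h]
  refine measurableSet_eq_fun (Measurable.tsum fun k => ?_) measurable_const
  exact (measurable_const.indicator hA).comp (hX k)

/-- The probability generating function of the Poisson law of mean `a`, from the exponential series
at `a * c`. -/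
lemma hasSum_poisson_weight (a c : ℝ) :
    HasSum (fun n : ℕ => c ^ n * (Real.exp (-a) * a ^ n / (n.factorial : ℝ)))
      (Real.exp (-(a * (1 - c)))) := by
  have h := (NormedSpace.expSeries_div_hasSum_exp (𝔸 := ℝ) (a * c)).mul_left (Real.exp (-a))
  rw [← Real.exp_eq_exp_ℝ, ← Real.exp_add] at h
  have e : -(a * (1 - c)) = -a + a * c := by ring
  rw [e]
  refine h.congr_fun fun n => ?_
  rw [mul_pow]; ring

namespace IsHPPP

/-- The count law prescribes only the finite values. Their probabilities sum to one, so the count is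
almost surely finite, and the mean of any function of it is the corresponding series. -/
lemma lintegral_count_eq_tsum [IsProbabilityMeasure μ] (hX : IsHPPP μ X lam) (hlam : 0 ≤ lam)
    {A : Set Plane} (hA : MeasurableSet A) (hA' : volume A ≠ ∞) (g : ℕ∞ → ℝ≥0∞) :
    (∀ᵐ ω ∂μ, pointCount X A ω ≠ ⊤) ∧ ∫⁻ ω, g (pointCount X A ω) ∂μ =
      ∑' n : ℕ, g n * ENNReal.ofReal (Real.exp (-(lam * volume.real A)) *
        (lam * volume.real A) ^ n / (n.factorial : ℝ)) := by
  have hm := measurable_pointCount hX.measurable hA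
  set a := lam * volume.real A with ha
  have ha0 : 0 ≤ a := mul_nonneg hlam measureReal_nonneg
  have hs : ∑' n : ℕ, μ {ω | pointCount X A ω = n} = 1 := by
    simp_rw [hX.count_law A hA hA']
    rw [← ENNReal.ofReal_tsum_of_nonneg (fun n => by positivity)]
    · have := (hasSum_poisson_weight a 1).tsum_eq
      simp only [one_pow, one_mul, sub_self, mul_zero, neg_zero, Real.exp_zero] at this
      rw [← ha, this, ENNReal.ofReal_one]
    · simpa using (hasSum_poisson_weight a 1).summable
  have hU : μ (⋃ n : ℕ, {ω | pointCount X A ω = n}) = 1 := by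
    rw [measure_iUnion (f := fun n : ℕ => {ω | pointCount X A ω = n}) _
      (fun n => hm (measurableSet_singleton (n : ℕ∞))), hs]
    intro i j hij
    refine Set.disjoint_left.2 fun ω (h1 : _ = _) (h2 : _ = _) => hij ?_
    rw [h1] at h2
    exact_mod_cast h2
  have hae : ∀ᵐ ω ∂μ, pointCount X A ω ≠ ⊤ := by
    have := (prob_compl_eq_zero_iff (μ := μ)
      (MeasurableSet.iUnion fun n : ℕ => hm (measurableSet_singleton (n : ℕ∞)))).2 hU
    refine measure_mono_null ?_ this
    intro ω hω
    simp only [Set.mem_compl_iff, Set.mem_ofPred_eq, not_not] at hω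
    simp [hω]
  refine ⟨hae, ?_⟩
  have h1 : ∫⁻ ω, g (pointCount X A ω) ∂μ =
      ∫⁻ ω, g ((pointCount X A ω).toNat : ℕ∞) ∂μ := by
    refine lintegral_congr_ae ?_
    filter_upwards [hae] with ω hω
    rw [ENat.natCast_toNat hω]
  have hm' : Measurable fun ω => (pointCount X A ω).toNat :=
    Measurable.of_discrete.comp hm
  rw [h1, ← lintegral_map (f := fun n : ℕ => g (n : ℕ∞)) Measurable.of_discrete hm',
    lintegral_countable']
  congr 1; ext n
  rw [Measure.map_apply hm' (measurableSet_singleton n), ← hX.count_law A hA hA' n]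
  congr 1
  refine measure_congr ?_
  filter_upwards [hae] with ω hω
  refine propext ?_
  change (pointCount X A ω).toNat = n ↔ pointCount X A ω = n
  constructor
  · intro h; rw [← h, ENat.natCast_toNat hω]
  · intro h; rw [h]; rfl

end IsHPPP

namespace IsHPPP

variable [IsProbabilityMeasure μ]

lemma lintegral_countPow (hX : IsHPPP μ X lam) (hlam : 0 ≤ lam)
    {A : Set Plane} (hA : MeasurableSet A) (hA' : volume A ≠ ∞) {c : ℝ≥0∞} (hc : c ≤ 1) :
    ∫⁻ ω, countPow c (pointCount X A ω) ∂μ =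
      expNeg (ENNReal.ofReal lam * ((1 - c) * volume A)) := by
  have hct : c ≠ ∞ := (hc.trans_lt ENNReal.one_lt_top).ne
  have hc1 : c.toReal ≤ 1 := by simpa using ENNReal.toReal_mono ENNReal.one_ne_top hc
  rw [(hX.lintegral_count_eq_tsum hlam hA hA' _).2]
  have h1 : ∀ n : ℕ, countPow c n * ENNReal.ofReal (Real.exp (-(lam * volume.real A)) *
        (lam * volume.real A) ^ n / (n.factorial : ℝ)) = ENNReal.ofReal (c.toReal ^ n *
        (Real.exp (-(lam * volume.real A)) *
        (lam * volume.real A) ^ n / (n.factorial : ℝ))) := by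
    intro n
    rw [countPow, if_neg (by simp), ENNReal.ofReal_mul (by positivity),
      ENNReal.ofReal_pow (by positivity), ENNReal.ofReal_toReal hct]
    rfl
  have hv : 0 ≤ lam * volume.real A := mul_nonneg hlam measureReal_nonneg
  simp_rw [h1]
  rw [← ENNReal.ofReal_tsum_of_nonneg (fun n => by positivity)
    (hasSum_poisson_weight _ _).summable, (hasSum_poisson_weight _ _).tsum_eq,
    ← expNeg_ofReal (mul_nonneg hv (by linarith)), ENNReal.ofReal_mul hv, ENNReal.ofReal_mul hlam,
    Measure.real, ENNReal.ofReal_toReal hA', ENNReal.ofReal_sub _ (by positivity),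
    ENNReal.ofReal_toReal hct, ENNReal.ofReal_one, mul_assoc, mul_comm (volume A)]

lemma lintegral_count (hX : IsHPPP μ X lam) (hlam : 0 ≤ lam)
    {A : Set Plane} (hA : MeasurableSet A) (hA' : volume A ≠ ∞) :
    ∫⁻ ω, (pointCount X A ω : ℝ≥0∞) ∂μ = ENNReal.ofReal lam * volume A := by
  rw [(hX.lintegral_count_eq_tsum hlam hA hA' (fun n => (n : ℝ≥0∞))).2]
  have hv : 0 ≤ lam * volume.real A := mul_nonneg hlam measureReal_nonneg
  set a := lam * volume.real A with ha
  rw [tsum_eq_zero_add' ENNReal.summable]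
  have h1 : ∀ n : ℕ, (((n + 1 : ℕ) : ℕ∞) : ℝ≥0∞) * ENNReal.ofReal (Real.exp (-a) *
        a ^ (n + 1) / ((n + 1).factorial : ℝ)) = ENNReal.ofReal (a * ((1 : ℝ) ^ n *
        (Real.exp (-a) * a ^ n / (n.factorial : ℝ)))) := by
    intro n
    have h2 : (((n + 1 : ℕ) : ℕ∞) : ℝ≥0∞) = ENNReal.ofReal ((n + 1 : ℕ) : ℝ) := by
      rw [ENNReal.ofReal_natCast]; rfl
    rw [h2, ← ENNReal.ofReal_mul (by positivity)]
    congr 1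
    rw [Nat.factorial_succ]
    have := n.factorial_pos
    push_cast
    field_simp
    ring
  simp_rw [h1]
  rw [← ENNReal.ofReal_tsum_of_nonneg (fun n => by positivity)
    ((hasSum_poisson_weight _ _).summable.mul_left a),
    ((hasSum_poisson_weight a 1).mul_left a).tsum_eq]
  simp only [Nat.cast_zero, ENat.toENNReal_zero, zero_mul, zero_add, sub_self, mul_zero, neg_zero,
    Real.exp_zero, mul_one]
  rw [ha, ENNReal.ofReal_mul hlam, Measure.real, ENNReal.ofReal_toReal hA']

/-- The probability of exactly one point in a region, used for the lower bound in the Mecke formula.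
-/
lemma lintegral_count_eq_one (hX : IsHPPP μ X lam) (hlam : 0 ≤ lam)
    {A : Set Plane} (hA : MeasurableSet A) (hA' : volume A ≠ ∞) :
    ∫⁻ ω, (if pointCount X A ω = 1 then 1 else 0) ∂μ =
      ENNReal.ofReal lam * volume A * expNeg (ENNReal.ofReal lam * volume A) := by
  rw [(hX.lintegral_count_eq_tsum hlam hA hA' (fun n => if n = 1 then 1 else 0)).2]
  rw [tsum_eq_single 1 (fun n hn => by simp [hn])]
  have hv : 0 ≤ lam * volume.real A := mul_nonneg hlam measureReal_nonneg
  have h1 : ENNReal.ofReal lam * volume A = ENNReal.ofReal (lam * volume.real A) := by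
    rw [ENNReal.ofReal_mul hlam, Measure.real, ENNReal.ofReal_toReal hA']
  rw [h1, expNeg_ofReal hv, ← ENNReal.ofReal_mul hv]
  simp [mul_comm]

/-- The number of points in a cell is independent of a product over the points of the other cells
of a finite partition, and the mean of the latter is explicit. -/
lemma lintegral_label (hX : IsHPPP μ X lam) (hlam : 0 ≤ lam) {q : Plane → ℕ} (hq : Measurable q)
    {m : ℕ} (hm : 0 < m) (hvol : ∀ i < m, volume (q ⁻¹' {i}) ≠ ∞) {c : ℕ → ℝ≥0∞}
    (hc : ∀ i, c i ≤ 1) (hc0 : c 0 = 1) (hcm : ∀ i, m ≤ i → c i = 1) (g : ℕ∞ → ℝ≥0∞) :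
    ∫⁻ ω, g (pointCount X (q ⁻¹' {0}) ω) * iprod (fun l => c (q (X l ω))) ∂μ =
      (∫⁻ ω, g (pointCount X (q ⁻¹' {0}) ω) ∂μ) *
        expNeg (ENNReal.ofReal lam * ∫⁻ y, (1 - c (q y))) := by
  classical
  have hA : ∀ i, MeasurableSet (q ⁻¹' {i}) := fun i => hq (measurableSet_singleton i)
  have hind : iIndepFun (fun i : Fin m => pointCount X (q ⁻¹' {(i : ℕ)})) μ := by
    refine hX.count_indep m _ (fun i => hA i) fun i j hij => ?_
    refine Set.disjoint_left.2 fun y (h1 : _ = _) (h2 : _ = _) => hij (Fin.ext ?_)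
    rw [← h1, ← h2]
  -- Cell `0` carries `g`, and its power factor is harmless because `c 0 = 1`. The other cells
  -- contribute powers of their counts. Labels from `m` on have weight one, so their cells, possibly
  -- of infinite area, drop out.
  let G : Fin m → ℕ∞ → ℝ≥0∞ := fun i n => (if (i : ℕ) = 0 then g n else 1) * countPow (c i) n
  have hGm : ∀ i, Measurable (G i) := fun i => Measurable.of_discrete
  have hfin : ∀ᵐ ω ∂μ, ∀ i : Fin m, pointCount X (q ⁻¹' {(i : ℕ)}) ω ≠ ⊤ :=
    ae_all_iff.2 fun i => (hX.lintegral_count_eq_tsum hlam (hA i) (hvol i i.2) 0).1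
  have hcp1 : ∀ n : ℕ∞, n ≠ ⊤ → countPow 1 n = 1 := fun n hn => by simp [countPow, hn]
  have hpath : ∀ᵐ ω ∂μ, g (pointCount X (q ⁻¹' {0}) ω) * iprod (fun l => c (q (X l ω))) =
      ∏ i : Fin m, G i (pointCount X (q ⁻¹' {(i : ℕ)}) ω) := by
    filter_upwards [hfin] with ω hω
    have h1 : ∀ s : Finset ℕ, iprod (fun l => ∏ i ∈ s, if q (X l ω) = i then c i else 1) =
        ∏ i ∈ s, iprod (fun l => if q (X l ω) = i then c i else 1) := by
      intro s
      induction s using Finset.induction_on with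
      | empty => simp [iprod_one]
      | insert i s hi ih =>
        simp_rw [Finset.prod_insert hi]
        rw [iprod_mul, ih]
        · intro l; split_ifs <;> simp [hc]
        · intro l
          exact Finset.prod_le_one' fun i _ => by split_ifs <;> simp [hc]
    have h2 : (fun l => c (q (X l ω))) =
        fun l => ∏ i ∈ Finset.range m, if q (X l ω) = i then c i else 1 := by
      ext l
      rw [Finset.prod_ite_eq]
      split_ifs with h
      · rfl
      · exact hcm _ (by simpa using h)
    rw [h2, h1, ← Fin.prod_univ_eq_prod_range (fun i => iprod fun l =>
      if q (X l ω) = i then c i else 1) m, Finset.prod_mul_distrib]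
    congr 1
    · rw [Finset.prod_eq_single ⟨0, hm⟩]
      · simp
      · intro i _ hi
        rw [if_neg fun h => hi (Fin.ext h)]
      · simp
    · refine Finset.prod_congr rfl fun i _ => ?_
      rw [← iprod_ite_mem (hω i) (hc i)]
      congr 1
      ext l
      exact if_congr Iff.rfl rfl rfl
  rw [lintegral_congr_ae hpath]
  have h4 := lintegral_prod_eq_prod_lintegral_of_indepFun Finset.univ
    (fun i ω => G i (pointCount X (q ⁻¹' {(i : ℕ)}) ω)) (hind.comp G hGm)
    (fun i => (hGm i).comp (measurable_pointCount hX.measurable (hA i)))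
  rw [h4]
  have h5 : ∀ i : Fin m, ∫⁻ ω, G i (pointCount X (q ⁻¹' {(i : ℕ)}) ω) ∂μ =
      (if (i : ℕ) = 0 then ∫⁻ ω, g (pointCount X (q ⁻¹' {0}) ω) ∂μ else 1) *
        expNeg (ENNReal.ofReal lam * ((1 - c i) * volume (q ⁻¹' {(i : ℕ)}))) := by
    intro i
    by_cases hi : (i : ℕ) = 0
    · have : ∀ᵐ ω ∂μ, G i (pointCount X (q ⁻¹' {(i : ℕ)}) ω) =
          g (pointCount X (q ⁻¹' {0}) ω) := by
        filter_upwards [hfin] with ω hω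
        have := hω i
        simp only [G, hi, if_true, hc0] at this ⊢
        rw [hcp1 _ this, mul_one]
      rw [lintegral_congr_ae this, hi, hc0]
      simp [expNeg_zero]
    · simp only [G, if_neg hi, one_mul]
      exact hX.lintegral_countPow hlam (hA i) (hvol i i.2) (hc i)
  simp_rw [h5]
  rw [Finset.prod_mul_distrib]
  congr 1
  · rw [Finset.prod_eq_single ⟨0, hm⟩]
    · simp
    · intro i _ hi
      rw [if_neg fun h => hi (Fin.ext h)]
    · simp
  · rw [← expNeg_sum, ← Finset.mul_sum,
      ← lintegral_map (f := fun i => 1 - c i) Measurable.of_discrete hq, lintegral_countable',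
      Fin.sum_univ_eq_sum_range (fun i => (1 - c i) * volume (q ⁻¹' {i})) m]
    rw [tsum_eq_sum (s := Finset.range m)]
    · congr 3; ext i; rw [Measure.map_apply hq (measurableSet_singleton i)]
    · intro i hi
      rw [hcm i (by simpa using hi)]; simp

end IsHPPP

end Counts

/-! ### Product functionals of a Poisson process -/

section Products

variable {Ω : Type*} [MeasurableSpace Ω] {μ : Measure Ω} {X : ℕ → Ω → Plane} {lam : ℝ}

/-- Upper dyadic approximation of a function with values in `[0, 1]`. -/
def dyadicUp (n : ℕ) (x : ℝ) : ℝ := min 1 ((⌊2 ^ n * x⌋₊ + 1 : ℕ) / 2 ^ n)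

/-- Halving the grid gives `⌊2 y⌋ ≤ 2 ⌊y⌋ + 1`. Approximation from above is chosen so that the
products decrease to their limit. -/
lemma dyadicUp_antitone {x : ℝ} (hx : 0 ≤ x) : Antitone fun n => dyadicUp n x := by
  refine antitone_nat_of_succ_le fun n => min_le_min le_rfl ?_
  have h1 : ⌊2 ^ (n + 1) * x⌋₊ ≤ 2 * ⌊2 ^ n * x⌋₊ + 1 := by
    rw [← Nat.lt_succ_iff, Nat.floor_lt (by positivity)]
    have := Nat.lt_floor_add_one (2 ^ n * x)
    push_cast
    rw [pow_succ]
    linarith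
  rw [div_le_div_iff₀ (by positivity) (by positivity), pow_succ]
  have h2 : ((⌊2 ^ (n + 1) * x⌋₊ + 1 : ℕ) : ℝ) ≤ 2 * (⌊2 ^ n * x⌋₊ + 1 : ℕ) := by
    have : ⌊2 ^ (n + 1) * x⌋₊ + 1 ≤ 2 * (⌊2 ^ n * x⌋₊ + 1) := by omega
    exact_mod_cast this
  rw [pow_succ] at h2
  nlinarith [pow_pos (zero_lt_two (α := ℝ)) n]

lemma le_dyadicUp {x : ℝ} (hx1 : x ≤ 1) (n : ℕ) : x ≤ dyadicUp n x := by
  refine le_min hx1 ?_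
  rw [le_div_iff₀ (by positivity)]
  have := Nat.lt_floor_add_one (2 ^ n * x)
  push_cast
  linarith

lemma dyadicUp_le {x : ℝ} (hx : 0 ≤ x) (n : ℕ) : dyadicUp n x ≤ x + (1 / 2) ^ n := by
  refine (min_le_right _ _).trans ?_
  rw [div_le_iff₀ (by positivity)]
  have := Nat.floor_le (show 0 ≤ 2 ^ n * x by positivity)
  push_cast
  rw [add_mul, ← mul_pow]
  norm_num
  linarith

lemma tendsto_dyadicUp {x : ℝ} (hx : 0 ≤ x) (hx1 : x ≤ 1) :
    Tendsto (fun n => dyadicUp n x) atTop (𝓝 x) := by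
  refine tendsto_of_tendsto_of_tendsto_of_le_of_le tendsto_const_nhds ?_
    (fun n => le_dyadicUp hx1 n) (fun n => dyadicUp_le hx n)
  simpa using (tendsto_pow_atTop_nhds_zero_of_lt_one (r := (1 / 2 : ℝ))
    (by norm_num) (by norm_num)).const_add x

namespace IsHPPP

/-- The generating functional of a Poisson process, together with an independent count. -/
lemma lintegral_count_mul_iprod [IsProbabilityMeasure μ] (hX : IsHPPP μ X lam) (hlam : 0 ≤ lam)
    {B : Set Plane} (hB : MeasurableSet B) (hB' : volume B ≠ ∞) {v : Plane → ℝ≥0∞}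
    (hv : Measurable v) (hv1 : ∀ y, v y ≤ 1) (hvB : ∀ y ∈ B, v y = 1) {g : ℕ∞ → ℝ≥0∞}
    (hg : ∫⁻ ω, g (pointCount X B ω) ∂μ ≠ ∞) :
    ∫⁻ ω, g (pointCount X B ω) * iprod (fun l => v (X l ω)) ∂μ =
      (∫⁻ ω, g (pointCount X B ω) ∂μ) * expNeg (ENNReal.ofReal lam * ∫⁻ y, (1 - v y)) := by
  classical
  -- Points of `B` get label `0`, points of the disc of radius `n` the dyadic level of `v` plus one,
  -- all others `2 ^ n + 2`. Division by `2 ^ n` recovers the upper approximation of `v` in the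
  -- disc, and the last label is truncated to weight one.
  let q : ℕ → Plane → ℕ := fun n y => if y ∈ B then 0 else if ‖y‖ ≤ n then
    ⌊2 ^ n * (v y).toReal⌋₊ + 1 else 2 ^ n + 2
  let c : ℕ → ℕ → ℝ≥0∞ := fun n i => if i = 0 then 1 else ENNReal.ofReal (min 1 ((i : ℝ) / 2 ^ n))
  have hqm : ∀ n, Measurable (q n) := fun n => by
    refine Measurable.ite hB measurable_const (Measurable.ite ?_ ?_ measurable_const)
    · exact measurableSet_le measurable_norm measurable_const
    · exact (Nat.measurable_floor.comp (hv.ennreal_toReal.const_mul _)).add_const 1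
  have hvt : ∀ y, (v y).toReal ≤ 1 := fun y => by
    simpa using ENNReal.toReal_mono ENNReal.one_ne_top (hv1 y)
  have hq0 : ∀ n, q n ⁻¹' {0} = B := fun n => by
    ext y
    simp only [Set.mem_preimage, Set.mem_singleton_iff, q]
    by_cases h : y ∈ B
    · simp [h]
    · simp only [h, if_false, iff_false]; split_ifs <;> simp
  have hc1 : ∀ n i, c n i ≤ 1 := fun n i => by
    simp only [c]; split_ifs
    · exact le_rfl
    · exact ENNReal.ofReal_le_one.2 (min_le_left _ _)
  have hcv : ∀ n y, c n (q n y) = if y ∈ B then 1 else if ‖y‖ ≤ n then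
      ENNReal.ofReal (dyadicUp n (v y).toReal) else 1 := fun n y => by
    simp only [c, q]
    by_cases h : y ∈ B
    · simp [h]
    · simp only [h, if_false]
      split_ifs with h1 h2 h3
      · simp at h2
      · rfl
      · rfl
      · rw [min_eq_left, ENNReal.ofReal_one]
        rw [le_div_iff₀ (by positivity)]
        push_cast; linarith
  have hstep : ∀ n, ∫⁻ ω, g (pointCount X B ω) * iprod (fun l => c n (q n (X l ω))) ∂μ =
      (∫⁻ ω, g (pointCount X B ω) ∂μ) *
        expNeg (ENNReal.ofReal lam * ∫⁻ y, (1 - c n (q n y))) := fun n => by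
    have := hX.lintegral_label hlam (hqm n) (m := 2 ^ n + 2) (Nat.succ_pos _) ?_ (c := c n) (hc1 n)
      (by simp [c]) ?_ g
    · simpa only [hq0 n] using this
    · intro i hi
      by_cases h0 : i = 0
      · rw [h0, hq0 n]; exact hB'
      · refine ((measure_mono ?_).trans_lt
          (measure_closedBall_lt_top (x := (0 : Plane)) (r := n))).ne
        intro y hy
        simp only [Set.mem_preimage, Set.mem_singleton_iff, q] at hy
        rw [mem_closedBall_zero_iff]
        by_contra h
        split_ifs at hy <;> omega
    · intro i hi
      simp only [c]
      rw [if_neg (by have := Nat.two_pow_pos n; omega), min_eq_left, ENNReal.ofReal_one]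
      rw [le_div_iff₀ (by positivity), one_mul]
      have : ((2 ^ n : ℕ) : ℝ) ≤ i := by exact_mod_cast (by omega)
      simpa using this
  -- Refining the levels and enlarging the disc both only lower the weights.
  have hanti : ∀ y, Antitone fun n => c n (q n y) := fun y => by
    intro n n' hn
    simp only [hcv]
    split_ifs with h1 h2 h3 h4
    · exact le_rfl
    · exact ENNReal.ofReal_le_ofReal (dyadicUp_antitone ENNReal.toReal_nonneg hn)
    · exact ENNReal.ofReal_le_one.2 (min_le_left _ _)
    · exact absurd (h4.trans (by exact_mod_cast hn)) h2
    · exact le_rfl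
  have hlim : ∀ y, ⨅ n, c n (q n y) = v y := fun y => by
    refine tendsto_nhds_unique (tendsto_atTop_iInf (hanti y)) ?_
    by_cases h : y ∈ B
    · refine tendsto_const_nhds.congr fun n => ?_
      rw [hcv, if_pos h, hvB y h]
    · have h1 := ENNReal.tendsto_ofReal
        (tendsto_dyadicUp (x := (v y).toReal) ENNReal.toReal_nonneg (hvt y))
      rw [ENNReal.ofReal_toReal ((hv1 y).trans_lt ENNReal.one_lt_top).ne] at h1
      refine h1.congr' ?_
      filter_upwards [eventually_ge_atTop ⌈‖y‖⌉₊] with n hn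
      rw [hcv, if_neg h, if_pos (Nat.ceil_le.1 hn)]
  have hcm : ∀ n, Measurable fun y => c n (q n y) :=
    fun n => (Measurable.of_discrete (f := c n)).comp (hqm n)
  have hgm : Measurable fun ω => g (pointCount X B ω) :=
    Measurable.of_discrete.comp (measurable_pointCount hX.measurable hB)
  -- Decreasing convergence under the integral needs a finite integral to start from; this is where
  -- `hg` enters.
  have hL : ⨅ n, ∫⁻ ω, g (pointCount X B ω) * iprod (fun l => c n (q n (X l ω))) ∂μ =
      ∫⁻ ω, g (pointCount X B ω) * iprod (fun l => v (X l ω)) ∂μ := by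
    rw [← lintegral_iInf_ae (μ := μ)]
    · refine lintegral_congr_ae ?_
      filter_upwards [ae_lt_top hgm hg] with ω hω
      rw [← ENNReal.mul_iInf (fun h => absurd h hω.ne),
        iprod_iInf (fun n l => hc1 n _) (fun l => hanti (X l ω))]
      simp_rw [hlim]
    · exact fun n => hgm.mul (measurable_iprod fun l => (hcm n).comp (hX.measurable l))
    · intro n
      filter_upwards with ω
      exact mul_le_mul_right (iprod_mono fun l => hanti _ (Nat.le_succ n)) _
    · refine ne_top_of_le_ne_top hg (lintegral_mono fun ω => ?_)
      exact mul_le_of_le_one_right' (iprod_le_one _)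
  rw [← hL]
  simp_rw [hstep]
  rw [← ENNReal.mul_iInf (fun h => absurd h hg), ← expNeg_iSup]
  · congr 2
    rw [← ENNReal.mul_iSup, ← lintegral_iSup]
    · congr 2; ext y
      rw [← hlim y, ENNReal.sub_iInf]
    · exact fun n => measurable_const.sub (hcm n)
    · exact fun n n' hn y => tsub_le_tsub_left (hanti y hn) 1
  · intro n n' hn
    exact mul_le_mul_right (lintegral_mono fun y => tsub_le_tsub_left (hanti y hn) 1) _

lemma lintegral_iprod [IsProbabilityMeasure μ] (hX : IsHPPP μ X lam) (hlam : 0 ≤ lam)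
    {v : Plane → ℝ≥0∞} (hv : Measurable v) (hv1 : ∀ y, v y ≤ 1) :
    ∫⁻ ω, iprod (fun l => v (X l ω)) ∂μ = expNeg (ENNReal.ofReal lam * ∫⁻ y, (1 - v y)) := by
  simpa using hX.lintegral_count_mul_iprod hlam MeasurableSet.empty (by simp) hv hv1 (by simp)
    (g := fun _ => 1) (by simp)

end IsHPPP

end Products

/-- Integration of a radial function over the plane. -/
lemma lintegral_norm_plane (f : ℝ → ℝ≥0∞) (hf : Measurable f) :
    ∫⁻ y : Plane, f ‖y‖ = ∫⁻ r in Set.Ioi (0 : ℝ), ENNReal.ofReal (2 * Real.pi * r) * f r := by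
  have hfr : Module.finrank ℝ Plane = 2 := by simp
  calc ∫⁻ y : Plane, f ‖y‖
      = ∫⁻ y : ({(0)}ᶜ : Set Plane), f ‖y.1‖ ∂((volume : Measure Plane).comap (↑)) := by
        rw [lintegral_subtype_comap (measurableSet_singleton _).compl fun x : Plane => f ‖x‖,
          restrict_compl_singleton]
    _ = ∫⁻ x, f x.2 ∂(volume : Measure Plane).toSphere.prod
          (.volumeIoiPow (Module.finrank ℝ Plane - 1)) := by
        have := (volume : Measure Plane).measurePreserving_homeomorphUnitSphereProd.lintegral_comp_emb
          (Homeomorph.measurableEmbedding _) (f ∘ Subtype.val ∘ Prod.snd)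
        simpa using this
    _ = (volume : Measure Plane).toSphere Set.univ *
          ∫⁻ x : Set.Ioi (0 : ℝ), f x ∂.volumeIoiPow (Module.finrank ℝ Plane - 1) := by
        have hm : Measurable fun x : Set.Ioi (0 : ℝ) => f x := hf.comp measurable_subtype_coe
        have h := lintegral_prod (μ := (volume : Measure Plane).toSphere)
          (ν := .volumeIoiPow (Module.finrank ℝ Plane - 1))
          (fun x : Metric.sphere (0 : Plane) 1 × Set.Ioi (0 : ℝ) => f x.2)
          (hm.comp measurable_snd).aemeasurable
        rw [h]
        simp [mul_comm]
    _ = _ := by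
        have hm : Measurable fun x : Set.Ioi (0 : ℝ) => f x := hf.comp measurable_subtype_coe
        rw [Measure.volumeIoiPow, lintegral_withDensity_eq_lintegral_mul _ (by fun_prop) hm, Measure.toSphere_apply_univ, hfr]
        simp only [Pi.mul_apply]
        rw [lintegral_subtype_comap measurableSet_Ioi
          (fun a : ℝ => ENNReal.ofReal (a ^ (2 - 1)) * f a), ← lintegral_const_mul _ (by fun_prop)]
        refine setLIntegral_congr_fun measurableSet_Ioi fun r hr => ?_
        rw [← mul_assoc]
        congr 1
        rw [EuclideanSpace.volume_ball_fin_two, mul_assoc 2 Real.pi, ENNReal.ofReal_mul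
          (by norm_num), ENNReal.ofReal_mul Real.pi_pos.le]
        simp [mul_assoc]

/-! ### The Mecke formula, by squeezing between thin annuli -/

section Mecke

variable {Ω : Type*} [MeasurableSpace Ω] {μ : Measure Ω} [IsProbabilityMeasure μ]
  {X : ℕ → Ω → Plane} {lam : ℝ}

/-- The annuli `j h ≤ ‖y‖² < (j + 1) h`, all of area `π h`. -/
def annulus (h : ℝ) (j : ℕ) : Set Plane := {y | ⌊‖y‖ ^ 2 / h⌋₊ = j}

lemma measurableSet_annulus (h : ℝ) (j : ℕ) : MeasurableSet (annulus h j) := by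
  have : Measurable fun y : Plane => ⌊‖y‖ ^ 2 / h⌋₊ :=
    Nat.measurable_floor.comp ((measurable_norm.pow_const 2).div_const h)
  exact this (measurableSet_singleton j)

lemma mem_annulus {h : ℝ} (hh : 0 < h) {j : ℕ} {y : Plane} :
    y ∈ annulus h j ↔ √(j * h) ≤ ‖y‖ ∧ ‖y‖ < √((j + 1 : ℕ) * h) := by
  change ⌊‖y‖ ^ 2 / h⌋₊ = j ↔ _
  rw [Nat.floor_eq_iff (by positivity), le_div_iff₀ hh, div_lt_iff₀ hh, Real.sqrt_le_left
    (norm_nonneg _), Real.lt_sqrt (norm_nonneg _)]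
  push_cast
  rfl

lemma volume_annulus {h : ℝ} (hh : 0 < h) (j : ℕ) :
    volume (annulus h j) = ENNReal.ofReal (Real.pi * h) := by
  have h1 : annulus h j = Metric.ball (0 : Plane) √((j + 1 : ℕ) * h) \
      Metric.ball (0 : Plane) √(j * h) := by
    ext y
    rw [mem_annulus hh]
    simp [and_comm]
  rw [h1, measure_sdiff _ measurableSet_ball.nullMeasurableSet measure_ball_lt_top.ne,
    EuclideanSpace.volume_ball_fin_two, EuclideanSpace.volume_ball_fin_two,
    ← ENNReal.ofReal_pow (by positivity), ← ENNReal.ofReal_pow (by positivity),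
    Real.sq_sqrt (by positivity), Real.sq_sqrt (by positivity),
    ← ENNReal.ofReal_mul (by positivity), ← ENNReal.ofReal_mul (by positivity),
    ← ENNReal.ofReal_sub _ (by positivity)]
  · congr 1; push_cast; ring
  · refine Metric.ball_subset_ball (Real.sqrt_le_sqrt ?_)
    push_cast; nlinarith

lemma tsum_indicator_annulus (h : ℝ) (y : Plane) (c : ℝ≥0∞) :
    ∑' j, (annulus h j).indicator (fun _ => c) y = c := by
  rw [tsum_eq_single ⌊‖y‖ ^ 2 / h⌋₊]
  · have : y ∈ annulus h ⌊‖y‖ ^ 2 / h⌋₊ := rfl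
    rw [Set.indicator_of_mem this]
  · intro j hj
    exact Set.indicator_of_notMem (fun hy => hj hy.symm) _

namespace IsHPPP

/-- By monotonicity, each point of the annulus may be moved to the inner radius, and the factors of
the points inside the annulus may be raised to one. What remains is the count of the annulus times a
product over the points outside, which are independent. -/
lemma lintegral_annulus_le (hX : IsHPPP μ X lam) (hlam : 0 ≤ lam) {v : ℝ → Plane → ℝ≥0∞}
    (hv : Measurable (Function.uncurry v)) (hv1 : ∀ r y, v r y ≤ 1)
    (hva : ∀ y, AntitoneOn (fun r => v r y) (Set.Ici 0)) {φ : ℝ → ℝ≥0∞}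
    (hφa : AntitoneOn φ (Set.Ici 0)) {h : ℝ} (hh : 0 < h) (j : ℕ) :
    expNeg (ENNReal.ofReal (lam * (Real.pi * h))) *
      ∫⁻ ω, ∑' k, (annulus h j).indicator (fun _ => φ ‖X k ω‖ *
        iprod fun l => if l = k then 1 else v ‖X k ω‖ (X l ω)) (X k ω) ∂μ ≤
      ENNReal.ofReal (lam * (Real.pi * h)) * (φ √(j * h) *
        expNeg (ENNReal.ofReal lam * ∫⁻ y, (1 - v √(j * h) y))) := by
  classical
  set a := √(j * h) with ha
  have ha0 : 0 ≤ a := Real.sqrt_nonneg _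
  set B := annulus h j with hB
  have hBm : MeasurableSet B := measurableSet_annulus h j
  have hBv : ENNReal.ofReal lam * volume B = ENNReal.ofReal (lam * (Real.pi * h)) := by
    rw [volume_annulus hh, ENNReal.ofReal_mul hlam]
  let w : Plane → ℝ≥0∞ := fun y => if y ∈ B then 1 else v a y
  have hvam : Measurable (v a) := hv.comp (measurable_const.prodMk measurable_id)
  have hw : Measurable w := Measurable.ite hBm measurable_const hvam
  have hw1 : ∀ y, w y ≤ 1 := fun y => by simp only [w]; split_ifs <;> simp [hv1]
  have h1 : ∀ ω, ∑' k, B.indicator (fun _ => φ ‖X k ω‖ *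
        iprod fun l => if l = k then 1 else v ‖X k ω‖ (X l ω)) (X k ω) ≤
      φ a * ((pointCount X B ω : ℝ≥0∞) * iprod fun l => w (X l ω)) := by
    intro ω
    rw [pointCount_toENNReal, ← ENNReal.tsum_mul_right, ← ENNReal.tsum_mul_left]
    refine ENNReal.tsum_le_tsum fun k => ?_
    by_cases hk : X k ω ∈ B
    · rw [Set.indicator_of_mem hk, Set.indicator_of_mem hk, one_mul]
      have hr := ((mem_annulus hh).1 hk).1
      refine mul_le_mul' (hφa ha0 (ha0.trans hr) hr) (iprod_mono fun l => ?_)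
      simp only [w]
      split_ifs with hl h2 h2
      · exact le_rfl
      · subst hl; exact absurd hk h2
      · exact hv1 _ _
      · exact hva _ ha0 (ha0.trans hr) hr
    · rw [Set.indicator_of_notMem hk]; exact zero_le
  have hgm : Measurable fun ω => (pointCount X B ω : ℝ≥0∞) * iprod fun l => w (X l ω) :=
    ((Measurable.of_discrete (f := ENat.toENNReal)).comp
      (measurable_pointCount hX.measurable hBm)).mul
      (measurable_iprod fun l => hw.comp (hX.measurable l))
  have hBv' : volume B ≠ ∞ := by rw [volume_annulus hh]; exact ENNReal.ofReal_ne_top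
  have h2 := hX.lintegral_count_mul_iprod hlam hBm hBv' hw hw1
    (fun y hy => by simp [w, hy]) (g := ENat.toENNReal)
    (by rw [hX.lintegral_count hlam hBm hBv', hBv]; exact ENNReal.ofReal_ne_top)
  rw [hX.lintegral_count hlam hBm hBv', hBv] at h2
  -- The removed factors satisfy `1 - v ≤ 1` on the annulus, so putting them back costs at most the
  -- exponential of minus its mean count.
  have h3 : expNeg (ENNReal.ofReal (lam * (Real.pi * h))) *
      expNeg (ENNReal.ofReal lam * ∫⁻ y, (1 - w y)) ≤
      expNeg (ENNReal.ofReal lam * ∫⁻ y, (1 - v a y)) := by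
    rw [← expNeg_add]
    refine expNeg_antitone ?_
    rw [← hBv, ← mul_add]
    refine mul_le_mul_right ?_ _
    rw [← lintegral_indicator_one hBm, ← lintegral_add_left (measurable_one.indicator hBm)]
    refine lintegral_mono fun y => ?_
    simp only [w]
    by_cases hy : y ∈ B
    · simp [hy]
    · simp [hy]
  calc _ ≤ expNeg (ENNReal.ofReal (lam * (Real.pi * h))) * (φ a *
        (ENNReal.ofReal (lam * (Real.pi * h)) *
          expNeg (ENNReal.ofReal lam * ∫⁻ y, (1 - w y)))) := by
        refine mul_le_mul_right ((lintegral_mono h1).trans ?_) _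
        rw [lintegral_const_mul _ hgm, h2]
    _ = ENNReal.ofReal (lam * (Real.pi * h)) * (φ a * (expNeg (ENNReal.ofReal (lam * (Real.pi * h))) *
          expNeg (ENNReal.ofReal lam * ∫⁻ y, (1 - w y)))) := by ring
    _ ≤ _ := by gcongr

/-- Only the event of exactly one point in the annulus is kept. Then the other points all lie
outside it, and the outer radius bounds every factor from below. The probability of this event
produces the exponential on the left. -/
lemma le_lintegral_annulus (hX : IsHPPP μ X lam) (hlam : 0 ≤ lam) {v : ℝ → Plane → ℝ≥0∞}
    (hv : Measurable (Function.uncurry v)) (hv1 : ∀ r y, v r y ≤ 1)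
    (hva : ∀ y, AntitoneOn (fun r => v r y) (Set.Ici 0)) {φ : ℝ → ℝ≥0∞}
    (hφa : AntitoneOn φ (Set.Ici 0)) {h : ℝ} (hh : 0 < h) (j : ℕ) :
    expNeg (ENNReal.ofReal (lam * (Real.pi * h))) * (ENNReal.ofReal (lam * (Real.pi * h)) *
      (φ √((j + 1 : ℕ) * h) *
        expNeg (ENNReal.ofReal lam * ∫⁻ y, (1 - v √((j + 1 : ℕ) * h) y)))) ≤
      ∫⁻ ω, ∑' k, (annulus h j).indicator (fun _ => φ ‖X k ω‖ *
        iprod fun l => if l = k then 1 else v ‖X k ω‖ (X l ω)) (X k ω) ∂μ := by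
  classical
  set a := √((j + 1 : ℕ) * h) with ha
  have ha0 : 0 ≤ a := Real.sqrt_nonneg _
  set B := annulus h j with hB
  have hBm : MeasurableSet B := measurableSet_annulus h j
  have hBv : ENNReal.ofReal lam * volume B = ENNReal.ofReal (lam * (Real.pi * h)) := by
    rw [volume_annulus hh, ENNReal.ofReal_mul hlam]
  let w : Plane → ℝ≥0∞ := fun y => if y ∈ B then 1 else v a y
  have hvam : Measurable (v a) := hv.comp (measurable_const.prodMk measurable_id)
  have hw : Measurable w := Measurable.ite hBm measurable_const hvam
  have hw1 : ∀ y, w y ≤ 1 := fun y => by simp only [w]; split_ifs <;> simp [hv1]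
  have h1 : ∀ ω, φ a * ((if pointCount X B ω = 1 then 1 else 0) * iprod fun l => w (X l ω)) ≤
      ∑' k, B.indicator (fun _ => φ ‖X k ω‖ *
        iprod fun l => if l = k then 1 else v ‖X k ω‖ (X l ω)) (X k ω) := by
    intro ω
    split_ifs with hc
    · rw [one_mul]
      obtain ⟨k, hk⟩ := Set.encard_eq_one.1 hc
      have hkB : X k ω ∈ B := by
        have : k ∈ {k | X k ω ∈ B} := by rw [hk]; rfl
        exact this
      refine le_trans ?_ (ENNReal.le_tsum k)
      rw [Set.indicator_of_mem hkB]
      have hr := ((mem_annulus hh).1 hkB).2.le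
      refine mul_le_mul' (hφa (norm_nonneg _) ha0 hr) (iprod_mono fun l => ?_)
      simp only [w]
      split_ifs with h2 hl hl
      · exact le_rfl
      · have : l ∈ {k | X k ω ∈ B} := h2
        rw [hk] at this
        exact absurd this hl
      · exact hv1 _ _
      · exact hva _ (norm_nonneg _) ha0 hr
    · simp
  have hgm : Measurable fun ω => (if pointCount X B ω = 1 then 1 else 0) *
      iprod fun l => w (X l ω) :=
    ((Measurable.of_discrete (f := fun n : ℕ∞ => if n = 1 then (1 : ℝ≥0∞) else 0)).comp
      (measurable_pointCount hX.measurable hBm)).mul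
      (measurable_iprod fun l => hw.comp (hX.measurable l))
  have hBv' : volume B ≠ ∞ := by rw [volume_annulus hh]; exact ENNReal.ofReal_ne_top
  have h2 := hX.lintegral_count_mul_iprod hlam hBm hBv' hw hw1
    (fun y hy => by simp [w, hy]) (g := fun n => if n = 1 then 1 else 0)
    (by rw [hX.lintegral_count_eq_one hlam hBm hBv', hBv]
        exact ENNReal.mul_ne_top ENNReal.ofReal_ne_top (expNeg_ne_top _))
  rw [hX.lintegral_count_eq_one hlam hBm hBv', hBv] at h2
  calc _ ≤ expNeg (ENNReal.ofReal (lam * (Real.pi * h))) * (ENNReal.ofReal (lam * (Real.pi * h)) *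
      (φ a * expNeg (ENNReal.ofReal lam * ∫⁻ y, (1 - w y)))) := by
        gcongr
        refine expNeg_antitone (mul_le_mul_right (lintegral_mono fun y => ?_) _)
        simp only [w]
        split_ifs <;> simp
    _ = φ a * (ENNReal.ofReal (lam * (Real.pi * h)) * expNeg (ENNReal.ofReal (lam * (Real.pi * h))) *
        expNeg (ENNReal.ofReal lam * ∫⁻ y, (1 - w y))) := by ring
    _ ≤ _ := by
        rw [← h2, ← lintegral_const_mul _ hgm]
        exact lintegral_mono h1

/-- Annuli of equal area give Riemann sums of a decreasing function: both `I` and the integral lie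
between the lower and the upper sum, up to a factor tending to one as `h → 0`. -/
lemma squeeze_annuli {f : ℝ → ℝ≥0∞} (hf0 : f 0 ≤ 1) (hf : AntitoneOn f (Set.Ici 0))
    (hlam : 0 ≤ lam) {I : ℝ≥0∞}
    (hub : ∀ h > 0, expNeg (ENNReal.ofReal (lam * (Real.pi * h))) * I ≤
      ∑' j : ℕ, ENNReal.ofReal (lam * (Real.pi * h)) * f √(j * h))
    (hlb : ∀ h > 0, ∑' j : ℕ, expNeg (ENNReal.ofReal (lam * (Real.pi * h))) *
      (ENNReal.ofReal (lam * (Real.pi * h)) * f √((j + 1 : ℕ) * h)) ≤ I) :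
    I = ENNReal.ofReal lam * ∫⁻ y : Plane, f ‖y‖ := by
  set T := ENNReal.ofReal lam * ∫⁻ y : Plane, f ‖y‖ with hT
  have hTs : ∀ h : ℝ, T = ∑' j, ENNReal.ofReal lam * ∫⁻ y in annulus h j, f ‖y‖ := by
    intro h
    rw [ENNReal.tsum_mul_left, hT, ← lintegral_iUnion (measurableSet_annulus h)]
    · congr 1
      rw [← setLIntegral_univ]
      congr 2
      symm
      exact Set.eq_univ_of_forall fun y => Set.mem_iUnion.2 ⟨_, rfl⟩
    · intro i j hij
      exact Set.disjoint_left.2 fun y (h1 : _ = _) (h2 : _ = _) => hij (h1.symm.trans h2)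
  have hT1 : ∀ h > 0, T ≤ ∑' j : ℕ, ENNReal.ofReal (lam * (Real.pi * h)) * f √(j * h) := by
    intro h hh
    rw [hTs h]
    refine ENNReal.tsum_le_tsum fun j => ?_
    rw [ENNReal.ofReal_mul hlam, mul_assoc, ← volume_annulus hh j, mul_comm (volume _),
      ← setLIntegral_const]
    refine mul_le_mul_right (setLIntegral_mono' (measurableSet_annulus h j) fun y hy => ?_) _
    have := ((mem_annulus hh).1 hy).1
    exact hf (Real.sqrt_nonneg _) (norm_nonneg _) this
  have hT2 : ∀ h > 0, ∑' j : ℕ, ENNReal.ofReal (lam * (Real.pi * h)) * f √((j + 1 : ℕ) * h) ≤ T := by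
    intro h hh
    rw [hTs h]
    refine ENNReal.tsum_le_tsum fun j => ?_
    rw [ENNReal.ofReal_mul hlam, mul_assoc, ← volume_annulus hh j, mul_comm (volume _),
      ← setLIntegral_const]
    refine mul_le_mul_right (setLIntegral_mono' (measurableSet_annulus h j) fun y hy => ?_) _
    have := ((mem_annulus hh).1 hy).2.le
    exact hf (norm_nonneg _) (Real.sqrt_nonneg _) this
  -- The upper sum is the lower sum shifted by one index, so they differ by the first term alone,
  -- which is at most `λ π h`.
  have hsplit : ∀ h > 0, ∑' j : ℕ, ENNReal.ofReal (lam * (Real.pi * h)) * f √(j * h) ≤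
      ENNReal.ofReal (lam * (Real.pi * h)) +
      ∑' j : ℕ, ENNReal.ofReal (lam * (Real.pi * h)) * f √((j + 1 : ℕ) * h) := by
    intro h hh
    rw [tsum_eq_zero_add' ENNReal.summable]
    gcongr
    refine mul_le_of_le_one_right' ?_
    simpa using hf0
  have hd : Tendsto (fun n : ℕ => ENNReal.ofReal (lam * (Real.pi * (1 / ((n : ℝ) + 1))))) atTop
      (𝓝 0) := by
    rw [← ENNReal.ofReal_zero]
    refine ENNReal.tendsto_ofReal ?_
    simpa using (tendsto_one_div_add_atTop_nhds_zero_nat.const_mul Real.pi).const_mul lam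
  have he : Tendsto (fun n : ℕ => expNeg (ENNReal.ofReal (lam * (Real.pi * (1 / ((n : ℝ) + 1))))))
      atTop (𝓝 1) := by
    rw [← expNeg_zero]
    exact (continuous_expNeg.tendsto 0).comp hd
  have hpos : ∀ n : ℕ, 0 < 1 / ((n : ℝ) + 1) := fun n => by positivity
  refine le_antisymm ?_ ?_
  · have h1 := ENNReal.Tendsto.mul_const he (b := I) (Or.inl one_ne_zero)
    have h2 := hd.add_const T
    rw [one_mul] at h1
    rw [zero_add] at h2
    refine le_of_tendsto_of_tendsto' h1 h2 fun n => ?_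
    refine (hub _ (hpos n)).trans ((hsplit _ (hpos n)).trans ?_)
    gcongr
    exact hT2 _ (hpos n)
  · have h1 := ENNReal.Tendsto.mul_const he (b := T) (Or.inl one_ne_zero)
    have h2 := hd.add_const I
    rw [one_mul] at h1
    rw [zero_add] at h2
    refine le_of_tendsto_of_tendsto' h1 h2 fun n => ?_
    refine (mul_le_mul_right ((hT1 _ (hpos n)).trans (hsplit _ (hpos n))) _).trans ?_
    rw [mul_add]
    refine add_le_add (mul_le_of_le_one_left' (expNeg_le_one _)) ?_
    rw [← ENNReal.tsum_mul_left]
    exact hlb _ (hpos n)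

/-- A form of the Mecke formula: the mean of a sum over the points `x` of a Poisson process of
products over the other points, for radial factors that decrease with `‖x‖`. -/
theorem lintegral_tsum_iprod (hX : IsHPPP μ X lam) (hlam : 0 ≤ lam) {v : ℝ → Plane → ℝ≥0∞}
    (hv : Measurable (Function.uncurry v)) (hv1 : ∀ r y, v r y ≤ 1)
    (hva : ∀ y, AntitoneOn (fun r => v r y) (Set.Ici 0)) {φ : ℝ → ℝ≥0∞} (hφ : Measurable φ)
    (hφ1 : φ 0 ≤ 1) (hφa : AntitoneOn φ (Set.Ici 0)) :
    ∫⁻ ω, ∑' k, φ ‖X k ω‖ * iprod (fun l => if l = k then 1 else v ‖X k ω‖ (X l ω)) ∂μ =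
      ENNReal.ofReal lam * ∫⁻ x : Plane, φ ‖x‖ *
        expNeg (ENNReal.ofReal lam * ∫⁻ y, (1 - v ‖x‖ y)) := by
  have hFm : ∀ k, Measurable fun ω => φ ‖X k ω‖ *
      iprod (fun l => if l = k then 1 else v ‖X k ω‖ (X l ω)) := fun k => by
    refine (hφ.comp (hX.measurable k).norm).mul (measurable_iprod fun l => ?_)
    by_cases hl : l = k
    · simp [hl]
    · simp only [hl, if_false]
      exact hv.comp ((hX.measurable k).norm.prodMk (hX.measurable l))
  have hsplit : ∀ h : ℝ, ∫⁻ ω, ∑' k, φ ‖X k ω‖ *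
      iprod (fun l => if l = k then 1 else v ‖X k ω‖ (X l ω)) ∂μ =
      ∑' j, ∫⁻ ω, ∑' k, (annulus h j).indicator (fun _ => φ ‖X k ω‖ *
        iprod fun l => if l = k then 1 else v ‖X k ω‖ (X l ω)) (X k ω) ∂μ := fun h => by
    rw [← lintegral_tsum]
    · congr 1; ext ω
      rw [ENNReal.tsum_comm]
      congr 1; ext k
      rw [tsum_indicator_annulus]
    · intro j
      refine (Measurable.tsum fun k => ?_).aemeasurable
      have : (fun ω => (annulus h j).indicator (fun _ => φ ‖X k ω‖ *
        iprod fun l => if l = k then 1 else v ‖X k ω‖ (X l ω)) (X k ω)) =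
        (X k ⁻¹' annulus h j).indicator (fun ω => φ ‖X k ω‖ *
        iprod fun l => if l = k then 1 else v ‖X k ω‖ (X l ω)) := by
        ext ω; rfl
      rw [this]
      exact (hFm k).indicator (hX.measurable k (measurableSet_annulus h j))
  refine squeeze_annuli (f := fun r => φ r * expNeg (ENNReal.ofReal lam * ∫⁻ y, (1 - v r y)))
    ?_ ?_ hlam ?_ ?_
  · exact mul_le_one' hφ1 (expNeg_le_one _)
  · intro r hr s hs hrs
    refine mul_le_mul' (hφa hr hs hrs) (expNeg_antitone (mul_le_mul_right ?_ _))
    exact lintegral_mono fun y => tsub_le_tsub_left (hva y hr hs hrs) 1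
  · intro h hh
    rw [hsplit h, ← ENNReal.tsum_mul_left]
    exact ENNReal.tsum_le_tsum fun j => hX.lintegral_annulus_le hlam hv hv1 hva hφa hh j
  · intro h hh
    rw [hsplit h]
    exact ENNReal.tsum_le_tsum fun j => hX.le_lintegral_annulus hlam hv hv1 hva hφa hh j

end IsHPPP

end Mecke

/-! ### Independence and the integration of marks -/

section Independence

variable {Ω β γ δ : Type*} [MeasurableSpace Ω] [MeasurableSpace β] [MeasurableSpace γ]
  [MeasurableSpace δ] {μ : Measure Ω} [IsProbabilityMeasure μ]

lemma Measurable.comp_two {α : Type*} [MeasurableSpace α] {f : β → γ → δ}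
    (hf : Measurable (Function.uncurry f)) {y : α → β} {z : α → γ} (hy : Measurable y)
    (hz : Measurable z) : Measurable fun x => f (y x) (z x) := hf.comp (hy.prodMk hz)

lemma Measurable.comp_three {α ε : Type*} [MeasurableSpace α] [MeasurableSpace ε]
    {f : β → γ → δ → ε} (hf : Measurable fun z : β × γ × δ => f z.1 z.2.1 z.2.2) {y : α → β}
    {z : α → γ} {t : α → δ} (hy : Measurable y) (hz : Measurable z) (ht : Measurable t) :
    Measurable fun x => f (y x) (z x) (t x) := hf.comp (hy.prodMk (hz.prodMk ht))

/-- Fubini for a pair of independent variables, written with a second copy of the sample space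
instead of the two laws. -/
lemma lintegral_indepFun {Y : Ω → β} {Z : Ω → γ} (hY : Measurable Y) (hZ : Measurable Z)
    (h : IndepFun Y Z μ) {F : β → γ → ℝ≥0∞} (hF : Measurable (Function.uncurry F)) :
    ∫⁻ ω, F (Y ω) (Z ω) ∂μ = ∫⁻ ω, ∫⁻ ω', F (Y ω) (Z ω') ∂μ ∂μ := by
  have h1 := (indepFun_iff_map_prod_eq_prod_map_map hY.aemeasurable hZ.aemeasurable).1 h
  have : IsProbabilityMeasure (μ.map Z) := Measure.isProbabilityMeasure_map hZ.aemeasurable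
  have h2 := lintegral_map (μ := μ) (f := Function.uncurry F) (g := fun ω => (Y ω, Z ω)) hF
    (hY.prodMk hZ)
  have h3 : ∫⁻ ω, F (Y ω) (Z ω) ∂μ = ∫⁻ z, Function.uncurry F z ∂(μ.map fun ω => (Y ω, Z ω)) :=
    h2.symm
  rw [h3, h1, lintegral_prod _ hF.aemeasurable, lintegral_map hF.lintegral_prod_right' hY]
  congr 1; ext ω
  exact lintegral_map (f := fun y => Function.uncurry F (Y ω, y))
    (hF.comp (measurable_const.prodMk measurable_id)) hZ

/-- Associativity of product measures. Iterating it, the independence of one variable from a growing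
collection of others is built up one component at a time. -/
lemma indepFun_prodMk_assoc {Y : Ω → β} {Z : Ω → γ} {W : Ω → δ} (hY : Measurable Y)
    (hZ : Measurable Z) (hW : Measurable W) (h : IndepFun Y Z μ)
    (h' : IndepFun (fun ω => (Y ω, Z ω)) W μ) : IndepFun Y (fun ω => (Z ω, W ω)) μ := by
  have h1 := (indepFun_iff_map_prod_eq_prod_map_map hY.aemeasurable hZ.aemeasurable).1 h
  have h2 := (indepFun_iff_map_prod_eq_prod_map_map (hY.prodMk hZ).aemeasurable
    hW.aemeasurable).1 h'
  have h3 := (indepFun_iff_map_prod_eq_prod_map_map hZ.aemeasurable hW.aemeasurable).1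
    (h'.comp measurable_snd measurable_id)
  have : IsProbabilityMeasure (μ.map Z) := Measure.isProbabilityMeasure_map hZ.aemeasurable
  have : IsProbabilityMeasure (μ.map W) := Measure.isProbabilityMeasure_map hW.aemeasurable
  have : IsProbabilityMeasure (μ.map Y) := Measure.isProbabilityMeasure_map hY.aemeasurable
  refine (indepFun_iff_map_prod_eq_prod_map_map hY.aemeasurable
    (hZ.prodMk hW).aemeasurable).2 ?_
  have h3' : μ.map (fun ω => (Z ω, W ω)) = (μ.map Z).prod (μ.map W) := h3
  rw [h3', ← Measure.prodAssoc_prod, ← h1, ← h2,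
    Measure.map_map (MeasurableEquiv.measurable _) ((hY.prodMk hZ).prodMk hW)]
  rfl

/-- Independent marks may be integrated out of a product over the points. -/
lemma lintegral_iprod_marks {M : ℕ → Ω → β} (hM : ∀ l, Measurable (M l)) (hind : iIndepFun M μ)
    {Y : Ω → γ} (hY : Measurable Y) (hYM : IndepFun Y (fun ω l => M l ω) μ)
    {g : γ → ℝ≥0∞} (hg : Measurable g) {w : ℕ → γ → β → ℝ≥0∞}
    (hw : ∀ l, Measurable (Function.uncurry (w l))) (hw1 : ∀ l y b, w l y b ≤ 1) :
    ∫⁻ ω, g (Y ω) * iprod (fun l => w l (Y ω) (M l ω)) ∂μ =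
      ∫⁻ ω, g (Y ω) * iprod (fun l => ∫⁻ b, w l (Y ω) b ∂(μ.map (M l))) ∂μ := by
  have hwm : ∀ l y, Measurable (w l y) := fun l y =>
    (hw l).comp (measurable_const.prodMk measurable_id)
  have hMs : Measurable fun ω l => M l ω := measurable_pi_iff.2 hM
  have h1 := lintegral_indepFun hY hMs hYM
    (F := fun y m => g y * iprod fun l => w l y (m l)) (by
      refine (hg.comp measurable_fst).mul (measurable_iprod fun l => ?_)
      exact (hw l).comp_two measurable_fst ((measurable_pi_apply l).comp measurable_snd))
  rw [h1]
  congr 1; ext ω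
  have hmeas : ∀ n, Measurable fun ω' => ∏ l ∈ Finset.range n, w l (Y ω) (M l ω') := fun n =>
    Finset.measurable_fun_prod _ fun l _ => (hwm l _).comp (hM l)
  have hip : Measurable fun ω' => iprod fun l => w l (Y ω) (M l ω') :=
    measurable_iprod fun l => (hwm l _).comp (hM l)
  rw [lintegral_const_mul _ hip]
  congr 1
  simp only [iprod]
  rw [lintegral_iInf hmeas]
  · congr 1; ext n
    rw [lintegral_prod_eq_prod_lintegral_of_indepFun (Finset.range n)
      (fun l ω' => w l (Y ω) (M l ω')) (hind.comp (fun l => w l (Y ω)) fun l => hwm l _)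
      fun l => (hwm l _).comp (hM l)]
    exact Finset.prod_congr rfl fun l _ => (lintegral_map (hwm l _) (hM l)).symm
  · exact fun n n' hn ω' => antitone_prod_range (fun l => hw1 l _ _) hn
  · simp

end Independence

/-! ### Two independent marked Poisson processes -/

section TwoTiers

variable {Ω β : Type*} [MeasurableSpace Ω] [MeasurableSpace β] {μ : Measure Ω}
  [IsProbabilityMeasure μ] {X X' : ℕ → Ω → Plane} {M M' : ℕ → Ω → β} {lam lam' : ℝ}

/-- With the marks integrated out, each point contributes the mean of its factor, which by `hv` is
the same function of the position for all indices. -/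
lemma lintegral_iprod_marked (hX : IsHPPP μ X lam) (hlam : 0 ≤ lam) (hM : ∀ l, Measurable (M l))
    (hind : iIndepFun M μ) (hXM : IndepFun (fun ω l => X l ω) (fun ω l => M l ω) μ)
    {w : Plane → β → ℝ≥0∞} (hw : Measurable (Function.uncurry w)) (hw1 : ∀ y b, w y b ≤ 1)
    {v : Plane → ℝ≥0∞} (hv : ∀ l y, ∫⁻ b, w y b ∂(μ.map (M l)) = v y) :
    ∫⁻ ω, iprod (fun l => w (X l ω) (M l ω)) ∂μ =
      expNeg (ENNReal.ofReal lam * ∫⁻ y, (1 - v y)) := by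
  have : ∀ l, IsProbabilityMeasure (μ.map (M l)) := fun l =>
    Measure.isProbabilityMeasure_map (hM l).aemeasurable
  have hvm : Measurable v := by
    have : v = fun y => ∫⁻ b, w y b ∂(μ.map (M 0)) := by ext y; rw [hv]
    rw [this]; exact hw.lintegral_prod_right
  have hv1 : ∀ y, v y ≤ 1 := fun y => by
    rw [← hv 0 y]
    exact (lintegral_mono fun b => hw1 y b).trans (by simp)
  have h1 := lintegral_iprod_marks (w := fun l (x : ℕ → Plane) b => w (x l) b) hM hind
    (measurable_pi_iff.2 hX.measurable) hXM measurable_one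
    (fun l => hw.comp_two ((measurable_pi_apply l).comp measurable_fst) measurable_snd)
    (fun l y b => hw1 _ _)
  simp only [Pi.one_apply, one_mul, hv] at h1
  rw [h1, hX.lintegral_iprod hlam hvm hv1]

/-- The mean of a sum over the points of one of two independent marked Poisson processes, of
products over all the other points of both. -/
theorem lintegral_tsum_marked (hX : IsHPPP μ X lam) (hlam : 0 ≤ lam) (hX' : IsHPPP μ X' lam')
    (hlam' : 0 ≤ lam') (hM : ∀ l, Measurable (M l)) (hM' : ∀ l, Measurable (M' l))
    (hind : iIndepFun M μ) (hind' : iIndepFun M' μ)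
    (hXM : IndepFun (fun ω l => X l ω) (fun ω l => M l ω) μ)
    (hXM' : IndepFun (fun ω l => X' l ω) (fun ω l => M' l ω) μ)
    (htiers : IndepFun (fun ω => ((fun l => X l ω), (fun l => M l ω)))
      (fun ω => ((fun l => X' l ω), (fun l => M' l ω))) μ)
    {ψ : ℝ → ℝ≥0∞} (hψ : Measurable ψ) (hψ1 : ψ 0 ≤ 1) (hψa : AntitoneOn ψ (Set.Ici 0))
    {a : β → ℝ≥0∞} (ha : Measurable a) (ha1 : ∀ b, a b ≤ 1) {A : ℝ≥0∞}
    (hA : ∀ l, ∫⁻ b, a b ∂(μ.map (M l)) = A)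
    {w w' : ℝ → Plane → β → ℝ≥0∞} (hw : Measurable fun z : ℝ × Plane × β => w z.1 z.2.1 z.2.2)
    (hw' : Measurable fun z : ℝ × Plane × β => w' z.1 z.2.1 z.2.2)
    (hw1 : ∀ r y b, w r y b ≤ 1) (hw1' : ∀ r y b, w' r y b ≤ 1)
    (hwa : ∀ y b, AntitoneOn (fun r => w r y b) (Set.Ici 0))
    (hwa' : ∀ y b, AntitoneOn (fun r => w' r y b) (Set.Ici 0))
    {v v' : ℝ → Plane → ℝ≥0∞} (hv : ∀ l r y, ∫⁻ b, w r y b ∂(μ.map (M l)) = v r y)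
    (hv' : ∀ l r y, ∫⁻ b, w' r y b ∂(μ.map (M' l)) = v' r y) :
    ∫⁻ ω, ∑' k, ψ ‖X k ω‖ * (a (M k ω) *
        iprod (fun l => if l = k then 1 else w ‖X k ω‖ (X l ω) (M l ω)) *
        iprod (fun l => w' ‖X k ω‖ (X' l ω) (M' l ω))) ∂μ =
      A * ENNReal.ofReal lam * ∫⁻ x : Plane, ψ ‖x‖ *
        expNeg (ENNReal.ofReal lam' * ∫⁻ y, (1 - v' ‖x‖ y)) *
        expNeg (ENNReal.ofReal lam * ∫⁻ y, (1 - v ‖x‖ y)) := by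
  have : ∀ l, IsProbabilityMeasure (μ.map (M l)) := fun l =>
    Measure.isProbabilityMeasure_map (hM l).aemeasurable
  have : ∀ l, IsProbabilityMeasure (μ.map (M' l)) := fun l =>
    Measure.isProbabilityMeasure_map (hM' l).aemeasurable
  have hXs : Measurable fun ω l => X l ω := measurable_pi_iff.2 hX.measurable
  have hMs : Measurable fun ω l => M l ω := measurable_pi_iff.2 hM
  have hXs' : Measurable fun ω l => X' l ω := measurable_pi_iff.2 hX'.measurable
  have hMs' : Measurable fun ω l => M' l ω := measurable_pi_iff.2 hM'
  have hassoc : Measurable fun z : (ℝ × Plane) × β => (z.1.1, z.1.2, z.2) := by fun_prop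
  have hvm : Measurable (Function.uncurry v) := by
    have : Function.uncurry v = fun z : ℝ × Plane => ∫⁻ b, w z.1 z.2 b ∂(μ.map (M 0)) := by
      ext z; rw [hv]; rfl
    rw [this]; exact (hw.comp hassoc).lintegral_prod_right'
  have hvm' : Measurable (Function.uncurry v') := by
    have : Function.uncurry v' = fun z : ℝ × Plane => ∫⁻ b, w' z.1 z.2 b ∂(μ.map (M' 0)) := by
      ext z; rw [hv']; rfl
    rw [this]; exact (hw'.comp hassoc).lintegral_prod_right'
  have hv1 : ∀ r y, v r y ≤ 1 := fun r y => by
    rw [← hv 0 r y]; exact (lintegral_mono fun b => hw1 r y b).trans (by simp)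
  have hva : ∀ y, AntitoneOn (fun r => v r y) (Set.Ici 0) := fun y r hr s hs hrs => by
    simp only [← hv 0]; exact lintegral_mono fun b => hwa y b hr hs hrs
  have hva' : ∀ y, AntitoneOn (fun r => v' r y) (Set.Ici 0) := fun y r hr s hs hrs => by
    simp only [← hv' 0]; exact lintegral_mono fun b => hwa' y b hr hs hrs
  have hA1 : A ≤ 1 := by
    rw [← hA 0]; exact (lintegral_mono fun b => ha1 b).trans (by simp)
  -- The mean contribution of the other tier depends on the serving point only through its distance,
  -- so it joins `ψ` as a decreasing radial factor.
  set φ : ℝ → ℝ≥0∞ := fun r => expNeg (ENNReal.ofReal lam' * ∫⁻ y, (1 - v' r y)) with hφ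
  have hφm : Measurable φ :=
    measurable_expNeg.comp ((measurable_const.sub hvm').lintegral_prod_right.const_mul _)
  -- The mark factor of the serving point is put into the free slot `l = k`, so that all marks can
  -- be integrated out of one product.
  let W : ℕ → ℕ → (ℕ → Plane) → β → ℝ≥0∞ := fun k l x b =>
    if l = k then a b else w ‖x k‖ (x l) b
  have hW1 : ∀ k l x b, W k l x b ≤ 1 := fun k l x b => by
    simp only [W]; split_ifs
    · exact ha1 b
    · exact hw1 _ _ _
  have hWm : ∀ k l, Measurable (Function.uncurry (W k l)) := fun k l => by
    by_cases h : l = k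
    · simp only [W, h, if_true, Function.uncurry_def]; exact ha.comp measurable_snd
    · simp only [W, h, if_false, Function.uncurry_def]
      exact hw.comp_three ((measurable_pi_apply k).comp measurable_fst).norm
        ((measurable_pi_apply l).comp measurable_fst) measurable_snd
  have hpw : ∀ k ω, ψ ‖X k ω‖ * (a (M k ω) *
        iprod (fun l => if l = k then 1 else w ‖X k ω‖ (X l ω) (M l ω)) *
        iprod (fun l => w' ‖X k ω‖ (X' l ω) (M' l ω))) =
      ψ ‖X k ω‖ * (iprod (fun l => W k l (fun j => X j ω) (M l ω)) *
        iprod (fun l => w' ‖X k ω‖ (X' l ω) (M' l ω))) := fun k ω => by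
    rw [← iprod_ite k (a (M k ω)) (ha1 _) (fun l => hw1 _ _ _)]
    congr 3; ext l
    simp only [W]
    split_ifs with h
    · rw [h]
    · rfl
  have hFm : ∀ k, Measurable fun z : ((ℕ → Plane) × (ℕ → β)) × ((ℕ → Plane) × (ℕ → β)) =>
      ψ ‖z.1.1 k‖ * (iprod (fun l => W k l z.1.1 (z.1.2 l)) *
        iprod (fun l => w' ‖z.1.1 k‖ (z.2.1 l) (z.2.2 l))) := fun k => by
    refine (hψ.comp (by fun_prop)).mul ((measurable_iprod fun l => ?_).mul
      (measurable_iprod fun l => ?_))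
    · exact (hWm k l).comp_two (by fun_prop) (by fun_prop)
    · exact hw'.comp_three (by fun_prop) (by fun_prop) (by fun_prop)
  have hterm : ∀ k, ∫⁻ ω, ψ ‖X k ω‖ * (iprod (fun l => W k l (fun j => X j ω) (M l ω)) *
        iprod (fun l => w' ‖X k ω‖ (X' l ω) (M' l ω))) ∂μ =
      A * ∫⁻ ω, (ψ ‖X k ω‖ * φ ‖X k ω‖) *
        iprod (fun l => if l = k then 1 else v ‖X k ω‖ (X l ω)) ∂μ := fun k => by
    rw [lintegral_indepFun (hXs.prodMk hMs) (hXs'.prodMk hMs') htiers (F := fun z z' =>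
      ψ ‖z.1 k‖ * (iprod (fun l => W k l z.1 (z.2 l)) *
        iprod (fun l => w' ‖z.1 k‖ (z'.1 l) (z'.2 l)))) (hFm k)]
    have h1 : ∀ ω, ∫⁻ ω', ψ ‖X k ω‖ * (iprod (fun l => W k l (fun j => X j ω) (M l ω)) *
        iprod (fun l => w' ‖X k ω‖ (X' l ω') (M' l ω'))) ∂μ =
        (ψ ‖X k ω‖ * φ ‖X k ω‖) * iprod (fun l => W k l (fun j => X j ω) (M l ω)) := fun ω => by
      have hm : Measurable fun ω' => iprod (fun l => w' ‖X k ω‖ (X' l ω') (M' l ω')) :=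
        measurable_iprod fun l => hw'.comp (measurable_const.prodMk
          ((hX'.measurable l).prodMk (hM' l)))
      rw [lintegral_const_mul _ (hm.const_mul _), lintegral_const_mul _ hm,
        lintegral_iprod_marked hX' hlam' hM' hind' hXM' (w := w' ‖X k ω‖)
          (hw'.comp (measurable_const.prodMk measurable_id)) (hw1' _) (fun l y => hv' l _ y)]
      ring
    simp_rw [h1]
    have hgm : Measurable fun x : ℕ → Plane => ψ ‖x k‖ * φ ‖x k‖ :=
      (hψ.comp (by fun_prop)).mul (hφm.comp (by fun_prop))
    rw [lintegral_iprod_marks hM hind hXs hXM hgm (hWm k) (hW1 k), ← lintegral_const_mul]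
    · congr 1; ext ω
      rw [mul_left_comm A, ← iprod_ite k A hA1 (fun l => hv1 _ _)]
      congr 2; ext l
      simp only [W]
      split_ifs with h
      · exact hA l
      · exact hv _ _ _
    · refine ((hψ.comp (hX.measurable k).norm).mul (hφm.comp (hX.measurable k).norm)).mul
        (measurable_iprod fun l => ?_)
      by_cases h : l = k
      · simp [h]
      · simp only [h, if_false]
        exact hvm.comp ((hX.measurable k).norm.prodMk (hX.measurable l))
  simp_rw [hpw]
  have hFm' : ∀ k, Measurable fun ω => ψ ‖X k ω‖ * (iprod (fun l => W k l (fun j => X j ω) (M l ω)) *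
        iprod (fun l => w' ‖X k ω‖ (X' l ω) (M' l ω))) := fun k =>
    (hψ.comp (hX.measurable k).norm).mul
      ((measurable_iprod fun l => (hWm k l).comp_two hXs (hM l)).mul
        (measurable_iprod fun l => hw'.comp_three (hX.measurable k).norm (hX'.measurable l) (hM' l)))
  rw [lintegral_tsum fun k => (hFm' k).aemeasurable]
  have hφa : AntitoneOn φ (Set.Ici 0) := fun r hr s hs hrs =>
    expNeg_antitone (mul_le_mul_right (lintegral_mono fun y =>
      tsub_le_tsub_left (hva' y hr hs hrs) 1) _)
  have hφ1 : ψ 0 * φ 0 ≤ 1 := mul_le_one' hψ1 (expNeg_le_one _)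
  have hψφ : AntitoneOn (fun r => ψ r * φ r) (Set.Ici 0) := fun r hr s hs hrs =>
    mul_le_mul' (hψa hr hs hrs) (hφa hr hs hrs)
  have hMecke := hX.lintegral_tsum_iprod hlam hvm hv1 hva (hψ.mul hφm) hφ1 hψφ
  have hGm : ∀ k, Measurable fun ω => (ψ ‖X k ω‖ * φ ‖X k ω‖) *
      iprod (fun l => if l = k then 1 else v ‖X k ω‖ (X l ω)) := fun k => by
    refine ((hψ.comp (hX.measurable k).norm).mul (hφm.comp (hX.measurable k).norm)).mul
        (measurable_iprod fun l => ?_)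
    by_cases h : l = k
    · simp [h]
    · simp only [h, if_false]
      exact hvm.comp_two (hX.measurable k).norm (hX.measurable l)
  rw [tsum_congr hterm, ENNReal.tsum_mul_left, ← lintegral_tsum fun k => (hGm k).aemeasurable,
    mul_assoc]
  exact congrArg (A * ·) hMecke

end TwoTiers

/-! ### Radial integrals -/

lemma lintegral_Ioc_deriv {g g' : ℝ → ℝ} {a b : ℝ} (hab : a ≤ b)
    (hc : ContinuousOn g (Set.Icc a b)) (hd : ∀ x ∈ Set.Ioo a b, HasDerivAt g (g' x) x)
    (hpos : ∀ x ∈ Set.Ioo a b, 0 ≤ g' x) :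
    ∫⁻ x in Set.Ioc a b, ENNReal.ofReal (g' x) = ENNReal.ofReal (g b - g a) := by
  have hi := intervalIntegral.integrableOn_deriv_of_nonneg hc hd hpos
  rw [← ofReal_integral_eq_lintegral_ofReal hi, ← intervalIntegral.integral_of_le hab,
    intervalIntegral.integral_eq_sub_of_hasDerivAt_of_le hab hc hd]
  · exact (intervalIntegrable_iff_integrableOn_Ioc_of_le hab).2 hi
  · rw [← restrict_Ioo_eq_restrict_Ioc]
    filter_upwards [ae_restrict_mem measurableSet_Ioo] with x hx using hpos x hx

lemma lintegral_Ioi_deriv {g g' : ℝ → ℝ} {a l : ℝ} (hc : ContinuousWithinAt g (Set.Ici a) a)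
    (hd : ∀ x ∈ Set.Ioi a, HasDerivAt g (g' x) x) (hpos : ∀ x ∈ Set.Ioi a, 0 ≤ g' x)
    (hl : Tendsto g atTop (𝓝 l)) :
    ∫⁻ x in Set.Ioi a, ENNReal.ofReal (g' x) = ENNReal.ofReal (l - g a) := by
  have hi := integrableOn_Ioi_deriv_of_nonneg hc hd hpos hl
  rw [← ofReal_integral_eq_lintegral_ofReal hi,
    integral_Ioi_of_hasDerivAt_of_nonneg hc hd hpos hl]
  filter_upwards [ae_restrict_mem measurableSet_Ioi] with x hx using hpos x hx

/-- `Ψ` is a function for which `y² Ψ (X / y ^ α)` is a primitive of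
`-2 y (1 + X / y ^ α) ^ (-N)`, normalized at `y = ∞`; the constant `D` describes the behaviour at
`y = 0`. -/
structure IsRadialPrimitive (α : ℝ) (N : ℕ) (D : ℝ) (Ψ : ℝ → ℝ) : Prop where
  continuousOn : ContinuousOn Ψ (Set.Ici 0)
  zero : Ψ 0 = -1
  hasDerivAt : ∀ z, 0 < z → HasDerivAt Ψ (2 / α * (Ψ z + (1 + z) ^ (-(N : ℝ))) / z) z
  tendsto_atTop : Tendsto (fun z => z ^ (-(2 / α)) * Ψ z) atTop (𝓝 (-D))

namespace IsRadialPrimitive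

variable {α D : ℝ} {N : ℕ} {Ψ : ℝ → ℝ}

/-- With `z = X * y ^ (-α)`, the equation for `Ψ` is exactly what cancels `Ψ` from the derivative.
It is only available for `z > 0`, so `X = 0` is separate; there the function vanishes because `Ψ 0 =
-1`. -/
lemma hasDerivAt_radial (h : IsRadialPrimitive α N D Ψ) (hα : 0 < α) {X : ℝ} (hX : 0 ≤ X) {y : ℝ}
    (hy : 0 < y) : HasDerivAt (fun y => y ^ 2 * (1 + Ψ (X * y ^ (-α))))
      (2 * y * (1 - (1 + X * y ^ (-α)) ^ (-(N : ℝ)))) y := by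
  rcases hX.eq_or_lt with rfl | hX
  · simp only [zero_mul, h.zero, add_neg_cancel, mul_zero, add_zero, Real.one_rpow, sub_self]
    exact hasDerivAt_const _ _
  · have hz : 0 < X * y ^ (-α) := mul_pos hX (Real.rpow_pos_of_pos hy _)
    have h1 : HasDerivAt (fun y => X * y ^ (-α)) (X * (-α * y ^ (-α - 1))) y :=
      (Real.hasDerivAt_rpow_const (Or.inl hy.ne')).const_mul X
    have h2 := ((h.hasDerivAt _ hz).comp y h1).const_add 1
    have h3 := (hasDerivAt_pow 2 y).mul h2
    refine h3.congr_deriv ?_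
    have h4 : y ^ (-α - 1) = y ^ (-α) / y := Real.rpow_sub_one hy.ne' _
    simp only [Function.comp_apply]
    rw [h4]
    set t := y ^ (-α) with ht
    have ht0 : t ≠ 0 := (Real.rpow_pos_of_pos hy _).ne'
    push_cast
    field_simp
    ring

lemma one_sub_nonneg {X y : ℝ} (hX : 0 ≤ X) (hy : 0 < y) :
    0 ≤ 2 * y * (1 - (1 + X * y ^ (-α)) ^ (-(N : ℝ))) := by
  have h1 : 1 ≤ 1 + X * y ^ (-α) := by
    have := mul_nonneg hX (Real.rpow_pos_of_pos hy (-α)).le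
    linarith
  have := Real.rpow_le_one_of_one_le_of_nonpos h1 (neg_nonpos.2 (Nat.cast_nonneg N))
  exact mul_nonneg (by positivity) (by linarith)

lemma lintegral_Ioc (h : IsRadialPrimitive α N D Ψ) (hα : 0 < α) {X : ℝ} (hX : 0 ≤ X) {a b : ℝ}
    (ha : 0 < a) (hab : a ≤ b) :
    ∫⁻ y in Set.Ioc a b, ENNReal.ofReal (2 * y * (1 - (1 + X * y ^ (-α)) ^ (-(N : ℝ)))) =
      ENNReal.ofReal (b ^ 2 * (1 + Ψ (X * b ^ (-α))) - a ^ 2 * (1 + Ψ (X * a ^ (-α)))) := by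
  refine lintegral_Ioc_deriv (g := fun y => y ^ 2 * (1 + Ψ (X * y ^ (-α)))) hab ?_ ?_ ?_
  · exact fun y hy => (h.hasDerivAt_radial hα hX (ha.trans_le hy.1)).continuousAt.continuousWithinAt
  · exact fun y hy => h.hasDerivAt_radial hα hX (ha.trans hy.1)
  · exact fun y hy => one_sub_nonneg hX (ha.trans hy.1)

/-- As `y → 0` the argument `z` of `Ψ` tends to infinity, and `y² = X ^ (2 / α) * z ^ (-(2 / α))`
exposes the limit recorded in the structure. -/
lemma tendsto_zero (h : IsRadialPrimitive α N D Ψ) (hα : 0 < α) {X : ℝ} (hX : 0 ≤ X) :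
    Tendsto (fun y => y ^ 2 * (1 + Ψ (X * y ^ (-α)))) (𝓝[>] 0) (𝓝 (-(D * X ^ (2 / α)))) := by
  rcases hX.eq_or_lt with rfl | hX
  · rw [Real.zero_rpow (by positivity)]
    simp [h.zero]
  · have h0 : Tendsto (fun y : ℝ => y ^ 2) (𝓝[>] 0) (𝓝 0) := by
      have : Tendsto (fun y : ℝ => y ^ 2) (𝓝 0) (𝓝 (0 ^ 2)) := (continuous_pow 2).tendsto 0
      rw [zero_pow two_ne_zero] at this
      exact this.mono_left nhdsWithin_le_nhds
    have h1 : Tendsto (fun y : ℝ => X * y ^ (-α)) (𝓝[>] 0) atTop :=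
      (tendsto_rpow_neg_nhdsGT_zero (neg_lt_zero.2 hα)).const_mul_atTop hX
    have h2 := h0.add ((h.tendsto_atTop.comp h1).const_mul (X ^ (2 / α)))
    have e : 0 + X ^ (2 / α) * -D = -(D * X ^ (2 / α)) := by ring
    rw [e] at h2
    refine h2.congr' ?_
    filter_upwards [self_mem_nhdsWithin] with y (hy : 0 < y)
    have h3 : (X * y ^ (-α)) ^ (-(2 / α)) = X ^ (-(2 / α)) * y ^ (2 : ℕ) := by
      rw [Real.mul_rpow hX.le (Real.rpow_pos_of_pos hy _).le, ← Real.rpow_mul hy.le,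
        ← Real.rpow_natCast]
      congr 2
      push_cast
      field_simp
    simp only [Function.comp_apply]
    rw [h3, Real.rpow_neg hX.le]
    have : X ^ (2 / α) ≠ 0 := (Real.rpow_pos_of_pos hX _).ne'
    field_simp

lemma lintegral_Ioc_zero (h : IsRadialPrimitive α N D Ψ) (hα : 0 < α) {X : ℝ} (hX : 0 ≤ X) {b : ℝ}
    (hb : 0 < b) :
    ∫⁻ y in Set.Ioc 0 b, ENNReal.ofReal (2 * y * (1 - (1 + X * y ^ (-α)) ^ (-(N : ℝ)))) =
      ENNReal.ofReal (b ^ 2 * (1 + Ψ (X * b ^ (-α))) + D * X ^ (2 / α)) := by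
  -- At `y = 0` the formula for the primitive evaluates to zero by the convention for `0 ^ (-α)`; it
  -- must be replaced there by its limit.
  have h1 := lintegral_Ioc_deriv (g := fun y => if y = 0 then -(D * X ^ (2 / α)) else
    y ^ 2 * (1 + Ψ (X * y ^ (-α)))) (g' := fun y => 2 * y * (1 - (1 + X * y ^ (-α)) ^ (-(N : ℝ))))
    hb.le ?_ ?_ ?_
  · rw [h1]
    simp [hb.ne']
  · intro y hy
    rcases hy.1.eq_or_lt with rfl | hy0
    · rw [ContinuousWithinAt, if_pos rfl]
      have hle : 𝓝[Set.Icc 0 b] (0 : ℝ) ≤ 𝓝[Set.Ici 0] 0 :=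
        nhdsWithin_mono _ fun x hx => hx.1
      refine Tendsto.mono_left ?_ hle
      rw [← Set.Ioi_insert, nhdsWithin_insert, tendsto_sup]
      constructor
      · rw [tendsto_pure_left]
        intro s hs
        simpa using mem_of_mem_nhds hs
      · refine (h.tendsto_zero hα hX).congr' ?_
        filter_upwards [self_mem_nhdsWithin] with y (hy : 0 < y)
        rw [if_neg hy.ne']
    · refine ContinuousAt.continuousWithinAt ?_
      refine (h.hasDerivAt_radial hα hX hy0).continuousAt.congr ?_
      filter_upwards [lt_mem_nhds hy0] with x hx
      rw [if_neg hx.ne']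
  · intro y hy
    refine (h.hasDerivAt_radial hα hX hy.1).congr_of_eventuallyEq ?_
    filter_upwards [lt_mem_nhds hy.1] with x hx
    rw [if_neg hx.ne']
  · exact fun y hy => one_sub_nonneg hX hy.1

/-- Now `z → 0`. The extra hypothesis says that `1 + Ψ` vanishes faster than `z ^ (2 / α)`. It fails
in the critical case `α = 2`, where the integral up to infinity diverges logarithmically. -/
lemma tendsto_infty (hα : 0 < α)
    (h0 : Tendsto (fun z => z ^ (-(2 / α)) * (1 + Ψ z)) (𝓝[>] 0) (𝓝 0)) {X : ℝ} (hX : 0 < X) :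
    Tendsto (fun y => y ^ 2 * (1 + Ψ (X * y ^ (-α)))) atTop (𝓝 0) := by
  have h1 : Tendsto (fun y : ℝ => X * y ^ (-α)) atTop (𝓝[>] 0) := by
    refine tendsto_nhdsWithin_iff.2 ⟨?_, ?_⟩
    · simpa using (tendsto_rpow_neg_atTop hα).const_mul X
    · filter_upwards [eventually_gt_atTop 0] with y hy
      exact mul_pos hX (Real.rpow_pos_of_pos hy _)
  have h2 := (h0.comp h1).const_mul (X ^ (2 / α))
  rw [mul_zero] at h2
  refine h2.congr' ?_
  filter_upwards [eventually_gt_atTop 0] with y hy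
  have h3 : (X * y ^ (-α)) ^ (-(2 / α)) = X ^ (-(2 / α)) * y ^ (2 : ℕ) := by
    rw [Real.mul_rpow hX.le (Real.rpow_pos_of_pos hy _).le, ← Real.rpow_mul hy.le,
      ← Real.rpow_natCast]
    congr 2
    push_cast
    field_simp
  simp only [Function.comp_apply]
  rw [h3, Real.rpow_neg hX.le]
  have : X ^ (2 / α) ≠ 0 := (Real.rpow_pos_of_pos hX _).ne'
  field_simp

lemma lintegral_Ioi (h : IsRadialPrimitive α N D Ψ) (hα : 0 < α)
    (h0 : Tendsto (fun z => z ^ (-(2 / α)) * (1 + Ψ z)) (𝓝[>] 0) (𝓝 0)) {X : ℝ} (hX : 0 < X)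
    {a : ℝ} (ha : 0 < a) :
    ∫⁻ y in Set.Ioi a, ENNReal.ofReal (2 * y * (1 - (1 + X * y ^ (-α)) ^ (-(N : ℝ)))) =
      ENNReal.ofReal (-(a ^ 2 * (1 + Ψ (X * a ^ (-α))))) := by
  rw [lintegral_Ioi_deriv (g := fun y => y ^ 2 * (1 + Ψ (X * y ^ (-α)))) (l := 0)
    (h.hasDerivAt_radial hα hX.le ha).continuousAt.continuousWithinAt
    (fun y hy => h.hasDerivAt_radial hα hX.le (ha.trans hy))
    (fun y hy => one_sub_nonneg hX.le (ha.trans hy)) (tendsto_infty hα h0 hX), zero_sub]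

end IsRadialPrimitive

/-! ### The hypergeometric function -/

/-- Coefficients of `₂F₁(1, b; c; ·)`. -/
def hypCoeff (b c : ℝ) (n : ℕ) : ℝ :=
  (ascPochhammer ℝ n).eval b * ((ascPochhammer ℝ n).eval c)⁻¹

/-- The Pochhammer symbol of `1` is `n!`, which cancels the factorial. Pfaff's transformation of the
function at hand has `c - a = 1`, so only this case is needed. -/
lemma ordinaryHypergeometric_one (b c w : ℝ) :
    ordinaryHypergeometric 1 b c w = ∑' n, hypCoeff b c n * w ^ n := by
  rw [ordinaryHypergeometric_eq_tsum]
  refine tsum_congr fun n => ?_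
  rw [hypCoeff, ascPochhammer_eval_one, smul_eq_mul]
  have : (n.factorial : ℝ) ≠ 0 := by positivity
  field_simp

lemma hypCoeff_zero (b c : ℝ) : hypCoeff b c 0 = 1 := by simp [hypCoeff]

lemma hypCoeff_pos {b c : ℝ} (hb : 0 < b) (hc : 0 < c) (n : ℕ) : 0 < hypCoeff b c n :=
  mul_pos (ascPochhammer_pos n b hb) (inv_pos.2 (ascPochhammer_pos n c hc))

lemma hypCoeff_succ {b c : ℝ} (hc : 0 < c) (n : ℕ) :
    (c + n) * hypCoeff b c (n + 1) = (b + n) * hypCoeff b c n := by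
  have h1 := (ascPochhammer_pos n c hc).ne'
  have h2 : c + n ≠ 0 := by positivity
  rw [hypCoeff, hypCoeff, ascPochhammer_succ_eval, ascPochhammer_succ_eval]
  field_simp

/-- The ratio of consecutive terms tends to `r`. The extra factor `n + 1` lets one series dominate
both the power series and its termwise derivative. -/
lemma summable_hypCoeff {b c : ℝ} (hb : 0 < b) (hc : 0 < c) {r : ℝ} (hr0 : 0 < r) (hr : r < 1) :
    Summable fun n : ℕ => (n + 1 : ℝ) * hypCoeff b c n * r ^ n := by
  refine summable_of_ratio_test_tendsto_lt_one hr (Eventually.of_forall fun n => ?_) ?_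
  · have := hypCoeff_pos hb hc n
    positivity
  · have hinv := tendsto_inv_atTop_nhds_zero_nat (𝕜 := ℝ)
    have h1 : Tendsto (fun n : ℕ => (1 + 2 * (n : ℝ)⁻¹) / (1 + 1 * (n : ℝ)⁻¹) *
        ((1 + b * (n : ℝ)⁻¹) / (1 + c * (n : ℝ)⁻¹)) * r) atTop (𝓝 ((1 + 2 * 0) / (1 + 1 * 0) *
        ((1 + b * 0) / (1 + c * 0)) * r)) := by
      refine Tendsto.mul_const _ (Tendsto.mul (Tendsto.div ?_ ?_ (by norm_num))
        (Tendsto.div ?_ ?_ (by norm_num)))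
      all_goals exact (hinv.const_mul _).const_add 1
    have e : (1 + 2 * 0) / (1 + 1 * 0) * ((1 + b * 0) / (1 + c * 0)) * r = r := by ring
    rw [e] at h1
    refine h1.congr' ?_
    filter_upwards [eventually_gt_atTop 0] with n hn
    have hn' : (0 : ℝ) < n := by exact_mod_cast hn
    have hp := hypCoeff_pos hb hc n
    have hp' := hypCoeff_pos hb hc (n + 1)
    have hs : hypCoeff b c (n + 1) = (b + n) * hypCoeff b c n / (c + n) := by
      rw [eq_div_iff (by positivity), ← hypCoeff_succ hc]; ring
    rw [Real.norm_of_nonneg (by positivity), Real.norm_of_nonneg (by positivity), hs]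
    push_cast
    field_simp
    ring

lemma summable_hypCoeff_abs {b c : ℝ} (hb : 0 < b) (hc : 0 < c) {w : ℝ} (hw : |w| < 1) :
    (Summable fun n : ℕ => hypCoeff b c n * w ^ n) ∧
      Summable fun n : ℕ => n * hypCoeff b c n * w ^ n := by
  obtain ⟨r, hr, hr1⟩ := exists_between hw
  have hr0 : 0 < r := (abs_nonneg w).trans_lt hr
  have hs := summable_hypCoeff hb hc hr0 hr1
  constructor
  · refine Summable.of_norm_bounded hs fun n => ?_
    have hp := hypCoeff_pos hb hc n
    rw [norm_mul, norm_pow, Real.norm_of_nonneg hp.le, Real.norm_eq_abs]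
    have h1 : |w| ^ n ≤ r ^ n := pow_le_pow_left₀ (abs_nonneg _) hr.le n
    have h2 : hypCoeff b c n ≤ (n + 1) * hypCoeff b c n :=
      le_mul_of_one_le_left hp.le (by linarith [(Nat.cast_nonneg n : (0 : ℝ) ≤ n)])
    exact mul_le_mul h2 h1 (by positivity) (by positivity)
  · refine Summable.of_norm_bounded hs fun n => ?_
    have hp := hypCoeff_pos hb hc n
    rw [norm_mul, norm_pow, Real.norm_of_nonneg (by positivity), Real.norm_eq_abs]
    have h1 : |w| ^ n ≤ r ^ n := pow_le_pow_left₀ (abs_nonneg _) hr.le n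
    have h2 : n * hypCoeff b c n ≤ (n + 1) * hypCoeff b c n :=
      mul_le_mul_of_nonneg_right (by linarith) hp.le
    exact mul_le_mul h2 h1 (by positivity) (by positivity)

lemma hasDerivAt_hyp {b c : ℝ} (hb : 0 < b) (hc : 0 < c) {w : ℝ} (hw : |w| < 1) :
    HasDerivAt (fun w => ∑' n, hypCoeff b c n * w ^ n)
      (∑' n : ℕ, hypCoeff b c n * (n * w ^ (n - 1))) w := by
  obtain ⟨r, hr, hr1⟩ := exists_between hw
  have hr0 : 0 < r := (abs_nonneg w).trans_lt hr
  have hs := (summable_hypCoeff hb hc hr0 hr1).mul_left r⁻¹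
  refine hasDerivAt_tsum_of_isPreconnected (t := Metric.ball (0 : ℝ) r) (y₀ := 0) hs
    Metric.isOpen_ball (convex_ball _ _).isPreconnected
    (fun n y _ => (hasDerivAt_pow n y).const_mul _) ?_ (by simpa using hr0)
    (summable_hypCoeff_abs hb hc (by simp)).1 (by simpa using hr)
  intro n y hy
  have hy' : |y| < r := by simpa using hy
  have hp := hypCoeff_pos hb hc n
  rcases n with _ | n
  · simpa using by positivity
  rw [norm_mul, norm_mul, norm_pow, Real.norm_of_nonneg hp.le, Real.norm_eq_abs y,
    Real.norm_of_nonneg (Nat.cast_nonneg _), Nat.add_sub_cancel, pow_succ]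
  have h1 : |y| ^ n ≤ r ^ n := pow_le_pow_left₀ (abs_nonneg _) hy'.le n
  have h2 : r⁻¹ * (((n + 1 : ℕ) + 1 : ℝ) * hypCoeff b c (n + 1) * (r ^ n * r)) =
      hypCoeff b c (n + 1) * (((n + 1 : ℕ) + 1 : ℝ) * r ^ n) := by
    field_simp
  rw [h2]
  refine mul_le_mul_of_nonneg_left (mul_le_mul ?_ h1 (by positivity) (by positivity)) hp.le
  linarith

/-- Since one parameter equals `1`, the coefficients obey a two-term recursion that amounts to an
inhomogeneous first-order equation. -/
lemma hyp_ode {b β : ℝ} (hb : 0 < b) (hβ : β < 1) {w : ℝ} (hw : |w| < 1) :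
    w * (1 - w) * (∑' n : ℕ, hypCoeff b (1 - β) n * (n * w ^ (n - 1))) -
      b * w * (∑' n, hypCoeff b (1 - β) n * w ^ n) =
      β * (∑' n, hypCoeff b (1 - β) n * w ^ n) - β := by
  have hc : 0 < 1 - β := by linarith
  obtain ⟨s0, s1⟩ := summable_hypCoeff_abs hb hc hw
  set a := hypCoeff b (1 - β) with ha
  have hd : w * ∑' n : ℕ, a n * (n * w ^ (n - 1)) = ∑' n : ℕ, n * a n * w ^ n := by
    rw [← tsum_mul_left]
    congr 1; ext n
    rcases n with _ | n
    · simp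
    · rw [Nat.add_sub_cancel, pow_succ]; ring
  have h1 : ∑' n : ℕ, n * a n * w ^ n = ∑' n : ℕ, (n + 1 : ℝ) * a (n + 1) * w ^ (n + 1) := by
    rw [s1.tsum_eq_zero_add]
    push_cast
    simp
  have h2 : ∑' n : ℕ, a n * w ^ n = 1 + ∑' n : ℕ, a (n + 1) * w ^ (n + 1) := by
    rw [s0.tsum_eq_zero_add, ha, hypCoeff_zero]
    simp
  have t0 := (summable_nat_add_iff 1).2 s0
  have t1 := (summable_nat_add_iff 1).2 s1
  -- At `w ^ (n + 1)` this reads `(n + b) a n = (n + 1 - β) a (n + 1)`, the recursion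
  -- `hypCoeff_succ`.
  have key : w * (∑' n : ℕ, n * a n * w ^ n) + b * w * (∑' n, a n * w ^ n) =
      (∑' n : ℕ, (n + 1 : ℝ) * a (n + 1) * w ^ (n + 1)) -
        β * ∑' n : ℕ, a (n + 1) * w ^ (n + 1) := by
    rw [mul_comm b w, mul_assoc, ← tsum_mul_left, ← tsum_mul_left, ← tsum_mul_left,
      ← tsum_mul_left, ← (s1.mul_left w).tsum_add ((s0.mul_left b).mul_left w),
      ← Summable.tsum_sub (by simpa using t1) (t0.mul_left β)]
    congr 1; ext n
    have := hypCoeff_succ (b := b) hc n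
    rw [← ha] at this
    rw [pow_succ]
    linear_combination (-(w ^ n * w)) * this
  calc w * (1 - w) * (∑' n : ℕ, a n * (n * w ^ (n - 1))) - b * w * (∑' n, a n * w ^ n)
      = (1 - w) * (w * ∑' n : ℕ, a n * (n * w ^ (n - 1))) - b * w * (∑' n, a n * w ^ n) := by ring
    _ = (∑' n : ℕ, n * a n * w ^ n) - (w * (∑' n : ℕ, n * a n * w ^ n) +
          b * w * (∑' n, a n * w ^ n)) := by rw [hd]; ring
    _ = _ := by rw [key, h1, h2]; ring

/-- The function `₂F₁(-β, N; 1 - β; -z)` in the form given by Pfaff's transformation. -/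
def pfaff (β : ℝ) (N : ℕ) (z : ℝ) : ℝ :=
  (1 + z) ^ (-(N : ℝ)) * ∑' n, hypCoeff N (1 - β) n * (z / (1 + z)) ^ n

lemma gaussHyp_eq_pfaff (β : ℝ) (N : ℕ) {z : ℝ} (hz : 0 ≤ z) :
    gaussHyp (-β) N (1 - β) (-z) = pfaff β N z := by
  rcases hz.eq_or_lt with rfl | hz
  · have h0 : ∀ c : ℝ, ∑' n, hypCoeff N c n * (0 : ℝ) ^ n = 1 := fun c => by
      rw [tsum_eq_single 0 (fun n hn => by simp [hn]), hypCoeff_zero]; simp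
    simp [gaussHyp, pfaff, h0]
  · rw [gaussHyp, if_pos (by linarith), pfaff, sub_neg_eq_add, ← ordinaryHypergeometric_one]
    have h1 : 1 - β - -β = 1 := by ring
    have h2 : -z / (-z - 1) = z / (1 + z) := by
      rw [← neg_div_neg_eq]; congr 1 <;> ring
    rw [h1, h2]

lemma pfaff_zero (β : ℝ) (N : ℕ) : pfaff β N 0 = 1 := by
  rw [← gaussHyp_eq_pfaff β N le_rfl]
  simp [gaussHyp]

/-- The range `z > -1/2` is an open neighbourhood of `[0, ∞)` that stays inside the disc of
convergence; it makes two-sided differentiation at `z = 0` possible. -/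
lemma abs_div_one_add_lt {z : ℝ} (hz : -(1 / 2) < z) : |z / (1 + z)| < 1 := by
  rw [abs_lt, div_lt_one (by linarith), lt_div_iff₀ (by linarith)]
  constructor <;> linarith

/-- This is `hyp_ode` in the variable `w = z / (1 + z)`, where `w (1 - w) = z / (1 + z) ^ 2`. The
equation is left multiplied by `z`, so that `z = 0` is included. -/
lemma hasDerivAt_pfaff {β : ℝ} (hβ : β < 1) {N : ℕ} (hN : 0 < N) {z : ℝ} (hz : -(1 / 2) < z) :
    ∃ d, HasDerivAt (pfaff β N) d z ∧ z * d = β * (pfaff β N z - (1 + z) ^ (-(N : ℝ))) := by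
  have hb : (0 : ℝ) < N := by exact_mod_cast hN
  have hc : 0 < 1 - β := by linarith
  have hz1 : 0 < 1 + z := by linarith
  have hw := abs_div_one_add_lt hz
  have h1 : HasDerivAt (fun z : ℝ => z / (1 + z)) ((1 * (1 + z) - z * 1) / (1 + z) ^ 2) z :=
    (hasDerivAt_id z).div ((hasDerivAt_id z).const_add 1) hz1.ne'
  have h2 := (hasDerivAt_hyp hb hc hw).comp z h1
  have h3 : HasDerivAt (fun z : ℝ => (1 + z) ^ (-(N : ℝ)))
      (1 * (-(N : ℝ)) * (1 + z) ^ (-(N : ℝ) - 1)) z :=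
    ((hasDerivAt_id z).const_add 1).rpow_const (Or.inl hz1.ne')
  refine ⟨_, h3.mul h2, ?_⟩
  have hode := hyp_ode hb hβ hw
  simp only [pfaff]
  rw [Real.rpow_sub_one hz1.ne']
  set A := ∑' n, hypCoeff N (1 - β) n * (z / (1 + z)) ^ n
  set A' := ∑' n : ℕ, hypCoeff N (1 - β) n * (n * (z / (1 + z)) ^ (n - 1))
  set q := (1 + z) ^ (-(N : ℝ))
  have : z / (1 + z) * (1 - z / (1 + z)) = z / (1 + z) ^ 2 := by field_simp; ring
  rw [this] at hode
  calc _ = q * (z / (1 + z) ^ 2 * A' - N * (z / (1 + z)) * A) := by field_simp; ring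
    _ = _ := by rw [hode]; ring

lemma lintegral_beta {a b : ℝ} (ha : 0 < a) (hb : 0 < b) :
    ∫⁻ x in Set.Ioo (0 : ℝ) 1, ENNReal.ofReal (x ^ (a - 1) * (1 - x) ^ (b - 1)) =
      ENNReal.ofReal (beta a b) := by
  have h1 := lintegral_betaPDF_eq_one ha hb
  have hB := beta_pos ha hb
  rw [lintegral_betaPDF] at h1
  have h2 : ∫⁻ x in Set.Ioo (0 : ℝ) 1, ENNReal.ofReal (x ^ (a - 1) * (1 - x) ^ (b - 1)) =
      ENNReal.ofReal (beta a b) * ∫⁻ (x : ℝ) in Set.Ioo 0 1,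
        ENNReal.ofReal (1 / beta a b * x ^ (a - 1) * (1 - x) ^ (b - 1)) := by
    rw [← lintegral_const_mul _ (by fun_prop)]
    refine setLIntegral_congr_fun measurableSet_Ioo fun x hx => ?_
    rw [← ENNReal.ofReal_mul hB.le]
    congr 1
    field_simp
  rw [h2, h1, mul_one]

section PfaffLimit

variable {β : ℝ} {N : ℕ}

lemma continuousAt_pfaff (hβ : β < 1) (hN : 0 < N) {z : ℝ} (hz : -(1 / 2) < z) :
    ContinuousAt (pfaff β N) z :=
  (hasDerivAt_pfaff hβ hN hz).choose_spec.1.continuousAt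

lemma isBigO_pfaff_sub_one (hβ : β < 1) (hN : 0 < N) :
    (fun z => pfaff β N z - 1) =O[𝓝 0] fun z => z := by
  obtain ⟨d, hd, -⟩ := hasDerivAt_pfaff hβ hN (z := 0) (by norm_num)
  simpa [pfaff_zero] using hd.isBigO_sub

lemma isBigO_one_add_rpow (N : ℕ) :
    (fun z : ℝ => (1 + z) ^ (-(N : ℝ)) - 1) =O[𝓝 0] fun z => z := by
  have : HasDerivAt (fun z : ℝ => (1 + z) ^ (-(N : ℝ))) _ 0 :=
    ((hasDerivAt_id (0 : ℝ)).const_add 1).rpow_const (Or.inl (by simp))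
  simpa using this.isBigO_sub

lemma tendsto_rpow_mul_of_isBigO {f : ℝ → ℝ} (hβ : β < 1) (hf : f =O[𝓝 0] fun z => z) :
    Tendsto (fun z => z ^ (-β) * f z) (𝓝[>] 0) (𝓝 0) := by
  have h1 : (fun z : ℝ => z ^ (-β) * f z) =O[𝓝[>] 0] fun z => z ^ (1 - β) := by
    have := (Asymptotics.isBigO_refl (fun z : ℝ => z ^ (-β)) (𝓝[>] 0)).mul
      (hf.mono nhdsWithin_le_nhds)
    refine this.congr' EventuallyEq.rfl ?_
    filter_upwards [self_mem_nhdsWithin] with z (hz : 0 < z)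
    rw [mul_comm, sub_eq_add_neg, Real.rpow_add hz, Real.rpow_one]
  refine h1.trans_tendsto ?_
  have : ContinuousAt (fun z : ℝ => z ^ (1 - β)) 0 :=
    Real.continuousAt_rpow_const _ _ (Or.inr (by linarith))
  have h2 := this.tendsto
  rw [Real.zero_rpow (by linarith)] at h2
  exact h2.mono_left nhdsWithin_le_nhds

/-- Subtracting `(1 + z) ^ (-N)` makes the function vanish at `0`, and after multiplication by the
integrating factor `z ^ (-β)` the hypergeometric function disappears from the derivative. -/
lemma hasDerivAt_pfaff_sub (hβ : β < 1) (hN : 0 < N) {z : ℝ} (hz : 0 < z) :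
    HasDerivAt (fun z => z ^ (-β) * (pfaff β N z - (1 + z) ^ (-(N : ℝ))))
      (N * z ^ (-β) * (1 + z) ^ (-(N : ℝ) - 1)) z := by
  obtain ⟨d, hd, hd'⟩ := hasDerivAt_pfaff hβ hN (z := z) (by linarith)
  have h1 : HasDerivAt (fun z : ℝ => z ^ (-β)) (-β * z ^ (-β - 1)) z :=
    Real.hasDerivAt_rpow_const (Or.inl hz.ne')
  have h2 : HasDerivAt (fun z : ℝ => (1 + z) ^ (-(N : ℝ)))
      (1 * (-(N : ℝ)) * (1 + z) ^ (-(N : ℝ) - 1)) z :=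
    ((hasDerivAt_id z).const_add 1).rpow_const (Or.inl (by simp; linarith))
  refine (h1.mul (hd.sub h2)).congr_deriv ?_
  rw [Real.rpow_sub_one hz.ne', Pi.sub_apply]
  field_simp
  linear_combination hd'

/-- The limit of the primitive in the variable `w = z / (1 + z)`. -/
lemma tendsto_pfaff_sub (hβ0 : 0 < β) (hβ : β < 1) (hN : 0 < N) :
    Tendsto (fun z => z ^ (-β) * (pfaff β N z - (1 + z) ^ (-(N : ℝ)))) atTop
      (𝓝 (N * beta (1 - β) (N + β))) := by
  have hNr : (0 : ℝ) < N := by exact_mod_cast hN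
  set T : ℝ → ℝ := fun z => z ^ (-β) * (pfaff β N z - (1 + z) ^ (-(N : ℝ))) with hT
  set f : ℝ → ℝ := fun x => N * (x ^ (1 - β - 1) * (1 - x) ^ (N + β - 1)) with hf
  have hT0 : Tendsto T (𝓝[>] 0) (𝓝 0) := by
    refine tendsto_rpow_mul_of_isBigO hβ ?_
    simpa using (isBigO_pfaff_sub_one hβ hN).sub (isBigO_one_add_rpow N)
  have hTz : T 0 = 0 := by simp [hT, pfaff_zero]
  have hw : Tendsto (fun w : ℝ => w / (1 - w)) (𝓝[>] 0) (𝓝[>] 0) := by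
    refine tendsto_nhdsWithin_iff.2 ⟨?_, ?_⟩
    · have : ContinuousAt (fun w : ℝ => w / (1 - w)) 0 :=
        continuousAt_id.div (continuousAt_const.sub continuousAt_id) (by simp)
      simpa using this.tendsto.mono_left nhdsWithin_le_nhds
    · filter_upwards [Ioo_mem_nhdsGT (zero_lt_one (α := ℝ))] with w hw
      exact div_pos hw.1 (by linarith [hw.2])
  have hd : ∀ w ∈ Set.Ioo (0 : ℝ) 1, HasDerivAt (fun w => T (w / (1 - w))) (f w) w := by
    intro w hw
    have h1w : 0 < 1 - w := by linarith [hw.2]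
    have hz : 0 < w / (1 - w) := div_pos hw.1 h1w
    have h1 : HasDerivAt (fun w : ℝ => w / (1 - w)) ((1 * (1 - w) - w * (-1)) / (1 - w) ^ 2) w := by
      exact (hasDerivAt_id w).div ((hasDerivAt_id w).const_sub 1) h1w.ne'
    refine ((hasDerivAt_pfaff_sub hβ hN hz).comp w h1).congr_deriv ?_
    have h2 : 1 + w / (1 - w) = (1 - w)⁻¹ := by field_simp; ring
    have e1 : (1 - w : ℝ) ^ ((N : ℝ) + β - 1) = (1 - w) ^ (N : ℝ) * (1 - w) ^ β / (1 - w) := by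
      rw [Real.rpow_sub_one h1w.ne', Real.rpow_add h1w]
    have e2 : (1 + w / (1 - w)) ^ (-(N : ℝ) - 1) = (1 - w) ^ (N : ℝ) * (1 - w) := by
      rw [h2, Real.inv_rpow h1w.le, ← Real.rpow_neg h1w.le, neg_sub, sub_neg_eq_add, add_comm,
        Real.rpow_add h1w, Real.rpow_one]
    have e3 : (w / (1 - w)) ^ (-β) = w ^ (-β) * (1 - w) ^ β := by
      rw [Real.div_rpow hw.1.le h1w.le, Real.rpow_neg h1w.le, div_inv_eq_mul]
    have e4 : (1 - β - 1 : ℝ) = -β := by ring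
    simp only [hf]
    rw [e1, e2, e3, e4]
    field_simp
    ring
  have hfpos : ∀ x ∈ Set.Ioo (0 : ℝ) 1, 0 ≤ f x := fun x hx => by
    have h1x : 0 < 1 - x := by linarith [hx.2]
    have := hx.1
    simp only [hf]
    positivity
  have hlin : ∫⁻ x in Set.Ioc (0 : ℝ) 1, ENNReal.ofReal (f x) =
      ENNReal.ofReal (N * beta (1 - β) (N + β)) := by
    rw [← restrict_Ioo_eq_restrict_Ioc, ENNReal.ofReal_mul hNr.le,
      ← lintegral_beta (by linarith) (by positivity), ← lintegral_const_mul _ (by fun_prop)]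
    simp only [hf, ENNReal.ofReal_mul hNr.le]
  have hint : IntegrableOn f (Set.Icc 0 1) := by
    rw [integrableOn_Icc_iff_integrableOn_Ioc]
    refine ⟨by simp only [hf]; fun_prop, ?_⟩
    rw [hasFiniteIntegral_iff_ofReal, hlin]
    · exact ENNReal.ofReal_lt_top
    · rw [← restrict_Ioo_eq_restrict_Ioc]
      filter_upwards [ae_restrict_mem measurableSet_Ioo] with x hx using hfpos x hx
  -- In the variable `w` the derivative is `N` times the beta integrand with parameters `1 - β` and
  -- `N + β`; the primitive starts at `0` by `hT0`.
  have hG : ∀ w ∈ Set.Ioo (0 : ℝ) 1, T (w / (1 - w)) = ∫ x in Set.Ioc 0 w, f x := by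
    intro w hw'
    rw [← intervalIntegral.integral_of_le hw'.1.le,
      intervalIntegral.integral_eq_sub_of_hasDerivAt_of_le (f := fun w => T (w / (1 - w))) hw'.1.le]
    · simp [hTz]
    · intro x hx
      rcases hx.1.eq_or_lt with rfl | hx0
      · have hle : 𝓝[Set.Icc 0 w] (0 : ℝ) ≤ 𝓝[Set.Ici 0] 0 := nhdsWithin_mono _ fun x hx => hx.1
        refine Tendsto.mono_left ?_ hle
        rw [← Set.Ioi_insert, nhdsWithin_insert, tendsto_sup]
        constructor
        · rw [tendsto_pure_left]
          intro s hs
          exact mem_of_mem_nhds hs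
        · have := hT0.comp hw
          simpa [hTz, Function.comp_def] using this
      · exact (hd x ⟨hx0, hx.2.trans_lt hw'.2⟩).continuousAt.continuousWithinAt
    · exact fun x hx => hd x ⟨hx.1, hx.2.trans hw'.2⟩
    · rw [intervalIntegrable_iff_integrableOn_Ioc_of_le hw'.1.le]
      exact hint.mono_set (Set.Ioc_subset_Icc_self.trans (Set.Icc_subset_Icc_right hw'.2.le))
  -- The beta integrand is integrable up to `1`, so its primitive is continuous there, and `w → 1`
  -- corresponds to `z → ∞`.
  have hlim := (intervalIntegral.continuousOn_primitive hint) 1 (by simp)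
  have h1 : ∫ x in Set.Ioc (0 : ℝ) 1, f x = N * beta (1 - β) (N + β) := by
    rw [integral_eq_lintegral_of_nonneg_ae, hlin, ENNReal.toReal_ofReal]
    · exact mul_nonneg hNr.le (beta_pos (by linarith) (by positivity)).le
    · rw [← restrict_Ioo_eq_restrict_Ioc]
      filter_upwards [ae_restrict_mem measurableSet_Ioo] with x hx using hfpos x hx
    · simp only [hf]; fun_prop
  rw [ContinuousWithinAt, h1] at hlim
  have hz : Tendsto (fun z : ℝ => z / (1 + z)) atTop (𝓝[Set.Icc 0 1] 1) := by
    refine tendsto_nhdsWithin_iff.2 ⟨?_, ?_⟩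
    · have h2 : Tendsto (fun z : ℝ => 1 - (1 + z)⁻¹) atTop (𝓝 (1 - 0)) :=
        (tendsto_inv_atTop_zero.comp (tendsto_atTop_add_const_left _ 1 tendsto_id)).const_sub 1
      rw [sub_zero] at h2
      refine h2.congr' ?_
      filter_upwards [eventually_gt_atTop 0] with z hz
      field_simp
      ring
    · filter_upwards [eventually_gt_atTop 0] with z hz
      exact ⟨by positivity, (div_le_one (by positivity)).2 (by linarith)⟩
  refine (hlim.comp hz).congr' ?_
  filter_upwards [eventually_gt_atTop 0] with z hz
  rw [Function.comp_apply, ← hG _ ⟨by positivity, (div_lt_one (by positivity)).2 (by linarith)⟩]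
  congr 1
  field_simp
  ring

/-- The constant is `N` times the beta integral: `Γ (N + 1) = N Γ N` in its denominator cancels the
factor `N`. -/
lemma isRadialPrimitive_pfaff {α : ℝ} (hα : 2 < α) (hN : 0 < N) :
    IsRadialPrimitive α N (Real.Gamma (1 - 2 / α) * Real.Gamma (N + 2 / α) * (Real.Gamma N)⁻¹)
      (fun z => -pfaff (2 / α) N z) := by
  have hα0 : 0 < α := by linarith
  have hβ0 : 0 < 2 / α := by positivity
  have hβ : 2 / α < 1 := (div_lt_one hα0).2 hα
  have hNr : (0 : ℝ) < N := by exact_mod_cast hN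
  refine ⟨?_, by simp [pfaff_zero], ?_, ?_⟩
  · intro z (hz : 0 ≤ z)
    exact (continuousAt_pfaff hβ hN (by linarith)).neg.continuousWithinAt
  · intro z hz
    obtain ⟨d, hd, hd'⟩ := hasDerivAt_pfaff hβ hN (z := z) (by linarith)
    refine hd.neg.congr_deriv ?_
    rw [eq_div_iff hz.ne']
    linear_combination -hd'
  · have h1 := tendsto_pfaff_sub hβ0 hβ hN
    have h2 : Tendsto (fun z : ℝ => z ^ (-(2 / α)) * (1 + z) ^ (-(N : ℝ))) atTop (𝓝 (0 * 0)) :=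
      (tendsto_rpow_neg_atTop hβ0).mul
        ((tendsto_rpow_neg_atTop hNr).comp (tendsto_atTop_add_const_left _ 1 tendsto_id))
    have h3 := (h1.add h2).neg
    have e : -(N * beta (1 - 2 / α) (N + 2 / α) + 0 * 0) =
        -(Real.Gamma (1 - 2 / α) * Real.Gamma (N + 2 / α) * (Real.Gamma N)⁻¹) := by
      have h4 : (1 - 2 / α + (N + 2 / α) : ℝ) = N + 1 := by ring
      have h5 := (Real.Gamma_pos_of_pos hNr).ne'
      rw [beta, h4, Real.Gamma_add_one hNr.ne']
      field_simp
      ring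
    rw [e] at h3
    refine h3.congr fun z => ?_
    ring

lemma tendsto_pfaff_zero {α : ℝ} (hα : 2 < α) (hN : 0 < N) :
    Tendsto (fun z => z ^ (-(2 / α)) * (1 + -pfaff (2 / α) N z)) (𝓝[>] 0) (𝓝 0) := by
  have hβ : 2 / α < 1 := (div_lt_one (by linarith)).2 hα
  refine tendsto_rpow_mul_of_isBigO hβ ?_
  refine (isBigO_pfaff_sub_one hβ hN).neg_left.congr_left fun z => by ring

/-- The radial primitive increases in `y` and tends to `0` at infinity, so it is nonpositive at `y =
1`, where it equals `1 - pfaff`. -/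
lemma one_le_pfaff {α : ℝ} (hα : 2 < α) (hN : 0 < N) {z : ℝ} (hz : 0 ≤ z) :
    1 ≤ pfaff (2 / α) N z := by
  have hα0 : 0 < α := by linarith
  rcases hz.eq_or_lt with rfl | hz
  · rw [pfaff_zero]
  have hP := isRadialPrimitive_pfaff hα hN
  have hlim := IsRadialPrimitive.tendsto_infty (Ψ := fun z => -pfaff (2 / α) N z) hα0
    (tendsto_pfaff_zero hα hN) hz
  have hmono : MonotoneOn (fun y => y ^ 2 * (1 + -pfaff (2 / α) N (z * y ^ (-α)))) (Set.Ici 1) := by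
    refine monotoneOn_of_deriv_nonneg (convex_Ici 1) ?_ ?_ ?_
    · exact fun y hy => (hP.hasDerivAt_radial hα0 hz.le
        (zero_lt_one.trans_le hy)).continuousAt.continuousWithinAt
    · intro y hy
      rw [interior_Ici] at hy
      exact (hP.hasDerivAt_radial hα0 hz.le (zero_lt_one.trans
        hy)).differentiableAt.differentiableWithinAt
    · intro y hy
      rw [interior_Ici] at hy
      rw [(hP.hasDerivAt_radial hα0 hz.le (zero_lt_one.trans hy)).deriv]
      exact IsRadialPrimitive.one_sub_nonneg hz.le (zero_lt_one.trans hy)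
  have h1 : (1 : ℝ) ^ 2 * (1 + -pfaff (2 / α) N (z * 1 ^ (-α))) ≤ 0 := by
    refine ge_of_tendsto hlim ?_
    filter_upwards [eventually_ge_atTop 1] with y hy
    exact hmono (Set.mem_Ici.2 le_rfl) hy hy
  rw [Real.one_rpow, mul_one] at h1
  linarith

end PfaffLimit

/-! ### The critical exponent -/

section Critical

/-- The function `y Fy y`, continuously extended to `y = 0`. -/
def criticalPrim (N : ℕ) (y : ℝ) : ℝ :=
  N * (y * Real.log (1 + y) - y * Real.log y) - 1 / (1 + y) ^ (N - 1)
    - y * ∑ j ∈ Finset.Icc 1 (N - 1), (N : ℝ) / ((1 + y) ^ j * j)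

lemma sum_Icc_sub_eq (N : ℕ) (y : ℝ) :
    ∑ m ∈ Finset.Icc 1 (N - 1), (N : ℝ) / ((1 + y) ^ (N - m) * ((N : ℝ) - m)) =
      ∑ j ∈ Finset.Icc 1 (N - 1), (N : ℝ) / ((1 + y) ^ j * j) := by
  refine Finset.sum_nbij' (fun m => N - m) (fun m => N - m) ?_ ?_ ?_ ?_ ?_
  · intro m hm; simp only [Finset.mem_Icc] at hm ⊢; omega
  · intro m hm; simp only [Finset.mem_Icc] at hm ⊢; omega
  · intro m hm; simp only [Finset.mem_Icc] at hm; omega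
  · intro m hm; simp only [Finset.mem_Icc] at hm; omega
  · intro m hm
    simp only [Finset.mem_Icc] at hm
    rw [Nat.cast_sub (by omega)]

lemma mul_Fy {N : ℕ} {y : ℝ} (hy : 0 < y) : y * HetNet.Fy N y = criticalPrim N y := by
  have h1 : Real.log (1 + 1 / y) = Real.log (1 + y) - Real.log y := by
    rw [← Real.log_div (by positivity) hy.ne']
    congr 1
    field_simp
    ring
  rw [HetNet.Fy, criticalPrim, sum_Icc_sub_eq, h1]
  field_simp

/-- A partial fraction computation: the derivative of the finite sum is a geometric series in `(1 +
y)⁻¹`, which cancels everything except `(1 + y) ^ (-N) / y ^ 2`. -/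
lemma hasDerivAt_Fy {N : ℕ} (hN : 0 < N) {y : ℝ} (hy : 0 < y) :
    HasDerivAt (HetNet.Fy N) ((1 + y) ^ (-(N : ℝ)) / y ^ 2) y := by
  have hy1 : 0 < 1 + y := by linarith
  have h1 : HasDerivAt (fun y : ℝ => N * Real.log (1 + 1 / y)) (N * (-(1 / (y * (1 + y))))) y := by
    have h2 : HasDerivAt (fun y : ℝ => Real.log (1 + y) - Real.log y) (1 / (1 + y) - y⁻¹) y :=
      (((hasDerivAt_id y).const_add 1).log hy1.ne').sub (Real.hasDerivAt_log hy.ne')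
    refine (((h2.congr_of_eventuallyEq ?_).const_mul (N : ℝ))).congr_deriv ?_
    · filter_upwards [lt_mem_nhds hy] with x hx
      rw [← Real.log_div (by positivity) hx.ne']
      congr 1
      field_simp
      ring
    · field_simp
      ring
  have h2 : ∀ j : ℕ, HasDerivAt (fun y : ℝ => ((1 + y) ^ j)⁻¹) (-(j * ((1 + y) ^ (j + 1))⁻¹)) y := by
    intro j
    refine ((((hasDerivAt_id y).const_add 1).pow j).inv (pow_ne_zero j hy1.ne')).congr_deriv ?_
    rcases j with _ | j
    · simp
    · simp only [id, Nat.add_sub_cancel, Pi.pow_apply]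
      push_cast
      field_simp
      ring
  have h3 : HasDerivAt (fun y : ℝ => 1 / (y * (1 + y) ^ (N - 1)))
      (-(1 / y ^ 2) * ((1 + y) ^ (N - 1))⁻¹ + y⁻¹ * (-((N - 1 : ℕ) * ((1 + y) ^ (N - 1 + 1))⁻¹))) y := by
    have := (hasDerivAt_inv hy.ne').mul (h2 (N - 1))
    refine (this.congr_of_eventuallyEq ?_).congr_deriv ?_
    · filter_upwards with x
      simp [mul_comm]
    · simp
  have h4 : HasDerivAt (fun y : ℝ => ∑ j ∈ Finset.Icc 1 (N - 1), (N : ℝ) / ((1 + y) ^ j * j))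
      (∑ j ∈ Finset.Icc 1 (N - 1), -(N * ((1 + y) ^ (j + 1))⁻¹)) y := by
    refine HasDerivAt.fun_sum fun j hj => ?_
    have hj0 : (j : ℝ) ≠ 0 := by
      have := (Finset.mem_Icc.1 hj).1
      exact_mod_cast (by omega)
    refine (((h2 j).const_mul ((N : ℝ) / j)).congr_of_eventuallyEq ?_).congr_deriv ?_
    · filter_upwards [lt_mem_nhds hy] with x hx
      have : 0 < 1 + x := by linarith
      field_simp
    · field_simp
  have h5 : ∀ M : ℕ, ∑ j ∈ Finset.Icc 1 M, ((1 + y) ^ (j + 1))⁻¹ =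
      (1 + y)⁻¹ * (1 - ((1 + y) ^ M)⁻¹) / y := by
    intro M
    induction M with
    | zero => simp
    | succ M ih =>
      rw [Finset.sum_Icc_succ_top (by omega), ih]
      field_simp
      ring
  have h6 := (h1.sub h3).sub h4
  have e : HetNet.Fy N = fun y : ℝ => N * Real.log (1 + 1 / y) - 1 / (y * (1 + y) ^ (N - 1)) -
      ∑ j ∈ Finset.Icc 1 (N - 1), (N : ℝ) / ((1 + y) ^ j * j) := by
    ext x
    rw [HetNet.Fy, sum_Icc_sub_eq]
  rw [e]
  refine h6.congr_deriv ?_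
  rw [Finset.sum_neg_distrib, ← Finset.mul_sum, h5, Real.rpow_neg hy1.le, Real.rpow_natCast]
  obtain ⟨M, rfl⟩ : ∃ M, N = M + 1 := ⟨N - 1, by omega⟩
  simp only [Nat.add_sub_cancel]
  push_cast
  field_simp
  ring

/-- With `Ψ z = z * Fy z` and exponent `2 / α = 1`, the equation for `Ψ` is the product rule and
`hasDerivAt_Fy`. The constant is zero because `Fy` tends to `0` at infinity. -/
lemma isRadialPrimitive_critical {N : ℕ} (hN : 0 < N) :
    IsRadialPrimitive 2 N 0 (criticalPrim N) := by
  refine ⟨?_, ?_, ?_, ?_⟩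
  · have h1 : ∀ y ∈ Set.Ici (0 : ℝ), 1 + y ≠ 0 := fun y (hy : 0 ≤ y) => by positivity
    have h2 : ContinuousOn (fun y : ℝ => y * Real.log y) (Set.Ici 0) :=
      Real.continuous_mul_log.continuousOn
    unfold criticalPrim
    refine ((continuousOn_const.mul ((continuousOn_id.mul ((continuousOn_const.add
      continuousOn_id).log h1)).sub h2)).sub (continuousOn_const.div ((continuousOn_const.add
      continuousOn_id).pow _) fun y hy => pow_ne_zero _ (h1 y hy))).sub
      (continuousOn_id.mul (continuousOn_finsetSum _ fun j hj => ?_))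
    refine continuousOn_const.div (((continuousOn_const.add continuousOn_id).pow _).mul
      continuousOn_const) fun y hy => mul_ne_zero (pow_ne_zero _ (h1 y hy)) ?_
    have := (Finset.mem_Icc.1 hj).1
    exact_mod_cast (by omega)
  · simp [criticalPrim]
  · intro z hz
    have h1 := (hasDerivAt_id z).mul (hasDerivAt_Fy hN hz)
    refine (h1.congr_of_eventuallyEq ?_).congr_deriv ?_
    · filter_upwards [lt_mem_nhds hz] with x hx
      exact (mul_Fy hx).symm
    · rw [← mul_Fy hz]
      simp only [id]
      field_simp
  · rw [neg_zero]
    have h0 : Tendsto (fun y : ℝ => (1 + y)) atTop atTop :=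
      tendsto_atTop_add_const_left _ 1 tendsto_id
    have h1 : Tendsto (fun y : ℝ => N * Real.log (1 + 1 / y)) atTop (𝓝 (N * Real.log (1 + 0))) := by
      have : Tendsto (fun y : ℝ => 1 + 1 / y) atTop (𝓝 (1 + 0)) := by
        simpa using tendsto_inv_atTop_zero.const_add (1 : ℝ)
      exact (this.log (by norm_num)).const_mul _
    have h2 : Tendsto (fun y : ℝ => 1 / (y * (1 + y) ^ (N - 1))) atTop (𝓝 0) := by
      refine squeeze_zero' (g := fun y : ℝ => y⁻¹) ?_ ?_ tendsto_inv_atTop_zero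
      · filter_upwards [eventually_gt_atTop 0] with y hy
        positivity
      · filter_upwards [eventually_gt_atTop 0] with y hy
        rw [one_div]
        refine inv_anti₀ hy (le_mul_of_one_le_right hy.le (one_le_pow₀ (by linarith)))
    have h3 : Tendsto (fun y : ℝ => ∑ j ∈ Finset.Icc 1 (N - 1), (N : ℝ) / ((1 + y) ^ j * j)) atTop
        (𝓝 (∑ j ∈ Finset.Icc 1 (N - 1), (0 : ℝ))) := by
      refine tendsto_finsetSum _ fun j hj => ?_
      have hj1 := (Finset.mem_Icc.1 hj).1
      refine Tendsto.div_atTop tendsto_const_nhds (Tendsto.atTop_mul_const (by exact_mod_cast hj1)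
        ((tendsto_pow_atTop (by omega)).comp h0))
    have h4 := (h1.sub h2).sub h3
    simp only [add_zero, Real.log_one, mul_zero, Finset.sum_const_zero, sub_zero] at h4
    refine h4.congr' ?_
    filter_upwards [eventually_gt_atTop 0] with y hy
    rw [← mul_Fy hy, HetNet.Fy, sum_Icc_sub_eq]
    norm_num
    rw [Real.rpow_neg_one]
    field_simp

end Critical

/-! ### Gauss–Chebyshev quadrature -/

section Quadrature

open Real

lemma integral_neg_one_one_eq {g : ℝ → ℝ} (hg : ContinuousOn g (Set.Icc (-1) 1)) :
    ∫ x in (-1 : ℝ)..1, g x = ∫ θ in (0 : ℝ)..π, g (cos θ) * sin θ := by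
  have h := intervalIntegral.integral_comp_mul_deriv'' (a := 0) (b := π) (f := cos)
    (f' := fun x => -sin x) (g := g) continuous_cos.continuousOn
    (fun x _ => (hasDerivAt_cos x).hasDerivWithinAt) (continuous_sin.neg.continuousOn)
    (hg.mono (by rintro _ ⟨x, -, rfl⟩; exact ⟨neg_one_le_cos x, cos_le_one x⟩))
  rw [cos_zero, cos_pi, intervalIntegral.integral_symm (-1) 1] at h
  rw [← neg_inj, ← h, ← intervalIntegral.integral_neg]
  simp

lemma sqrt_one_sub_chebNode_le (u k : ℕ) : √(1 - HetNet.chebNode u k ^ 2) ≤ 1 := by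
  exact Real.sqrt_le_one.2 (by nlinarith [sq_nonneg (HetNet.chebNode u k)])

lemma midpoint_angle_mem {u k : ℕ} (hk : k ∈ Finset.Icc 1 u) :
    (2 * (k : ℝ) - 1) / (2 * (u : ℝ)) * π ∈ Set.Ioo 0 π := by
  rw [Finset.mem_Icc] at hk
  have h1 : (1 : ℝ) ≤ k := by exact_mod_cast hk.1
  have h2 : (k : ℝ) ≤ u := by exact_mod_cast hk.2
  have hu : (0 : ℝ) < u := by linarith
  refine ⟨mul_pos (div_pos (by linarith) (by linarith)) pi_pos, ?_⟩
  have : (2 * (k : ℝ) - 1) / (2 * (u : ℝ)) < 1 := by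
    rw [div_lt_one (by linarith)]; linarith
  nlinarith [pi_pos]

lemma chebNode_mem_Ioo {u k : ℕ} (hk : k ∈ Finset.Icc 1 u) :
    HetNet.chebNode u k ∈ Set.Ioo (-1 : ℝ) 1 := by
  obtain ⟨h0, h1⟩ := midpoint_angle_mem hk
  constructor
  · rw [← cos_pi]
    exact strictAntiOn_cos ⟨h0.le, h1.le⟩ ⟨pi_pos.le, le_rfl⟩ h1
  · rw [← cos_zero]
    exact strictAntiOn_cos ⟨le_rfl, pi_pos.le⟩ ⟨h0.le, h1.le⟩ h0

/-- The angles are the midpoints of `u` equal pieces of `[0, π]`. On each piece the function differs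
from its midpoint value by at most its oscillation. -/
lemma abs_integral_sub_midpoint_le {H : ℝ → ℝ} (hH : ContinuousOn H (Set.Icc 0 π)) {ε δ : ℝ}
    (hε : ∀ x ∈ Set.Icc 0 π, ∀ y ∈ Set.Icc 0 π, |x - y| ≤ δ → |H x - H y| ≤ ε)
    {u : ℕ} (hu : 0 < u) (huδ : π / u ≤ δ) :
    |(∫ θ in (0 : ℝ)..π, H θ) -
      π / u * ∑ k ∈ Finset.Icc 1 u, H ((2 * (k : ℝ) - 1) / (2 * (u : ℝ)) * π)| ≤ ε * π := by
  have hur : (0 : ℝ) < u := by exact_mod_cast hu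
  set a : ℕ → ℝ := fun k => k * (π / u) with ha
  have ha0 : ∀ k, 0 ≤ a k := fun k => by positivity
  have hau : ∀ k ≤ u, a k ≤ π := fun k hk => by
    have : (k : ℝ) ≤ u := by exact_mod_cast hk
    calc a k ≤ u * (π / u) := by simp only [ha]; gcongr
      _ = π := by field_simp
  have hstep : ∀ k, a (k + 1) - a k = π / u := fun k => by simp only [ha]; push_cast; ring
  have hle : ∀ k, a k ≤ a (k + 1) := fun k => by
    have := hstep k
    have h2 : 0 < π / u := by positivity
    linarith
  have hint : ∀ k < u, IntervalIntegrable H volume (a k) (a (k + 1)) := fun k hk =>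
    (hH.mono (by
      rw [Set.uIcc_of_le (hle k)]
      exact Set.Icc_subset_Icc (ha0 k) (hau _ hk))).intervalIntegrable
  have hsum := intervalIntegral.sum_integral_adjacent_intervals hint
  have e0 : a 0 = 0 := by simp [ha]
  have eu : a u = π := by simp only [ha]; field_simp
  rw [e0, eu] at hsum
  have hre : ∑ k ∈ Finset.Icc 1 u, H ((2 * (k : ℝ) - 1) / (2 * (u : ℝ)) * π) =
      ∑ k ∈ Finset.range u, H ((a k + a (k + 1)) / 2) := by
    rw [Finset.range_eq_Ico, Finset.sum_Ico_eq_sum_range, ← Finset.Ico_succ_right_eq_Icc,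
      Finset.sum_Ico_eq_sum_range]
    simp only [Order.succ_eq_add_one, Nat.add_sub_cancel, Nat.sub_zero]
    refine Finset.sum_congr rfl fun k _ => ?_
    congr 1
    simp only [ha]; push_cast; field_simp; ring
  rw [← hsum, hre, Finset.mul_sum, ← Finset.sum_sub_distrib]
  have hterm : ∀ k ∈ Finset.range u, |(∫ θ in a k..a (k + 1), H θ) -
      π / u * H ((a k + a (k + 1)) / 2)| ≤ ε * (π / u) := by
    intro k hk
    have hk := Finset.mem_range.1 hk
    have h1 : π / u * H ((a k + a (k + 1)) / 2) =
        ∫ θ in a k..a (k + 1), H ((a k + a (k + 1)) / 2) := by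
      rw [intervalIntegral.integral_const, hstep, smul_eq_mul]
    rw [h1, ← intervalIntegral.integral_sub (hint k hk) (by simp)]
    have := intervalIntegral.norm_integral_le_of_norm_le_const (a := a k) (b := a (k + 1)) (C := ε)
      (f := fun θ => H θ - H ((a k + a (k + 1)) / 2)) ?_
    · rw [hstep, abs_of_pos (by positivity)] at this
      exact this
    · intro x hx
      rw [Set.uIoc_of_le (hle k)] at hx
      have h2 := hstep k
      have h3 := hau _ (Nat.succ_le_of_lt hk)
      have h4 := ha0 k
      refine hε _ ⟨h4.trans hx.1.le, hx.2.trans h3⟩ _ ⟨?_, ?_⟩ ?_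
      · linarith [hle k]
      · have := hle k
        simp only [Nat.succ_eq_add_one] at h3
        linarith
      · rw [abs_le]; constructor <;> linarith [hx.1, hx.2, hle k]
  calc _ ≤ ∑ k ∈ Finset.range u, |(∫ θ in a k..a (k + 1), H θ) -
      π / u * H ((a k + a (k + 1)) / 2)| := Finset.abs_sum_le_sum_abs _ _
    _ ≤ ∑ k ∈ Finset.range u, ε * (π / u) := Finset.sum_le_sum hterm
    _ = ε * π := by rw [Finset.sum_const, Finset.card_range, nsmul_eq_mul]; field_simp

/-- Under `x = cos θ` the weight `√(1 - x²)` becomes `sin θ` and the rule becomes the midpoint rule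
for `F κ (cos θ) * sin θ`. Uniform continuity on the compact product makes the error uniform in the
parameter. -/
theorem tendstoUniformlyOn_chebyshev {K : Set ℝ} (hK : IsCompact K) {F : ℝ → ℝ → ℝ}
    (hF : ContinuousOn (Function.uncurry F) (K ×ˢ Set.Icc (-1) 1)) :
    TendstoUniformlyOn (fun (u : ℕ) κ => π / u * ∑ k ∈ Finset.Icc 1 u,
      F κ (HetNet.chebNode u k) * √(1 - HetNet.chebNode u k ^ 2))
      (fun κ => ∫ x in (-1 : ℝ)..1, F κ x) atTop K := by
  set H : ℝ × ℝ → ℝ := fun z => F z.1 (cos z.2) * sin z.2 with hHdef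
  have hH : ContinuousOn H (K ×ˢ Set.Icc 0 π) := by
    refine ContinuousOn.mul ?_ (continuous_sin.comp continuous_snd).continuousOn
    refine hF.comp (f := fun z : ℝ × ℝ => (z.1, cos z.2)) (by fun_prop) ?_
    rintro z ⟨h1, h2⟩
    exact ⟨h1, neg_one_le_cos _, cos_le_one _⟩
  have huc := (hK.prod isCompact_Icc).uniformContinuousOn_of_continuous hH
  rw [Metric.uniformContinuousOn_iff_le] at huc
  rw [Metric.tendstoUniformlyOn_iff]
  intro ε hε
  obtain ⟨δ, hδ, hd⟩ := huc (ε / 2 / π) (by positivity)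
  have hlim : Tendsto (fun u : ℕ => π / (u : ℝ)) atTop (𝓝 0) :=
    tendsto_const_nhds.div_atTop tendsto_natCast_atTop_atTop
  filter_upwards [hlim.eventually (ge_mem_nhds hδ), eventually_gt_atTop 0] with u hu hu0 κ hκ
  have hFκ : ContinuousOn (F κ) (Set.Icc (-1) 1) :=
    hF.comp (f := fun x : ℝ => (κ, x)) (by fun_prop) fun x hx => ⟨hκ, hx⟩
  have hHκ : ContinuousOn (fun θ => H (κ, θ)) (Set.Icc 0 π) :=
    hH.comp (f := fun x : ℝ => (κ, x)) (by fun_prop) fun x hx => ⟨hκ, hx⟩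
  have h1 := abs_integral_sub_midpoint_le hHκ (ε := ε / 2 / π) (δ := δ) (fun x hx y hy hxy => by
    have := hd (κ, x) ⟨hκ, hx⟩ (κ, y) ⟨hκ, hy⟩ (by
      rw [Prod.dist_eq, dist_self, Real.dist_eq]; simpa [hδ.le] using hxy)
    rwa [Real.dist_eq] at this) hu0 hu
  have h2 : ε / 2 / π * π = ε / 2 := by field_simp
  rw [Real.dist_eq, integral_neg_one_one_eq hFκ]
  refine lt_of_le_of_lt (le_of_eq ?_) (lt_of_le_of_lt (h1.trans h2.le) (by linarith))
  congr 3
  refine Finset.sum_congr rfl fun k hk => ?_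
  simp only [hHdef, HetNet.chebNode]
  rw [← sin_eq_sqrt_one_sub_cos_sq (midpoint_angle_mem hk).1.le (midpoint_angle_mem hk).2.le]

end Quadrature

/-! ### The array gain -/

namespace HetNet

lemma arrayGain_zero (S : HetNet) (w : ℝ) : S.arrayGain 0 w = 1 := by simp [arrayGain]

lemma arrayGain_nonneg (S : HetNet) (i : Fin 2) (w : ℝ) : 0 ≤ S.arrayGain i w := by
  unfold arrayGain
  split_ifs <;> positivity

/-- The quotient `sin (N θ) / sin θ` is the Chebyshev polynomial `U` of degree `N - 1` at `cos θ`,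
so the gain is continuous also at the integers. -/
lemma arrayGain_one_eq {S : HetNet} (hN : 0 < S.ant 1) (w : ℝ) :
    S.arrayGain 1 w = ((Polynomial.Chebyshev.U ℝ ((S.ant 1 : ℤ) - 1)).eval
      (Real.cos (Real.pi * w))) ^ 2 / (S.ant 1 : ℝ) ^ 2 := by
  have hNr : (0 : ℝ) < S.ant 1 := by exact_mod_cast hN
  have h := Polynomial.Chebyshev.U_real_cos (Real.pi * w) ((S.ant 1 : ℤ) - 1)
  push_cast at h
  rw [sub_add_cancel] at h
  simp only [arrayGain, one_ne_zero, if_false]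
  split_ifs with hs
  -- At a zero of the sine the cosine is `1` or `-1`, where `U` has the value `N` up to sign; this
  -- matches the prescribed gain `1`.
  · have hc : Real.cos (Real.pi * w) ^ 2 = 1 := by
      nlinarith [Real.sin_sq_add_cos_sq (Real.pi * w)]
    rw [eq_comm, div_eq_one_iff_eq (by positivity)]
    rcases (sq_eq_one_iff.1 hc) with hc | hc <;> rw [hc]
    · simp
    · rcases Int.units_eq_one_or ((S.ant 1 : ℤ) - 1).negOnePow with h1 | h1 <;>
        simp [Polynomial.Chebyshev.U_eval_neg_one, h1]
  · rw [show Real.pi * S.ant 1 * w = S.ant 1 * (Real.pi * w) by ring, ← h]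
    field_simp

lemma continuous_arrayGain {S : HetNet} (hN : 0 < S.ant 1) (i : Fin 2) :
    Continuous (S.arrayGain i) := by
  fin_cases i
  · exact continuous_const.congr fun w => (S.arrayGain_zero w).symm
  · have : S.arrayGain 1 = _ := funext fun w => arrayGain_one_eq hN w
    show Continuous (S.arrayGain 1)
    rw [this]
    fun_prop

end HetNet

/-! ### Alzer's inequality for the Gamma distribution function -/

section Alzer

open Real HetNet

lemma dslope_one_sub_exp_pos {u : ℝ} (hu : 0 ≤ u) :
    0 < dslope (fun u => 1 - exp (-u)) 0 u := by
  rcases hu.eq_or_lt with rfl | hu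
  · rw [dslope_same]
    have : HasDerivAt (fun u : ℝ => 1 - exp (-u)) (-(exp (-0) * -1)) 0 :=
      ((hasDerivAt_neg (0 : ℝ)).exp).const_sub 1
    rw [this.deriv]; simp
  · rw [dslope_of_ne _ hu.ne', slope_def_field]
    have : exp (-u) < 1 := by rw [exp_lt_one_iff]; linarith
    simp only [neg_zero, exp_zero, sub_self, sub_zero]
    exact div_pos (by linarith) hu

/-- `log (u / (1 - exp (-u)))`, continuously extended to `u = 0`. -/
def logRatio (u : ℝ) : ℝ := -log (dslope (fun u => 1 - exp (-u)) 0 u)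

lemma logRatio_zero : logRatio 0 = 0 := by
  have : HasDerivAt (fun u : ℝ => 1 - exp (-u)) (-(exp (-0) * -1)) 0 :=
    ((hasDerivAt_neg (0 : ℝ)).exp).const_sub 1
  rw [logRatio, dslope_same, this.deriv]; simp

lemma exp_logRatio {u : ℝ} (hu : 0 < u) : (1 - exp (-u)) * exp (logRatio u) = u := by
  have h := dslope_one_sub_exp_pos hu.le
  rw [logRatio, exp_neg (log _), exp_log h, dslope_of_ne _ hu.ne', slope_def_field]
  have : exp (-u) < 1 := by rw [exp_lt_one_iff]; linarith
  have : 1 - exp (-u) ≠ 0 := by linarith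
  simp only [neg_zero, exp_zero, sub_self, sub_zero]
  field_simp

/-- After division by `exp u` this is the square of `u / 2 ≤ sinh (u / 2)`. -/
lemma sq_mul_exp_le {u : ℝ} (hu : 0 ≤ u) : u ^ 2 * exp u ≤ (exp u - 1) ^ 2 := by
  have h1 : u / 2 ≤ sinh (u / 2) := self_le_sinh_iff.2 (by linarith)
  have h2 : exp u - 1 = 2 * exp (u / 2) * sinh (u / 2) := by
    rw [sinh_eq]
    have e1 : exp (u / 2) * exp (u / 2) = exp u := by rw [← exp_add]; congr 1; ring
    have e2 : exp (u / 2) * exp (-(u / 2)) = 1 := by rw [← exp_add]; simp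
    linear_combination -e1 + e2
  have h3 : exp u = exp (u / 2) ^ 2 := by rw [← exp_nat_mul]; congr 1; push_cast; ring
  rw [h2, h3]
  have h4 : u ^ 2 ≤ (2 * sinh (u / 2)) ^ 2 := pow_le_pow_left₀ hu (by linarith) 2
  calc _ ≤ (2 * sinh (u / 2)) ^ 2 * exp (u / 2) ^ 2 := by gcongr
    _ = _ := by ring

/-- The second derivative is `exp u / (exp u - 1) ^ 2 - 1 / u ^ 2`, nonpositive by `sq_mul_exp_le`.
-/
lemma concaveOn_logRatio : ConcaveOn ℝ (Set.Ici 0) logRatio := by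
  refine concaveOn_of_hasDerivWithinAt2_nonpos (convex_Ici 0)
    (f' := fun u => 1 / u - 1 / (exp u - 1))
    (f'' := fun u => -1 / u ^ 2 + exp u / (exp u - 1) ^ 2) ?_ ?_ ?_ ?_
  · have h1 : Continuous (dslope (fun u : ℝ => 1 - exp (-u)) 0) := by
      rw [← continuousOn_univ]
      refine (continuousOn_dslope univ_mem).2 ⟨by fun_prop, ?_⟩
      fun_prop
    exact (h1.continuousOn.log fun u hu => (dslope_one_sub_exp_pos hu).ne').neg
  · intro u hu
    rw [interior_Ici] at hu
    have hu : 0 < u := hu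
    have hlt : exp (-u) < 1 := by rw [exp_lt_one_iff]; linarith
    have hgt : 1 < exp u := by rw [one_lt_exp_iff]; exact hu
    have h1 : HasDerivAt (fun u : ℝ => log u - log (1 - exp (-u)))
        (u⁻¹ - (-(exp (-u) * -1)) / (1 - exp (-u))) u :=
      (hasDerivAt_log hu.ne').sub
        ((((hasDerivAt_neg u).exp).const_sub 1).log (by linarith))
    refine HasDerivAt.hasDerivWithinAt ((h1.congr_of_eventuallyEq ?_).congr_deriv ?_)
    · filter_upwards [lt_mem_nhds hu] with x hx
      have : exp (-x) < 1 := by rw [exp_lt_one_iff]; linarith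
      rw [logRatio, dslope_of_ne _ hx.ne', slope_def_field]
      simp only [neg_zero, exp_zero, sub_self, sub_zero]
      rw [log_div (by linarith) hx.ne']; ring
    · have e : exp (-u) = (exp u)⁻¹ := exp_neg u
      have h2 : exp u - 1 ≠ 0 := by linarith
      have h3 : exp u ≠ 0 := (exp_pos u).ne'
      have h4 : 1 - (exp u)⁻¹ ≠ 0 := by rw [← e]; linarith
      have h5 : 1 - (exp u)⁻¹ = (exp u - 1) / exp u := by field_simp
      rw [e, h5]
      field_simp
  · intro u hu
    rw [interior_Ici] at hu
    have hu : 0 < u := hu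
    have hgt : 1 < exp u := by rw [one_lt_exp_iff]; exact hu
    have h2 : exp u - 1 ≠ 0 := by linarith
    have h1 := ((hasDerivAt_inv hu.ne')).sub
      (((Real.hasDerivAt_exp u).sub_const 1).inv h2)
    refine HasDerivAt.hasDerivWithinAt ((h1.congr_of_eventuallyEq ?_).congr_deriv ?_)
    · exact Eventually.of_forall fun x => by simp
    · ring
  · intro u hu
    rw [interior_Ici] at hu
    have hu : 0 < u := hu
    have hgt : 1 < exp u := by rw [one_lt_exp_iff]; exact hu
    have h2 : 0 < exp u - 1 := by linarith
    have : exp u / (exp u - 1) ^ 2 ≤ 1 / u ^ 2 := by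
      rw [div_le_div_iff₀ (by positivity) (by positivity)]
      linarith [sq_mul_exp_le hu.le]
    have h3 : -1 / u ^ 2 = -(1 / u ^ 2) := by ring
    linarith

lemma logRatio_mul_le {s t : ℝ} (hs : 0 ≤ s) (hst : s ≤ t) :
    s * logRatio t ≤ t * logRatio s := by
  rcases hs.eq_or_lt with rfl | hs
  · simp [logRatio_zero]
  have ht : 0 < t := hs.trans_le hst
  have hd : 0 ≤ 1 - s / t := by rw [sub_nonneg, div_le_one ht]; exact hst
  have h := concaveOn_logRatio.2 (Set.self_mem_Ici (a := (0 : ℝ))) (Set.mem_Ici.2 ht.le) hd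
    (by positivity : 0 ≤ s / t) (by ring)
  simp only [smul_eq_mul, mul_zero, zero_add, logRatio_zero] at h
  rw [div_mul_cancel₀ _ ht.ne', div_mul_eq_mul_div, div_le_iff₀ ht] at h
  linarith

variable {N : ℕ}

lemma etaL_pos (hN : 0 < N) : 0 < etaL N := by
  have : (0 : ℝ) < N := by exact_mod_cast hN
  unfold etaL; positivity

/-- This value of `η` makes the approximation agree with the Gamma distribution function to leading
order at `0`. -/
lemma etaL_pow (hN : 0 < N) : etaL N ^ N = (N : ℝ) ^ N / N.factorial := by
  have hNr : (N : ℝ) ≠ 0 := by positivity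
  rw [etaL, mul_pow, ← rpow_natCast ((N.factorial : ℝ) ^ _), ← rpow_mul (by positivity)]
  rw [show -(1 / (N : ℝ)) * N = -1 by field_simp, rpow_neg_one]
  rfl

lemma gammaApprox_nonneg (hN : 0 < N) {x : ℝ} (hx : 0 ≤ x) : 0 ≤ gammaApprox N x := by
  have := etaL_pos hN
  refine pow_nonneg (sub_nonneg.2 (exp_le_one_iff.2 ?_)) _
  have : 0 ≤ etaL N * x := by positivity
  linarith

lemma gammaApprox_le_one (hN : 0 < N) {x : ℝ} (hx : 0 ≤ x) : gammaApprox N x ≤ 1 := by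
  have h := etaL_pos hN
  have h2 : 0 ≤ etaL N * x := by positivity
  exact pow_le_one₀ (sub_nonneg.2 (exp_le_one_iff.2 (by linarith)))
    (by linarith [exp_pos (-(etaL N * x))])

lemma gammaMeasure_real_Iic (hN : 0 < N) {x : ℝ} (hx : 0 ≤ x) :
    (gammaMeasure N N).real (Set.Iic x) =
      ∫ y in (0 : ℝ)..x, (N : ℝ) ^ N / Gamma N * y ^ (N - 1) * exp (-(N * y)) := by
  have hNr : (0 : ℝ) < N := by exact_mod_cast hN
  have := isProbabilityMeasure_gammaMeasure hNr hNr
  rw [← cdf_eq_real, cdf_gammaMeasure_eq_integral hNr hNr]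
  have hint : Integrable (gammaPDFReal N N) := by
    refine ⟨by fun_prop, ?_⟩
    rw [hasFiniteIntegral_iff_ofReal (ae_of_all _ fun y => gammaPDFReal_nonneg hNr hNr y)]
    have := lintegral_gammaPDF_eq_one hNr hNr
    simp only [gammaPDF] at this
    rw [this]; simp
  have h0 : ∫ y in Set.Iic (0 : ℝ), gammaPDFReal N N y = 0 := by
    rw [← setIntegral_congr_set Iio_ae_eq_Iic]
    refine setIntegral_eq_zero_of_forall_eq_zero fun y (hy : y < 0) => ?_
    rw [gammaPDFReal, if_neg (not_le.2 hy)]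
  have h1 := intervalIntegral.integral_Iic_sub_Iic (μ := volume) (f := gammaPDFReal N N)
    (a := 0) (b := x) hint.integrableOn hint.integrableOn
  rw [h0, sub_zero] at h1
  rw [h1]
  refine intervalIntegral.integral_congr fun y hy => ?_
  rw [Set.uIcc_of_le hx] at hy
  simp only [gammaPDFReal, if_pos hy.1]
  rw [rpow_natCast, ← rpow_natCast y, Nat.cast_sub hN, Nat.cast_one]

/-- Derivative of the difference of the Gamma distribution function and its approximation. -/
def alzerDeriv (N : ℕ) (x : ℝ) : ℝ :=
  (N : ℝ) ^ N / Gamma N * x ^ (N - 1) * exp (-(N * x)) -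
    N * (1 - exp (-(etaL N * x))) ^ (N - 1) * (etaL N * exp (-(etaL N * x)))

lemma hasDerivAt_alzer (N : ℕ) (x : ℝ) :
    HasDerivAt (fun x => (∫ y in (0 : ℝ)..x, (N : ℝ) ^ N / Gamma N * y ^ (N - 1) *
      exp (-(N * y))) - gammaApprox N x) (alzerDeriv N x) x := by
  have hc : Continuous fun y : ℝ => (N : ℝ) ^ N / Gamma N * y ^ (N - 1) * exp (-(N * y)) := by
    fun_prop
  refine HasDerivAt.sub (hc.integral_hasStrictDerivAt 0 x).hasDerivAt ?_
  have h1 : HasDerivAt (fun x => 1 - exp (-(etaL N * x)))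
      (-(exp (-(etaL N * x)) * (-(etaL N * 1)))) x :=
    ((((hasDerivAt_id x).const_mul (etaL N)).neg).exp).const_sub 1
  refine (h1.pow N).congr_deriv ?_
  ring

/-- Writing `η x = (1 - exp (-η x)) * exp (logRatio (η x))` brings out a common factor and leaves a
difference of two exponentials, whose sign is that of the difference of exponents. -/
lemma alzerDeriv_eq (hN : 0 < N) {x : ℝ} (hx : 0 < x) :
    alzerDeriv N x = N * etaL N * (1 - exp (-(etaL N * x))) ^ (N - 1) *
      (exp ((N - 1 : ℝ) * logRatio (etaL N * x) - N * x) - exp (-(etaL N * x))) := by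
  have hη := etaL_pos hN
  have hu : 0 < etaL N * x := by positivity
  have h1 : (1 - exp (-(etaL N * x))) ^ (N - 1) * exp ((N - 1 : ℝ) * logRatio (etaL N * x)) =
      (etaL N * x) ^ (N - 1) := by
    conv_rhs => rw [← exp_logRatio hu, mul_pow, ← exp_nat_mul, Nat.cast_sub hN, Nat.cast_one]
  have h2 : (N : ℝ) ^ N / Gamma N = N * etaL N ^ N := by
    obtain ⟨n, rfl⟩ := Nat.exists_eq_succ_of_ne_zero hN.ne'
    rw [etaL_pow hN, Nat.succ_eq_add_one, Nat.cast_add_one, Gamma_nat_eq_factorial,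
      Nat.factorial_succ]
    push_cast
    have : (n.factorial : ℝ) ≠ 0 := by positivity
    field_simp
  have h3 : etaL N ^ N = etaL N * etaL N ^ (N - 1) := by
    rw [← pow_succ', Nat.sub_add_cancel hN]
  rw [sub_eq_add_neg _ ((N : ℝ) * x), exp_add, alzerDeriv, h2, h3]
  rw [mul_pow] at h1
  linear_combination (-(N * etaL N * exp (-(N * x)))) * h1

/-- The difference `g` of the two functions vanishes at `0` and at infinity. Its derivative has the
sign of `h`, and `h y / y` is nonincreasing, so `g` can only rise first and fall afterwards. If `h x
≥ 0`, it rises on `[0, x]` from `0`; otherwise it falls on `[x, ∞)` to `0`. -/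
theorem gammaApprox_le_gammaMeasure (hN : 0 < N) {x : ℝ} (hx : 0 ≤ x) :
    gammaApprox N x ≤ (gammaMeasure N N).real (Set.Iic x) := by
  have hNr : (0 : ℝ) < N := by exact_mod_cast hN
  have := isProbabilityMeasure_gammaMeasure hNr hNr
  rcases hx.eq_or_lt with rfl | hx
  · simp [gammaApprox, hN.ne']
  have hη := etaL_pos hN
  set g : ℝ → ℝ := fun x => (∫ y in (0 : ℝ)..x, (N : ℝ) ^ N / Gamma N * y ^ (N - 1) *
      exp (-(N * y))) - gammaApprox N x with hg
  have hgd : ∀ x, HasDerivAt g (alzerDeriv N x) x := hasDerivAt_alzer N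
  have hgc : Continuous g := continuous_iff_continuousAt.2 fun x => (hgd x).continuousAt
  have hg0 : g 0 = 0 := by simp [hg, gammaApprox, hN.ne']
  suffices 0 ≤ g x by
    rw [gammaMeasure_real_Iic hN hx.le]; simp only [hg] at this; linarith
  set h : ℝ → ℝ := fun y => (N - 1 : ℝ) * logRatio (etaL N * y) - N * y + etaL N * y with hh
  have hN1 : (0 : ℝ) ≤ N - 1 := by
    have : (1 : ℝ) ≤ N := by exact_mod_cast hN
    linarith
  have hmono : ∀ s t : ℝ, 0 ≤ s → s ≤ t → s * h t ≤ t * h s := by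
    intro s t hs hst
    have h1 := logRatio_mul_le (s := etaL N * s) (t := etaL N * t) (by positivity) (by gcongr)
    have h2 : s * logRatio (etaL N * t) ≤ t * logRatio (etaL N * s) := by
      rw [mul_assoc, mul_assoc] at h1
      exact le_of_mul_le_mul_left h1 hη
    have h3 := mul_le_mul_of_nonneg_left h2 hN1
    simp only [hh]
    linear_combination h3
  have hfac : ∀ y, 0 < y → 0 ≤ N * etaL N * (1 - exp (-(etaL N * y))) ^ (N - 1) := by
    intro y hy
    have : 0 ≤ 1 - exp (-(etaL N * y)) := sub_nonneg.2 (exp_le_one_iff.2 (by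
      have : 0 ≤ etaL N * y := by positivity
      linarith))
    positivity
  have hpos : ∀ y, 0 < y → 0 ≤ h y → 0 ≤ alzerDeriv N y := by
    intro y hy hy2
    rw [alzerDeriv_eq hN hy]
    refine mul_nonneg (hfac y hy) (sub_nonneg.2 (exp_le_exp.2 ?_))
    simp only [hh] at hy2; linarith
  have hneg : ∀ y, 0 < y → h y ≤ 0 → alzerDeriv N y ≤ 0 := by
    intro y hy hy2
    rw [alzerDeriv_eq hN hy]
    refine mul_nonpos_of_nonneg_of_nonpos (hfac y hy) (sub_nonpos.2 (exp_le_exp.2 ?_))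
    simp only [hh] at hy2; linarith
  rcases le_or_gt 0 (h x) with hx0 | hx0
  · have hm : MonotoneOn g (Set.Icc 0 x) := by
      refine monotoneOn_of_hasDerivWithinAt_nonneg (convex_Icc 0 x) hgc.continuousOn
        (fun y _ => (hgd y).hasDerivWithinAt) fun y hy => ?_
      rw [interior_Icc] at hy
      refine hpos y hy.1 ?_
      have := hmono y x hy.1.le hy.2.le
      by_contra! hc
      have h1 : 0 ≤ y * h x := mul_nonneg hy.1.le hx0
      have h2 : x * h y < 0 := mul_neg_of_pos_of_neg hx hc
      linarith
    rw [← hg0]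
    exact hm ⟨le_rfl, hx.le⟩ ⟨hx.le, le_rfl⟩ hx.le
  · have hm : AntitoneOn g (Set.Ici x) := by
      refine antitoneOn_of_hasDerivWithinAt_nonpos (convex_Ici x) hgc.continuousOn
        (fun y _ => (hgd y).hasDerivWithinAt) fun y hy => ?_
      rw [interior_Ici] at hy
      have hy : x < y := hy
      refine hneg y (hx.trans hy) ?_
      have := hmono x y hx.le hy.le
      by_contra! hc
      have h1 : 0 < x * h y := mul_pos hx hc
      have h2 : y * h x < 0 := mul_neg_of_pos_of_neg (hx.trans hy) hx0
      linarith
    have hlim : Tendsto g atTop (𝓝 (1 - 1)) := by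
      refine Tendsto.sub ?_ ?_
      · refine (tendsto_cdf_atTop (gammaMeasure N N)).congr' ?_
        filter_upwards [eventually_ge_atTop 0] with y hy
        rw [cdf_eq_real, gammaMeasure_real_Iic hN hy]
      · have h1 : Tendsto (fun y => exp (-(etaL N * y))) atTop (𝓝 0) :=
          tendsto_exp_neg_atTop_nhds_zero.comp (tendsto_id.const_mul_atTop hη)
        have h2 := (h1.const_sub 1).pow N
        rw [sub_zero, one_pow] at h2
        exact h2
    rw [sub_self] at hlim
    refine le_of_tendsto hlim ?_
    filter_upwards [eventually_ge_atTop x] with y hy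
    exact hm Set.self_mem_Ici hy hy

end Alzer

namespace HetNet

variable {S : HetNet}

/-! ### Association regions -/

/-- A BS of tier `i` at distance `r` has a link of positive average power. -/
def InRange (S : HetNet) (i : Fin 2) (r : ℝ) : Prop := 0 < r ∧ (i = 0 ∨ r ≤ S.RL)

/-- A BS of tier `j` beats one of tier `i` at distance `r` when it is closer than this. -/
def powerRadius (S : HetNet) (i j : Fin 2) (r : ℝ) : ℝ :=
  if j = 0 then (S.powRatio j i * r ^ S.alpha i) ^ (1 / S.alpha j)
  else min S.RL ((S.powRatio j i * r ^ S.alpha i) ^ (1 / S.alpha j))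

lemma Valid.alpha_pos (hS : S.Valid) (i : Fin 2) : 0 < S.alpha i := by
  fin_cases i
  · exact lt_trans two_pos hS.alpha_first
  · exact lt_of_lt_of_le two_pos hS.alpha_second

lemma Valid.nakOf_pos (hS : S.Valid) (i : Fin 2) : 0 < S.nakOf i := by
  unfold nakOf; split_ifs
  · exact one_pos
  · exact hS.nak_pos

lemma Valid.powRatio_pos (hS : S.Valid) (i j : Fin 2) : 0 < S.powRatio i j := by
  have h1 := hS.bias_pos; have h2 := hS.pow_pos; have h3 := hS.inter_pos
  have h4 : ∀ i, (0 : ℝ) < S.ant i := fun i => by exact_mod_cast hS.ant_pos i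
  unfold powRatio
  exact div_pos (mul_pos (mul_pos (mul_pos (h1 _) (h2 _)) (h3 _)) (h4 _))
    (mul_pos (mul_pos (mul_pos (h1 _) (h2 _)) (h3 _)) (h4 _))

lemma powRatio_self (hS : S.Valid) (i : Fin 2) : S.powRatio i i = 1 := by
  have h1 := hS.bias_pos; have h2 := hS.pow_pos; have h3 := hS.inter_pos
  have h4 : ∀ i, (0 : ℝ) < S.ant i := fun i => by exact_mod_cast hS.ant_pos i
  exact div_self (mul_pos (mul_pos (mul_pos (h1 _) (h2 _)) (h3 _)) (h4 _)).ne'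

lemma threshold_pos (hS : S.Valid) (i : Fin 2) {R : ℝ} (hR : 0 < R) : 0 < S.threshold i R := by
  have h := hS.bw_pos i
  exact sub_pos.2 (Real.one_lt_rpow one_lt_two (by positivity))

lemma measurable_unitStep : Measurable unitStep :=
  Measurable.ite measurableSet_Ici measurable_const measurable_const

lemma measurable_pathLoss (S : HetNet) (i : Fin 2) : Measurable (S.pathLoss i) := by
  have h : Measurable fun r => unitStep (S.RL - r) :=
    measurable_unitStep.comp (measurable_const.sub measurable_id)
  unfold pathLoss
  split_ifs
  · fun_prop
  · exact (h.mul_const _).mul (by fun_prop)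

lemma pathLoss_of_inRange {i : Fin 2} {r : ℝ} (h : S.InRange i r) :
    S.pathLoss i r = S.inter i * r ^ (-S.alpha i) := by
  fin_cases i
  · simp [pathLoss]
  · have h2 : r ≤ S.RL := h.2.resolve_left (by simp)
    simp [pathLoss, unitStep, h2]

lemma pathLoss_of_not_inRange (hS : S.Valid) {i : Fin 2} {r : ℝ} (hr : 0 ≤ r)
    (h : ¬ S.InRange i r) : S.pathLoss i r = 0 := by
  rcases hr.eq_or_lt with rfl | hr
  · have h1 : -S.alpha i ≠ 0 := by linarith [hS.alpha_pos i]
    fin_cases i <;> simp_all [pathLoss, Real.zero_rpow]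
  · fin_cases i
    · exact (h ⟨hr, Or.inl rfl⟩).elim
    · have h2 : ¬ r ≤ S.RL := fun h' => h ⟨hr, Or.inr h'⟩
      simp [pathLoss, unitStep, h2]

lemma pathLoss_nonneg (hS : S.Valid) (i : Fin 2) {r : ℝ} (hr : 0 ≤ r) : 0 ≤ S.pathLoss i r := by
  by_cases h : S.InRange i r
  · rw [pathLoss_of_inRange h]
    exact mul_nonneg (hS.inter_pos i).le (Real.rpow_nonneg hr _)
  · rw [pathLoss_of_not_inRange hS hr h]

lemma pathLoss_pos (hS : S.Valid) {i : Fin 2} {r : ℝ} (h : S.InRange i r) :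
    0 < S.pathLoss i r := by
  rw [pathLoss_of_inRange h]
  exact mul_pos (hS.inter_pos i) (Real.rpow_pos_of_pos h.1 _)

/-- Inverts the power law of the competitor; a tie counts as blocking. A BS out of range has zero
power and blocks nothing. This includes distance zero, where `0 ^ (-α) = 0`, hence the condition `0
< y`. -/
lemma power_lt_iff (hS : S.Valid) {i j : Fin 2} {r y : ℝ} (hr : S.InRange i r) (hy : 0 ≤ y) :
    S.bias j * S.pow j * S.pathLoss j y * S.ant j * G0 <
      S.bias i * S.pow i * S.pathLoss i r * S.ant i * G0 ↔
      ¬ (0 < y ∧ y ≤ S.powerRadius i j r) := by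
  have h1 := hS.bias_pos; have h2 := hS.pow_pos; have h3 := hS.inter_pos
  have h4 : ∀ i, (0 : ℝ) < S.ant i := fun i => by exact_mod_cast hS.ant_pos i
  have hi := pathLoss_pos hS hr
  have hpos : 0 < S.bias i * S.pow i * S.pathLoss i r * S.ant i * G0 := by
    have := h1 i; have := h2 i; have := h4 i
    unfold G0; positivity
  by_cases hj : S.InRange j y
  · have hy0 := hj.1
    have hα := hS.alpha_pos j
    have key : S.bias j * S.pow j * S.pathLoss j y * S.ant j * G0 <
        S.bias i * S.pow i * S.pathLoss i r * S.ant i * G0 ↔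
        (S.powRatio j i * r ^ S.alpha i) ^ (1 / S.alpha j) < y := by
      have hr0 := hr.1
      have b1 := h1 i; have b2 := h2 i; have b3 := h3 i; have b4 := h4 i
      have c1 := h1 j; have c2 := h2 j; have c3 := h3 j; have c4 := h4 j
      have e1 : 0 < r ^ S.alpha i := Real.rpow_pos_of_pos hr0 _
      have e2 : 0 < y ^ S.alpha j := Real.rpow_pos_of_pos hy0 _
      rw [one_div, Real.rpow_inv_lt_iff_of_pos (mul_pos (hS.powRatio_pos j i) e1).le hy hα,
        pathLoss_of_inRange hr, pathLoss_of_inRange hj, Real.rpow_neg hr0.le, Real.rpow_neg hy,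
        powRatio, G0, div_mul_eq_mul_div, div_lt_iff₀ (by positivity)]
      constructor <;> intro h
      · have := mul_lt_mul_of_pos_right h (mul_pos e1 e2)
        field_simp at this
        linarith
      · refine lt_of_mul_lt_mul_right ?_ (mul_pos e1 e2).le
        field_simp
        linarith
    rw [key, not_and]
    constructor
    · intro h _
      unfold powerRadius
      split_ifs
      · exact not_le.2 h
      · exact fun h' => absurd (h'.trans (min_le_right _ _)) (not_le.2 h)
    · intro h
      have h := h hy0
      unfold powerRadius at h
      split_ifs at h with hj0
      · exact not_le.1 h
      · rw [le_min_iff, not_and] at h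
        exact not_le.1 (h (hj.2.resolve_left hj0))
  · rw [pathLoss_of_not_inRange hS hy hj]
    simp only [mul_zero, zero_mul]
    refine iff_of_true hpos fun ⟨h, h'⟩ => hj ⟨h, ?_⟩
    by_cases hj0 : j = 0
    · exact Or.inl hj0
    · rw [powerRadius, if_neg hj0] at h'
      exact Or.inr (h'.trans (min_le_left _ _))

lemma powerRadius_self (hS : S.Valid) {i : Fin 2} {r : ℝ} (hr : S.InRange i r) :
    S.powerRadius i i r = r := by
  have h : (S.powRatio i i * r ^ S.alpha i) ^ (1 / S.alpha i) = r := by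
    rw [powRatio_self hS, one_mul, ← Real.rpow_mul hr.1.le, mul_one_div,
      div_self (hS.alpha_pos i).ne', Real.rpow_one]
  rw [powerRadius, h]
  split_ifs with h0
  · rfl
  · exact min_eq_right (hr.2.resolve_left h0)

lemma powerRadius_nonneg (hS : S.Valid) (i j : Fin 2) {r : ℝ} (hr : 0 ≤ r) :
    0 ≤ S.powerRadius i j r := by
  have h : 0 ≤ (S.powRatio j i * r ^ S.alpha i) ^ (1 / S.alpha j) :=
    Real.rpow_nonneg (mul_nonneg (hS.powRatio_pos j i).le (Real.rpow_nonneg hr _)) _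
  unfold powerRadius
  split_ifs
  · exact h
  · exact le_min hS.RL_pos.le h

lemma powerRadius_monotone (hS : S.Valid) (i j : Fin 2) :
    MonotoneOn (S.powerRadius i j) (Set.Ici 0) := by
  intro r (hr : 0 ≤ r) s _ hrs
  have h : (S.powRatio j i * r ^ S.alpha i) ^ (1 / S.alpha j) ≤
      (S.powRatio j i * s ^ S.alpha i) ^ (1 / S.alpha j) := by
    have := (hS.powRatio_pos j i).le
    have h1 := (hS.alpha_pos i).le
    have h2 := hS.alpha_pos j
    gcongr
  unfold powerRadius
  split_ifs
  · exact h
  · exact min_le_min_left _ h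

lemma measurable_powerRadius (S : HetNet) (i j : Fin 2) : Measurable (S.powerRadius i j) := by
  unfold powerRadius
  split_ifs <;> fun_prop

variable {Ω : Type*}

namespace Deployment

variable {D : Deployment Ω}

/-- BS `k` of tier `i` is in range and closer than all other BSs of tier `i` whose cache satisfies
`e`, and no BS of tier `o` whose cache satisfies `e'` beats it. -/
def Selected (S : HetNet) (D : Deployment Ω) (i o : Fin 2) (e e' : (ℕ → Bool) → Bool) (k : ℕ)
    (ω : Ω) : Prop :=
  e (D.cache i k ω) = true ∧ S.InRange i ‖D.pos i k ω‖ ∧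
    (∀ l, l ≠ k → e (D.cache i l ω) = true →
      ¬ (0 < ‖D.pos i l ω‖ ∧ ‖D.pos i l ω‖ ≤ ‖D.pos i k ω‖)) ∧
    ∀ l, e' (D.cache o l ω) = true →
      ¬ (0 < ‖D.pos o l ω‖ ∧ ‖D.pos o l ω‖ ≤ S.powerRadius i o ‖D.pos i k ω‖)

lemma Selected.unique {i o : Fin 2} {e e' : (ℕ → Bool) → Bool} {k l : ℕ} {ω : Ω}
    (hk : D.Selected S i o e e' k ω) (hl : D.Selected S i o e e' l ω) : k = l := by
  by_contra h
  have h1 := hk.2.2.1 l (Ne.symm h) hl.1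
  have h2 := hl.2.2.1 k h hk.1
  rw [not_and, not_le] at h1 h2
  exact lt_asymm (h1 hl.2.1.1) (h2 hk.2.1.1)

lemma avgPower_pos_iff (hS : S.Valid) (i : Fin 2) (k : ℕ) (ω : Ω) :
    0 < D.avgPower S i k ω ↔ S.InRange i ‖D.pos i k ω‖ := by
  have h1 := hS.bias_pos i; have h2 := hS.pow_pos i
  have h4 : (0 : ℝ) < S.ant i := by exact_mod_cast hS.ant_pos i
  unfold avgPower
  constructor
  · intro h
    by_contra hc
    rw [pathLoss_of_not_inRange hS (norm_nonneg _) hc] at h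
    simp at h
  · intro h
    have := pathLoss_pos hS h
    unfold G0; positivity

/-- Within the own tier the power radius is the serving distance itself, so comparing powers means
comparing distances. -/
lemma serves_iff (hS : S.Valid) {i o : Fin 2} (hio : o ≠ i) (k f : ℕ) (ω : Ω) :
    D.Serves S i k f ω ↔ D.Selected S i o (fun c => c f) (fun c => c f) k ω := by
  unfold Serves Selected
  rw [avgPower_pos_iff hS]
  refine and_congr_right fun _ => and_congr_right fun hr => ?_
  have key : ∀ j l, D.avgPower S j l ω < D.avgPower S i k ω ↔
      ¬ (0 < ‖D.pos j l ω‖ ∧ ‖D.pos j l ω‖ ≤ S.powerRadius i j ‖D.pos i k ω‖) := fun j l =>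
    power_lt_iff hS hr (norm_nonneg _)
  simp only [key]
  constructor
  · intro h
    refine ⟨fun l hl hc => ?_, fun l hc => h o l (by simp [hio]) hc⟩
    have := h i l (by simp [hl]) hc
    rwa [powerRadius_self hS hr] at this
  · rintro ⟨ha, hb⟩ j l hjl hc
    by_cases hj : j = i
    · subst hj
      rw [powerRadius_self hS hr]
      exact ha l (by simpa using hjl) hc
    · have : j = o := by omega
      subst this
      exact hb l hc

/-- With `e` always true and `e'` always false, nearest-BS association takes the same form as
Max-RP, and one computation serves both. -/
lemma nearest_iff {ω : Ω} (h0 : ∀ l, D.pos 0 l ω ≠ 0) (k : ℕ) :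
    D.Nearest k ω ↔ D.Selected S 0 1 (fun _ => true) (fun _ => false) k ω := by
  have h1 : ∀ l, 0 < ‖D.pos 0 l ω‖ := fun l => norm_pos_iff.2 (h0 l)
  simp [Nearest, Selected, InRange, h1]

/-! ### Rates -/

/-- The fading gain of the serving link that is needed for the SINR threshold `t`. -/
def neededGain (S : HetNet) (D : Deployment Ω) (noise t : ℝ) (i : Fin 2) (k : ℕ) (ω : Ω) : ℝ≥0∞ :=
  ENNReal.ofReal t * (ENNReal.ofReal noise + D.interference S i k ω) /
    ENNReal.ofReal (S.pow i * S.pathLoss i ‖D.pos i k ω‖ * G0 * S.ant i)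

lemma lt_rate_iff_lt_sinr (hS : S.Valid) {R : ℝ} (hR : 0 < R) (noise : Fin 2 → ℝ) (i : Fin 2)
    (k : ℕ) (ω : Ω) : (R : EReal) < D.rate S noise i k ω ↔
      ENNReal.ofReal (S.threshold i R) < D.sinr S noise i k ω := by
  have hB := hS.bw_pos i
  have hl : 0 < Real.log 2 := Real.log_pos one_lt_two
  unfold rate
  generalize D.sinr S noise i k ω = x
  rcases eq_or_ne x ⊤ with rfl | hx
  · refine iff_of_true ?_ ENNReal.ofReal_lt_top
    rw [add_top, ENNReal.log_top, EReal.top_div_of_pos_ne_top (by exact_mod_cast hl)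
      (EReal.coe_ne_top _), EReal.coe_mul_top_of_pos hB]
    exact EReal.coe_lt_top R
  · lift x to ℝ≥0 using hx
    have e : (1 : ℝ≥0∞) + x = ENNReal.ofReal (1 + x) := by
      rw [ENNReal.ofReal_add zero_le_one x.coe_nonneg, ENNReal.ofReal_one, ENNReal.ofReal_coe_nnreal]
    have hx1 : (0 : ℝ) < 1 + x := by positivity
    rw [e, ENNReal.log_ofReal_of_pos hx1, ← EReal.coe_div, ← EReal.coe_mul, EReal.coe_lt_coe_iff,
      ← ENNReal.ofReal_coe_nnreal, ENNReal.ofReal_lt_ofReal_iff_of_nonneg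
        (threshold_pos hS i hR).le, threshold, sub_lt_iff_lt_add', ← mul_div_assoc, lt_div_iff₀ hl,
      ← div_lt_iff₀' hB, Real.lt_log_iff_exp_lt hx1, Real.rpow_def_of_pos two_pos,
      mul_div_assoc', mul_comm R]

lemma lt_sinr_iff (hS : S.Valid) {t : ℝ} (ht : 0 < t) (noise : Fin 2 → ℝ) {i : Fin 2} {k : ℕ}
    {ω : Ω} (hr : S.InRange i ‖D.pos i k ω‖) : ENNReal.ofReal t < D.sinr S noise i k ω ↔
      D.neededGain S (noise i) t i k ω < ENNReal.ofReal (D.gain i k ω) := by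
  have h1 := pathLoss_pos hS hr
  have h2 := hS.pow_pos i
  have h4 : (0 : ℝ) < S.ant i := by exact_mod_cast hS.ant_pos i
  have hq : 0 < S.pow i * S.pathLoss i ‖D.pos i k ω‖ * G0 * S.ant i := by unfold G0; positivity
  have ht' : ENNReal.ofReal t ≠ 0 := by simpa using ht
  have hq' : ENNReal.ofReal (S.pow i * S.pathLoss i ‖D.pos i k ω‖ * G0 * S.ant i) ≠ 0 := by
    simpa using hq
  unfold sinr neededGain
  rw [ENNReal.lt_div_iff_mul_lt (Or.inr ENNReal.ofReal_ne_top) (Or.inr ht'),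
    ENNReal.div_lt_iff (Or.inl hq') (Or.inl ENNReal.ofReal_ne_top), ENNReal.ofReal_mul hq.le,
    mul_comm (ENNReal.ofReal (D.gain i k ω))]

/-! ### Measurability -/

variable [MeasurableSpace Ω]

/-- All components of the network are random variables. -/
structure IsMeasurable (D : Deployment Ω) : Prop where
  pos : ∀ i k, Measurable (D.pos i k)
  cache : ∀ i k, Measurable (D.cache i k)
  gain : ∀ i k, Measurable (D.gain i k)
  aod : ∀ i k, Measurable (D.aod i k)

lemma Law.isMeasurable {μ : Measure Ω} (hD : D.Law S μ) : D.IsMeasurable :=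
  ⟨fun i => (hD.poisson i).measurable, hD.measurable_cache, hD.measurable_gain, hD.measurable_aod⟩

lemma IsMeasurable.mark (hD : D.IsMeasurable) (i : Fin 2) (k : ℕ) : Measurable (D.mark i k) :=
  (hD.cache i k).prodMk ((hD.gain i k).prodMk (hD.aod i k))

lemma IsMeasurable.selected (hD : D.IsMeasurable) (S : HetNet) (i o : Fin 2)
    {e e' : (ℕ → Bool) → Bool} (he : Measurable e) (he' : Measurable e') (k : ℕ) :
    MeasurableSet {ω | D.Selected S i o e e' k ω} := by
  have hn : ∀ i k, Measurable fun ω => ‖D.pos i k ω‖ := fun i k => (hD.pos i k).norm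
  have hc : ∀ {e : (ℕ → Bool) → Bool}, Measurable e → ∀ i k,
      MeasurableSet {ω | e (D.cache i k ω) = true} := fun {e} he i k =>
    measurableSet_eq_fun (he.comp (hD.cache i k)) measurable_const
  have h0 : ∀ i k, MeasurableSet {ω | 0 < ‖D.pos i k ω‖} := fun i k =>
    measurableSet_lt measurable_const (hn i k)
  refine (hc he i k).inter (MeasurableSet.inter ?_ (MeasurableSet.inter ?_ ?_))
  · refine (h0 i k).inter (MeasurableSet.union (MeasurableSet.const _) ?_)
    exact measurableSet_le (hn i k) measurable_const
  · change MeasurableSet {ω | ∀ l, l ≠ k → e (D.cache i l ω) = true → ¬ (0 < ‖D.pos i l ω‖ ∧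
        ‖D.pos i l ω‖ ≤ ‖D.pos i k ω‖)}
    rw [show {ω | ∀ l, l ≠ k → e (D.cache i l ω) = true → ¬ (0 < ‖D.pos i l ω‖ ∧
        ‖D.pos i l ω‖ ≤ ‖D.pos i k ω‖)} = ⋂ l, ⋂ _ : l ≠ k,
        ({ω | e (D.cache i l ω) = true} ∩ ({ω | 0 < ‖D.pos i l ω‖} ∩
          {ω | ‖D.pos i l ω‖ ≤ ‖D.pos i k ω‖}))ᶜ by ext; simp]
    exact MeasurableSet.iInter fun l => MeasurableSet.iInter fun _ =>
      ((hc he i l).inter ((h0 i l).inter (measurableSet_le (hn i l) (hn i k)))).compl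
  · change MeasurableSet {ω | ∀ l, e' (D.cache o l ω) = true → ¬ (0 < ‖D.pos o l ω‖ ∧
        ‖D.pos o l ω‖ ≤ S.powerRadius i o ‖D.pos i k ω‖)}
    rw [show {ω | ∀ l, e' (D.cache o l ω) = true → ¬ (0 < ‖D.pos o l ω‖ ∧
        ‖D.pos o l ω‖ ≤ S.powerRadius i o ‖D.pos i k ω‖)} = ⋂ l,
        ({ω | e' (D.cache o l ω) = true} ∩ ({ω | 0 < ‖D.pos o l ω‖} ∩
          {ω | ‖D.pos o l ω‖ ≤ S.powerRadius i o ‖D.pos i k ω‖}))ᶜ by ext; simp]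
    exact MeasurableSet.iInter fun l =>
      ((hc he' o l).inter ((h0 o l).inter (measurableSet_le (hn o l)
        ((S.measurable_powerRadius i o).comp (hn i k))))).compl

lemma measurable_arrayGain (S : HetNet) (i : Fin 2) : Measurable (S.arrayGain i) := by
  unfold arrayGain
  split_ifs
  · fun_prop
  · refine Measurable.ite (measurableSet_eq_fun (by fun_prop) measurable_const) ?_ ?_ <;> fun_prop

lemma IsMeasurable.interference (hD : D.IsMeasurable) (S : HetNet) (i : Fin 2) (k : ℕ) :
    Measurable (D.interference S i k) := by
  unfold Deployment.interference
  refine Measurable.tsum fun l => ?_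
  split_ifs
  · fun_prop
  · have h1 := (S.measurable_pathLoss i).comp (hD.pos i l).norm
    have h2 := (measurable_arrayGain S i).comp (hD.aod i l)
    exact ((h1.const_mul _).mul (((hD.gain i l).const_mul _).mul h2)).ennreal_ofReal

lemma IsMeasurable.neededGain (hD : D.IsMeasurable) (S : HetNet) (noise t : ℝ) (i : Fin 2)
    (k : ℕ) : Measurable (D.neededGain S noise t i k) := by
  have h1 := (S.measurable_pathLoss i).comp (hD.pos i k).norm
  exact (((hD.interference S i k).const_add _).const_mul _).div
    (((h1.const_mul _).mul_const _).mul_const _).ennreal_ofReal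

end Deployment

end HetNet

namespace HetNet

/-! ### The tail of the fading gain -/

/-- Tail of the normalized Gamma distribution, as a function on `[0, ∞]`. -/
def gammaTail (N : ℕ) (x : ℝ≥0∞) : ℝ≥0∞ := gammaMeasure N N {g | x < ENNReal.ofReal g}

lemma gammaTail_eq {N : ℕ} (hN : 0 < N) {x : ℝ≥0∞} (hx : x ≠ ⊤) :
    gammaTail N x = ENNReal.ofReal (1 - (gammaMeasure N N).real (Set.Iic x.toReal)) := by
  have hNr : (0 : ℝ) < N := by exact_mod_cast hN
  have := isProbabilityMeasure_gammaMeasure hNr hNr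
  have h : {g : ℝ | x < ENNReal.ofReal g} = (Set.Iic x.toReal)ᶜ := by
    ext g
    rw [Set.compl_Iic, Set.mem_Ioi]
    exact ENNReal.lt_ofReal_iff_toReal_lt hx
  rw [gammaTail, h, ← probReal_compl_eq_one_sub measurableSet_Iic, ofReal_measureReal]

lemma gammaTail_top (N : ℕ) : gammaTail N ⊤ = 0 := by simp [gammaTail]

lemma gammaTail_one (x : ℝ≥0∞) : gammaTail 1 x = expNeg x := by
  rcases eq_or_ne x ⊤ with rfl | hx
  · rw [gammaTail_top, expNeg_top]
  have h := cdf_expMeasure_eq one_pos x.toReal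
  have h1 : (0 : ℝ) < (1 : ℕ) := by simp
  have := isProbabilityMeasure_gammaMeasure h1 h1
  have h2 : expMeasure 1 = gammaMeasure (1 : ℕ) (1 : ℕ) := by simp [expMeasure]
  rw [h2, cdf_eq_real, if_pos ENNReal.toReal_nonneg, one_mul] at h
  rw [gammaTail_eq one_pos hx, h, expNeg_of_ne_top hx, sub_sub_cancel]

lemma measurable_gammaTail (N : ℕ) : Measurable (gammaTail N) := by
  have : Antitone (gammaTail N) := fun x y hxy => measure_mono fun g hg => lt_of_le_of_lt hxy hg
  exact this.measurable

/-- The Gamma law has a density, hence no atoms. -/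
lemma gammaMeasure_real_Iio {N : ℕ} (x : ℝ) :
    (gammaMeasure N N).real (Set.Iio x) = (gammaMeasure N N).real (Set.Iic x) := by
  have : gammaMeasure N N ≪ volume := withDensity_absolutelyContinuous _ _
  exact measureReal_congr (this.ae_le Iio_ae_eq_Iic)

lemma le_gammaError {N : ℕ} (hN : 0 < N) {x : ℝ} (hx : 0 ≤ x) :
    (gammaMeasure N N).real (Set.Iic x) - gammaApprox N x ≤ gammaError N := by
  have hNr : (0 : ℝ) < N := by exact_mod_cast hN
  have := isProbabilityMeasure_gammaMeasure hNr hNr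
  have hb : BddAbove (Set.range fun x : ℝ≥0 =>
      |(gammaMeasure N N).real (Set.Iio (x : ℝ)) - gammaApprox N x|) := by
    refine ⟨1, ?_⟩
    rintro _ ⟨y, rfl⟩
    have h1 := gammaApprox_nonneg hN y.coe_nonneg
    have h2 := gammaApprox_le_one hN y.coe_nonneg
    have h3 : (gammaMeasure N N).real (Set.Iio (y : ℝ)) ≤ 1 := measureReal_le_one
    have h4 : 0 ≤ (gammaMeasure N N).real (Set.Iio (y : ℝ)) := measureReal_nonneg
    exact abs_le.2 ⟨by linarith, by linarith⟩
  have h := le_ciSup hb ⟨x, hx⟩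
  rw [← gammaMeasure_real_Iio]
  exact (le_abs_self _).trans h

lemma gammaError_nonneg (N : ℕ) : 0 ≤ gammaError N := Real.iSup_nonneg fun _ => abs_nonneg _

variable {S : HetNet} {Ω : Type*}

namespace Deployment

/-- Realizations of the network. -/
abbrev Config : Type := Fin 2 → ℕ → Plane × (ℕ → Bool) × ℝ × ℝ

/-- The network as a function of its realization. -/
def canonical : Deployment Config where
  pos i k z := (z i k).1
  cache i k z := (z i k).2.1
  gain i k z := (z i k).2.2.1
  aod i k z := (z i k).2.2.2

/-- The realization of the network with the fading gain of one link erased. -/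
def masked (D : Deployment Ω) (i : Fin 2) (k : ℕ) (ω : Ω) : Config := fun j l =>
  (D.pos j l ω, D.cache j l ω, if j = i ∧ l = k then 0 else D.gain j l ω, D.aod j l ω)

/-- The interference omits the serving link, so the erased gain is never read. Thus the needed gain
is a function of the masked network alone. -/
lemma neededGain_masked (S : HetNet) (D : Deployment Ω) (noise t : ℝ) (i : Fin 2) (k : ℕ) (ω : Ω) :
    canonical.neededGain S noise t i k (D.masked i k ω) = D.neededGain S noise t i k ω := by
  have : canonical.interference S i k (D.masked i k ω) = D.interference S i k ω := by
    unfold interference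
    refine tsum_congr fun l => ?_
    split_ifs with h
    · rfl
    · simp [canonical, masked, h]
  unfold neededGain
  rw [this]
  rfl

variable [MeasurableSpace Ω] {μ : Measure Ω} {D : Deployment Ω}

/-! ### Independence of the fading gain of a link from the rest of the network -/

lemma Law.indep_tiers_of_ne (hD : D.Law S μ) {i o : Fin 2} (h : o ≠ i) :
    IndepFun (fun ω => ((fun k => D.pos i k ω), (fun k => D.mark i k ω)))
      (fun ω => ((fun k => D.pos o k ω), (fun k => D.mark o k ω))) μ := by
  fin_cases i <;> fin_cases o
  · exact (h rfl).elim
  · exact hD.indep_tiers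
  · exact hD.indep_tiers.symm
  · exact (h rfl).elim

/-- Erase the mark of BS `k`. -/
def eraseMark (k : ℕ) (m : ℕ → (ℕ → Bool) × ℝ × ℝ) (l : ℕ) : (ℕ → Bool) × ℝ × ℝ :=
  if l = k then (fun _ => false, 0, 0) else m l

lemma measurable_eraseMark (k : ℕ) : Measurable (eraseMark k) := by
  refine measurable_pi_iff.2 fun l => ?_
  unfold eraseMark
  split_ifs <;> fun_prop

/-- Disjoint groups of independent marks are independent, and the erased coordinate is constant. -/
lemma Law.indep_mark_eraseMark (hD : D.Law S μ) (i : Fin 2) (k : ℕ) :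
    IndepFun (D.mark i k) (fun ω => eraseMark k fun l => D.mark i l ω) μ := by
  have hm := hD.isMeasurable.mark i
  have h := indep_iSup_of_disjoint (fun l => (hm l).comap_le)
    ((iIndepFun_iff_iIndep _ _ _).1 (hD.indep_marks i)) (S := {k}) (T := {k}ᶜ) disjoint_compl_right
  refine (IndepFun_iff_Indep _ _ _).2 (indep_of_indep_of_le_left
    (indep_of_indep_of_le_right h ?_) ?_)
  · rw [MeasurableSpace.pi, MeasurableSpace.comap_iSup]
    refine iSup_le fun l => ?_
    rw [MeasurableSpace.comap_comp]
    by_cases hl : l = k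
    · have : (fun b : ℕ → (ℕ → Bool) × ℝ × ℝ => b l) ∘
          (fun ω => eraseMark k fun l => D.mark i l ω) = fun _ => (fun _ => false, 0, 0) := by
        ext1 ω; simp [eraseMark, hl]
      rw [this, MeasurableSpace.comap_const]
      exact bot_le
    · have : (fun b : ℕ → (ℕ → Bool) × ℝ × ℝ => b l) ∘
          (fun ω => eraseMark k fun l => D.mark i l ω) = D.mark i l := by
        ext1 ω; simp [eraseMark, hl]
      rw [this]
      exact le_iSup₂_of_le l hl le_rfl
  · exact le_iSup₂_of_le k rfl le_rfl

lemma canonical_isMeasurable : canonical.IsMeasurable := by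
  constructor <;> intro i k <;> simp only [canonical] <;> fun_prop

variable [IsProbabilityMeasure μ]

/-- The gain is shown independent of an increasing list: angle and cache of its BS, the other marks
of the tier, the positions of the tier, the other tier. Each extension is one use of
`indepFun_prodMk_assoc`. -/
lemma Law.indep_gain_masked (hD : D.Law S μ) (i : Fin 2) (k : ℕ) :
    IndepFun (D.gain i k) (D.masked i k) μ := by
  obtain ⟨o, ho⟩ : ∃ o : Fin 2, o ≠ i := exists_ne i
  have hm := hD.isMeasurable
  have mE := measurable_eraseMark k
  have mO : Measurable fun ω => eraseMark k fun l => D.mark i l ω :=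
    mE.comp (measurable_pi_iff.2 (hm.mark i))
  have mP : Measurable fun ω l => D.pos i l ω := measurable_pi_iff.2 (hm.pos i)
  have mT : Measurable fun ω => ((fun k => D.pos o k ω), (fun k => D.mark o k ω)) :=
    (measurable_pi_iff.2 (hm.pos o)).prodMk (measurable_pi_iff.2 (hm.mark o))
  have mB : Measurable fun ω => (D.aod i k ω, D.cache i k ω) := (hm.aod i k).prodMk (hm.cache i k)
  have h1 := indepFun_prodMk_assoc (hm.gain i k) (hm.aod i k) (hm.cache i k)
    (hD.indep_gain_aod i k) (hD.indep_cache i k).symm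
  let φ₁ : (ℕ → Bool) × ℝ × ℝ → ℝ × ℝ × (ℕ → Bool) := fun m => (m.2.1, (m.2.2, m.1))
  have hφ₁ : Measurable φ₁ := by fun_prop
  have h2 := indepFun_prodMk_assoc (hm.gain i k) mB mO h1
    ((hD.indep_mark_eraseMark i k).comp hφ₁ measurable_id)
  have mBO := mB.prodMk mO
  let φ₂ : (ℕ → (ℕ → Bool) × ℝ × ℝ) → ℝ × (ℝ × (ℕ → Bool)) × (ℕ → (ℕ → Bool) × ℝ × ℝ) :=
    fun m => ((m k).2.1, (((m k).2.2, (m k).1), eraseMark k m))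
  have hφ₂ : Measurable φ₂ := by fun_prop
  have h3 := indepFun_prodMk_assoc (hm.gain i k) mBO mP h2
    ((hD.indep_pos_marks i).symm.comp hφ₂ measurable_id)
  have mBOP := mBO.prodMk mP
  let φ₃ : (ℕ → Plane) × (ℕ → (ℕ → Bool) × ℝ × ℝ) →
      ℝ × (((ℝ × (ℕ → Bool)) × (ℕ → (ℕ → Bool) × ℝ × ℝ)) × (ℕ → Plane)) :=
    fun z => ((z.2 k).2.1, ((((z.2 k).2.2, (z.2 k).1), eraseMark k z.2), z.1))
  have hφ₃ : Measurable φ₃ := by fun_prop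
  have h4 := indepFun_prodMk_assoc (hm.gain i k) mBOP mT h3
    ((hD.indep_tiers_of_ne ho).comp hφ₃ measurable_id)
  -- Reassembles the masked network from the accumulated components.
  let ψ : ((((ℝ × (ℕ → Bool)) × (ℕ → (ℕ → Bool) × ℝ × ℝ)) × (ℕ → Plane)) ×
      ((ℕ → Plane) × (ℕ → (ℕ → Bool) × ℝ × ℝ))) → Config := fun z j l =>
    if j = i then (z.1.2 l, if l = k then (z.1.1.1.2, 0, z.1.1.1.1) else z.1.1.2 l)
      else (z.2.1 l, z.2.2 l)
  have hψ : Measurable ψ := by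
    refine measurable_pi_iff.2 fun j => measurable_pi_iff.2 fun l => ?_
    simp only [ψ]
    split_ifs <;> fun_prop
  have h5 := h4.comp measurable_id hψ
  have hfun : D.masked i k = ψ ∘ fun ω => ((((D.aod i k ω, D.cache i k ω),
      eraseMark k fun l => D.mark i l ω), fun l => D.pos i l ω),
      ((fun k => D.pos o k ω), (fun k => D.mark o k ω))) := ?_
  · rw [hfun]
    exact h5
  funext ω j l
  by_cases hj : j = i
  · subst hj
    by_cases hl : l = k
    · subst hl; simp [masked, ψ]
    · simp [masked, ψ, hl, eraseMark, mark]
  · have : j = o := by omega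
    subst this
    simp [masked, ψ, hj, mark]

/-- Selection and needed gain depend on the masked network only; the independent gain is integrated
against its Gamma law, which leaves the tail. -/
lemma Law.measure_selected_gain (hD : D.Law S μ) (i o : Fin 2) {e e' : (ℕ → Bool) → Bool}
    (he : Measurable e) (he' : Measurable e') (noise t : ℝ) (k : ℕ) :
    μ {ω | D.Selected S i o e e' k ω ∧
        D.neededGain S noise t i k ω < ENNReal.ofReal (D.gain i k ω)} =
      ∫⁻ ω, {ω | D.Selected S i o e e' k ω}.indicator
        (fun ω => gammaTail (S.nakOf i) (D.neededGain S noise t i k ω)) ω ∂μ := by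
  have hm := hD.isMeasurable
  have hind := (hD.indep_gain_masked i k).symm
  have mM : Measurable (D.masked i k) := by
    refine measurable_pi_iff.2 fun j => measurable_pi_iff.2 fun l => ?_
    refine (hm.pos j l).prodMk ((hm.cache j l).prodMk (Measurable.prodMk ?_ (hm.aod j l)))
    split_ifs
    · exact measurable_const
    · exact hm.gain j l
  have hsel := canonical_isMeasurable.selected S i o he he' k
  have hneed := canonical_isMeasurable.neededGain S noise t i k
  have hset : MeasurableSet {z : Config × ℝ | canonical.Selected S i o e e' k z.1 ∧
      canonical.neededGain S noise t i k z.1 < ENNReal.ofReal z.2} :=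
    (measurable_fst hsel).inter (measurableSet_lt (hneed.comp measurable_fst)
      measurable_snd.ennreal_ofReal)
  have key := lintegral_indepFun mM (hm.gain i k) hind
    (F := fun z g => {z : Config × ℝ | canonical.Selected S i o e e' k z.1 ∧
      canonical.neededGain S noise t i k z.1 < ENNReal.ofReal z.2}.indicator 1 (z, g))
    (measurable_one.indicator hset)
  have hmeas : MeasurableSet {ω | D.Selected S i o e e' k ω ∧
        D.neededGain S noise t i k ω < ENNReal.ofReal (D.gain i k ω)} :=
    (hm.selected S i o he he' k).inter (measurableSet_lt (hm.neededGain S noise t i k)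
      (hm.gain i k).ennreal_ofReal)
  have hrw : ∀ ω g, {z : Config × ℝ | canonical.Selected S i o e e' k z.1 ∧
      canonical.neededGain S noise t i k z.1 < ENNReal.ofReal z.2}.indicator
      (1 : Config × ℝ → ℝ≥0∞) (D.masked i k ω, g) =
      {g : ℝ | D.Selected S i o e e' k ω ∧
        D.neededGain S noise t i k ω < ENNReal.ofReal g}.indicator 1 g := by
    intro ω g
    have hiff : (D.masked i k ω, g) ∈ {z : Config × ℝ | canonical.Selected S i o e e' k z.1 ∧
        canonical.neededGain S noise t i k z.1 < ENNReal.ofReal z.2} ↔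
        g ∈ {g : ℝ | D.Selected S i o e e' k ω ∧
          D.neededGain S noise t i k ω < ENNReal.ofReal g} := by
      change (D.Selected S i o e e' k ω ∧
        canonical.neededGain S noise t i k (D.masked i k ω) < ENNReal.ofReal g) ↔ _
      rw [neededGain_masked]
      rfl
    by_cases h : g ∈ {g : ℝ | D.Selected S i o e e' k ω ∧
          D.neededGain S noise t i k ω < ENNReal.ofReal g}
    · rw [Set.indicator_of_mem h, Set.indicator_of_mem (hiff.2 h)]; rfl
    · rw [Set.indicator_of_notMem h, Set.indicator_of_notMem (mt hiff.1 h)]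
  simp only [hrw] at key
  rw [← lintegral_indicator_one hmeas]
  refine Eq.trans ?_ (key.trans (lintegral_congr fun ω => ?_))
  · rfl
  · have hs : MeasurableSet {g : ℝ | D.Selected S i o e e' k ω ∧
          D.neededGain S noise t i k ω < ENNReal.ofReal g} :=
      (MeasurableSet.const _).inter (measurableSet_lt measurable_const
        ENNReal.measurable_ofReal)
    rw [← lintegral_map (μ := μ) (measurable_one.indicator hs) (hm.gain i k), hD.gain_law,
      lintegral_indicator_one hs]
    by_cases h : D.Selected S i o e e' k ω
    · simp [h, gammaTail]
    · simp [h]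

/-- At most one BS is selected, so the event is a disjoint union over the serving BS. -/
theorem Law.measure_exists_lt_rate (hS : S.Valid) (hD : D.Law S μ) {R : ℝ} (hR : 0 < R)
    (i o : Fin 2) {e e' : (ℕ → Bool) → Bool} (he : Measurable e) (he' : Measurable e')
    (noise : Fin 2 → ℝ) :
    μ {ω | ∃ k, D.Selected S i o e e' k ω ∧ (R : EReal) < D.rate S noise i k ω} =
      ∫⁻ ω, ∑' k, {ω | D.Selected S i o e e' k ω}.indicator (fun ω => gammaTail (S.nakOf i)
        (D.neededGain S (noise i) (S.threshold i R) i k ω)) ω ∂μ := by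
  have hm := hD.isMeasurable
  have hset : {ω | ∃ k, D.Selected S i o e e' k ω ∧ (R : EReal) < D.rate S noise i k ω} =
      ⋃ k, {ω | D.Selected S i o e e' k ω ∧
        D.neededGain S (noise i) (S.threshold i R) i k ω < ENNReal.ofReal (D.gain i k ω)} := by
    ext ω
    simp only [Set.mem_ofPred_eq, Set.mem_iUnion]
    refine exists_congr fun k => and_congr_right fun hk => ?_
    rw [lt_rate_iff_lt_sinr hS hR, lt_sinr_iff hS (threshold_pos hS i hR) noise hk.2.1]
  have hmeas : ∀ k, MeasurableSet {ω | D.Selected S i o e e' k ω ∧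
      D.neededGain S (noise i) (S.threshold i R) i k ω < ENNReal.ofReal (D.gain i k ω)} := fun k =>
    (hm.selected S i o he he' k).inter (measurableSet_lt (hm.neededGain S _ _ i k)
      (hm.gain i k).ennreal_ofReal)
  have hm' : ∀ k, AEMeasurable ({ω | D.Selected S i o e e' k ω}.indicator fun ω =>
      gammaTail (S.nakOf i) (D.neededGain S (noise i) (S.threshold i R) i k ω)) μ := fun k =>
    (((measurable_gammaTail _).comp (hm.neededGain S _ _ i k)).indicator
      (hm.selected S i o he he' k)).aemeasurable
  rw [hset, measure_iUnion ?_ hmeas, lintegral_tsum hm']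
  · exact tsum_congr fun k => hD.measure_selected_gain i o he he' _ _ k
  · intro k l hkl
    exact Set.disjoint_left.2 fun ω hk hl => hkl (hk.1.unique hl.1)

/-- The mean number of points at the origin is zero. -/
lemma Law.ae_pos_ne_zero (hS : S.Valid) (hD : D.Law S μ) (i : Fin 2) :
    ∀ᵐ ω ∂μ, ∀ k, D.pos i k ω ≠ 0 := by
  have h := (hD.poisson i).lintegral_count (hS.lam_pos i).le (measurableSet_singleton (0 : Plane))
    (by simp)
  simp_rw [pointCount_toENNReal] at h
  have hm : Measurable fun ω => ∑' k, ({0} : Set Plane).indicator (fun _ => (1 : ℝ≥0∞))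
      (D.pos i k ω) := Measurable.tsum fun k =>
    (measurable_const.indicator (measurableSet_singleton 0)).comp ((hD.poisson i).measurable k)
  rw [measure_singleton, mul_zero, lintegral_eq_zero_iff hm] at h
  filter_upwards [h] with ω hω k hk
  have := ENNReal.tsum_eq_zero.1 hω k
  simp [hk] at this

/-- Almost surely only finitely many BSs lie in the line-of-sight disc, and the others contribute
nothing. -/
lemma Law.ae_interference_ne_top (hS : S.Valid) (hD : D.Law S μ) :
    ∀ᵐ ω ∂μ, ∀ k, D.interference S 1 k ω ≠ ⊤ := by
  have h := ((hD.poisson 1).lintegral_count_eq_tsum (hS.lam_pos 1).le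
    (Metric.isClosed_closedBall (x := (0 : Plane)) (ε := S.RL)).measurableSet
    measure_closedBall_lt_top.ne 0).1
  filter_upwards [h] with ω hω k
  have hfin : {l | D.pos 1 l ω ∈ Metric.closedBall (0 : Plane) S.RL}.Finite :=
    Set.encard_ne_top_iff.1 hω
  unfold interference
  rw [tsum_eq_sum (s := hfin.toFinset)]
  · refine (ENNReal.sum_lt_top.2 fun l _ => ?_).ne
    split_ifs
    · exact ENNReal.zero_lt_top
    · exact ENNReal.ofReal_lt_top
  · intro l hl
    have hl : ¬ ‖D.pos 1 l ω‖ ≤ S.RL := by simpa using hl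
    have hr : ¬ S.InRange 1 ‖D.pos 1 l ω‖ := fun h => hl (h.2.resolve_left (by simp))
    simp [pathLoss_of_not_inRange hS (norm_nonneg _) hr]

end Deployment

end HetNet

/-! ### Laplace functional of the interference together with the association -/

/-- An exponential factor changes the rate of the Gamma density from `N` to `N + c`; the quotient of
the normalizing constants is the value. -/
lemma lintegral_expNeg_gammaMeasure {N : ℕ} (hN : 0 < N) {c : ℝ} (hc : 0 ≤ c) :
    ∫⁻ g, expNeg (ENNReal.ofReal (c * g)) ∂(gammaMeasure N N) =
      ENNReal.ofReal ((1 + c / N) ^ (-(N : ℝ))) := by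
  have hNr : (0 : ℝ) < N := by exact_mod_cast hN
  have hr : 0 < N + c := by positivity
  have hm : Measurable fun g => expNeg (ENNReal.ofReal (c * g)) :=
    measurable_expNeg.comp (by fun_prop)
  have hp : ∀ r : ℝ, Measurable (gammaPDF N r) := fun r =>
    (measurable_gammaPDFReal _ _).ennreal_ofReal
  rw [gammaMeasure, lintegral_withDensity_eq_lintegral_mul _ (hp N) hm]
  have h1 : ∀ g : ℝ, (gammaPDF N N * fun g => expNeg (ENNReal.ofReal (c * g))) g =
      ENNReal.ofReal ((1 + c / N) ^ (-(N : ℝ))) * gammaPDF N (N + c) g := by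
    intro g
    rw [Pi.mul_apply]
    rcases lt_or_ge g 0 with hg | hg
    · rw [gammaPDF_of_neg hg, gammaPDF_of_neg hg]; simp
    · rw [gammaPDF_of_nonneg hg, gammaPDF_of_nonneg hg, expNeg_ofReal (by positivity),
        ← ENNReal.ofReal_mul (by positivity), ← ENNReal.ofReal_mul (by positivity)]
      congr 1
      have h2 : (1 + c / N) ^ (-(N : ℝ)) * (N + c) ^ (N : ℝ) = (N : ℝ) ^ (N : ℝ) := by
        rw [show (N : ℝ) + c = N * (1 + c / N) by field_simp, Real.mul_rpow hNr.le (by positivity),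
          Real.rpow_neg (by positivity)]
        have : (1 + c / N) ^ (N : ℝ) ≠ 0 := by positivity
        field_simp
      have h3 : Real.exp (-(N * g)) * Real.exp (-(c * g)) = Real.exp (-((N + c) * g)) := by
        rw [← Real.exp_add]; congr 1; ring
      rw [← h2, ← h3]; ring
  rw [lintegral_congr h1, lintegral_const_mul _ (hp _),
    lintegral_gammaPDF_eq_one hNr hr, mul_one]

namespace HetNet

variable {S : HetNet}

/-- The law of the angle offset of a BS. -/
def angleLaw (S : HetNet) : Measure ℝ :=
  cond volume (Set.Icc (-(S.spacing / S.wavelength)) (S.spacing / S.wavelength))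

lemma isProbabilityMeasure_angleLaw (hS : S.Valid) : IsProbabilityMeasure S.angleLaw := by
  have h : 0 < S.spacing / S.wavelength := div_pos hS.spacing_pos hS.wavelength_pos
  refine cond_isProbabilityMeasure_of_finite ?_ ?_
  · rw [Real.volume_Icc]; simp [h]
  · rw [Real.volume_Icc]; exact ENNReal.ofReal_ne_top

/-- Laplace transform at `c` of the product of fading gain and array gain of an interferer. -/
def markLaplace (S : HetNet) (i : Fin 2) (c : ℝ) : ℝ≥0∞ :=
  ∫⁻ w, ENNReal.ofReal ((1 + c * S.arrayGain i w / S.nakOf i) ^ (-(S.nakOf i : ℝ))) ∂S.angleLaw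

/-- Indicator that a BS at `y` whose cache satisfies `e` (or not, according to `b`) does not block
a server at range `r`. -/
def openIndicator (b : Bool) (y : Plane) (r : ℝ) : ℝ≥0∞ :=
  if b = true ∧ 0 < ‖y‖ ∧ ‖y‖ ≤ r then 0 else 1

lemma openIndicator_le_one (b : Bool) (y : Plane) (r : ℝ) : openIndicator b y r ≤ 1 := by
  unfold openIndicator; split_ifs <;> simp

lemma openIndicator_antitone (b : Bool) (y : Plane) : Antitone (openIndicator b y) := by
  intro r s hrs
  unfold openIndicator
  by_cases h : b = true ∧ 0 < ‖y‖ ∧ ‖y‖ ≤ r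
  · rw [if_pos h, if_pos ⟨h.1, h.2.1, h.2.2.trans hrs⟩]
  · rw [if_neg h]; split_ifs <;> simp

lemma measurable_openIndicator {α : Type*} [MeasurableSpace α] {b : α → Bool} (hb : Measurable b)
    {y : α → Plane} (hy : Measurable y) {r : α → ℝ} (hr : Measurable r) :
    Measurable fun z => openIndicator (b z) (y z) (r z) := by
  refine Measurable.ite ?_ measurable_const measurable_const
  exact (measurableSet_eq_fun hb measurable_const).inter
    ((measurableSet_lt measurable_const hy.norm).inter (measurableSet_le hy.norm hr))

/-- Attenuation, relative to the serving link of length `r`, of an interfering link of length `y`. -/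
def relLoss (S : HetNet) (i : Fin 2) (s r y : ℝ) : ℝ :=
  s * r ^ S.alpha i * (S.pathLoss i y / S.inter i)

/-- Factor of the Laplace functional due to a fading gain `g` and an angle offset `w`. -/
def fadingFactor (S : HetNet) (i : Fin 2) (c g w : ℝ) : ℝ≥0∞ :=
  expNeg (ENNReal.ofReal c * ENNReal.ofReal (g * S.arrayGain i w))

lemma measurable_fadingFactor (S : HetNet) (i : Fin 2) :
    Measurable fun z : ℝ × ℝ × ℝ => S.fadingFactor i z.1 z.2.1 z.2.2 := by
  have hG : Measurable fun z : ℝ × ℝ × ℝ => S.arrayGain i z.2.2 :=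
    (Deployment.measurable_arrayGain S i).comp (by fun_prop)
  have h1 : Measurable fun z : ℝ × ℝ × ℝ => ENNReal.ofReal z.1 := by fun_prop
  have h2 : Measurable fun z : ℝ × ℝ × ℝ => z.2.1 * S.arrayGain i z.2.2 :=
    Measurable.mul (by fun_prop) hG
  exact measurable_expNeg.comp (h1.mul h2.ennreal_ofReal)

/-- Contribution of an interferer at `y` with given marks to the Laplace functional. -/
def ownWeight (S : HetNet) (i : Fin 2) (e : (ℕ → Bool) → Bool) (s r : ℝ) (y : Plane)
    (m : (ℕ → Bool) × ℝ × ℝ) : ℝ≥0∞ :=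
  openIndicator (e m.1) y r * S.fadingFactor i (S.relLoss i s r ‖y‖) m.2.1 m.2.2

lemma measurable_relLoss (S : HetNet) (i : Fin 2) (s : ℝ) :
    Measurable fun z : ℝ × ℝ => S.relLoss i s z.1 z.2 := by
  have h1 : Measurable fun z : ℝ × ℝ => S.pathLoss i z.2 :=
    (S.measurable_pathLoss i).comp measurable_snd
  have h2 : Measurable fun z : ℝ × ℝ => s * z.1 ^ S.alpha i := by fun_prop
  exact h2.mul (h1.div_const _)

lemma measurable_ownWeight (S : HetNet) (i : Fin 2) {e : (ℕ → Bool) → Bool} (he : Measurable e)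
    (s : ℝ) : Measurable fun z : ℝ × Plane × (ℕ → Bool) × ℝ × ℝ =>
      S.ownWeight i e s z.1 z.2.1 z.2.2 := by
  have h1 : Measurable fun z : ℝ × Plane × (ℕ → Bool) × ℝ × ℝ => S.relLoss i s z.1 ‖z.2.1‖ :=
    (S.measurable_relLoss i s).comp (f := fun z : ℝ × Plane × (ℕ → Bool) × ℝ × ℝ =>
      (z.1, ‖z.2.1‖)) (by fun_prop)
  exact (measurable_openIndicator (he.comp (by fun_prop)) (by fun_prop) (by fun_prop)).mul
    ((S.measurable_fadingFactor i).comp_three h1 (by fun_prop) (by fun_prop))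

lemma relLoss_nonneg (hS : S.Valid) (i : Fin 2) {s r y : ℝ} (hs : 0 ≤ s) (hr : 0 ≤ r)
    (hy : 0 ≤ y) : 0 ≤ S.relLoss i s r y :=
  mul_nonneg (mul_nonneg hs (Real.rpow_nonneg hr _))
    (div_nonneg (pathLoss_nonneg hS i hy) (hS.inter_pos i).le)

lemma relLoss_mono (hS : S.Valid) (i : Fin 2) {s y : ℝ} (hs : 0 ≤ s) (hy : 0 ≤ y) :
    MonotoneOn (fun r => S.relLoss i s r y) (Set.Ici 0) := by
  intro r (hr : 0 ≤ r) r' _ hrr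
  have h1 := div_nonneg (pathLoss_nonneg hS i hy) (hS.inter_pos i).le
  have h2 := (hS.alpha_pos i).le
  simp only [relLoss]
  gcongr

lemma ownWeight_le_one (S : HetNet) (i : Fin 2) (e : (ℕ → Bool) → Bool) (s r : ℝ) (y : Plane)
    (m : (ℕ → Bool) × ℝ × ℝ) : S.ownWeight i e s r y m ≤ 1 :=
  mul_le_one' (openIndicator_le_one _ _ _) (expNeg_le_one _)

lemma ownWeight_antitone (hS : S.Valid) (i : Fin 2) (e : (ℕ → Bool) → Bool) {s : ℝ} (hs : 0 ≤ s)
    (y : Plane) (m : (ℕ → Bool) × ℝ × ℝ) :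
    AntitoneOn (fun r => S.ownWeight i e s r y m) (Set.Ici 0) := by
  intro r hr r' hr' hrr
  refine mul_le_mul' (openIndicator_antitone _ _ hrr) (expNeg_antitone ?_)
  refine mul_le_mul_left (ENNReal.ofReal_le_ofReal ?_) _
  exact relLoss_mono hS i hs (norm_nonneg y) hr hr' hrr

/-- Probability that a BS at distance `y` does not block a server at range `r`, when its cache
matters with probability `p`. -/
def openProb (p : ℝ≥0∞) (y r : ℝ) : ℝ≥0∞ := if 0 < y ∧ y ≤ r then 1 - p else 1

/-- Mean contribution of an interferer at distance `y`. -/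
def meanWeight (S : HetNet) (i : Fin 2) (p : ℝ≥0∞) (s r y : ℝ) : ℝ≥0∞ :=
  openProb p y r * S.markLaplace i (S.relLoss i s r y)

variable {Ω : Type*}

namespace Deployment

variable {D : Deployment Ω}

/-- The indicator that a range admits a link of positive average power. -/
def rangeIndicator (S : HetNet) (i : Fin 2) (r : ℝ) : ℝ≥0∞ :=
  if i = 0 ∨ r ≤ S.RL then 1 else 0

lemma measurable_rangeIndicator (S : HetNet) (i : Fin 2) : Measurable (rangeIndicator S i) :=
  Measurable.ite ((MeasurableSet.const _).union measurableSet_Iic) measurable_const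
    measurable_const

lemma rangeIndicator_antitone (S : HetNet) (i : Fin 2) : Antitone (rangeIndicator S i) := by
  intro r r' hrr
  unfold rangeIndicator
  by_cases h : i = 0 ∨ r' ≤ S.RL
  · rw [if_pos h, if_pos (h.imp_right hrr.trans)]
  · rw [if_neg h]; exact zero_le

/-- Transmit powers, antenna numbers and intercepts cancel between serving and interfering links of
one tier. -/
lemma neededGain_eq_tsum (hS : S.Valid) {s : ℝ} (hs : 0 ≤ s) {i : Fin 2} {k : ℕ} {ω : Ω}
    (hr : S.InRange i ‖D.pos i k ω‖) :
    D.neededGain S 0 s i k ω = ∑' l, if l = k then 0 else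
      ENNReal.ofReal (S.relLoss i s ‖D.pos i k ω‖ ‖D.pos i l ω‖) *
        ENNReal.ofReal (D.gain i l ω * S.arrayGain i (D.aod i l ω)) := by
  have h2 := hS.pow_pos i
  have h3 := hS.inter_pos i
  have h4 : (0 : ℝ) < S.ant i := by exact_mod_cast hS.ant_pos i
  have hrpow : 0 < ‖D.pos i k ω‖ ^ S.alpha i := Real.rpow_pos_of_pos hr.1 _
  unfold neededGain interference
  rw [ENNReal.ofReal_zero, zero_add, div_eq_mul_inv, mul_right_comm, ← ENNReal.tsum_mul_left]
  refine tsum_congr fun l => ?_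
  split_ifs with h
  · rw [mul_zero]
  · have hq : 0 < S.pow i * S.pathLoss i ‖D.pos i k ω‖ * G0 * S.ant i := by
      have := pathLoss_pos hS hr
      unfold G0; positivity
    have hrel := relLoss_nonneg hS i hs (norm_nonneg (D.pos i k ω)) (norm_nonneg (D.pos i l ω))
    rw [← ENNReal.ofReal_inv_of_pos hq, ← ENNReal.ofReal_mul hs, ← ENNReal.ofReal_mul
      (mul_nonneg hs (inv_nonneg.2 hq.le)), ← ENNReal.ofReal_mul hrel]
    congr 1
    rw [pathLoss_of_inRange hr, relLoss, Real.rpow_neg hr.1.le, G0]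
    field_simp

/-- Each other BS contributes one factor: an indicator that it does not block, times an exponential
if it belongs to the own tier. A BS at the origin must be excluded, since it is out of range while
`rangeIndicator` may be one. -/
lemma selected_indicator_eq (hS : S.Valid) (D : Deployment Ω) (i o : Fin 2)
    (e e' : (ℕ → Bool) → Bool) {s : ℝ} (hs : 0 ≤ s) {k : ℕ} {ω : Ω} (h0 : D.pos i k ω ≠ 0) :
    {ω | D.Selected S i o e e' k ω}.indicator (fun ω => expNeg (D.neededGain S 0 s i k ω)) ω =
      rangeIndicator S i ‖D.pos i k ω‖ * ((if e (D.mark i k ω).1 = true then 1 else 0) *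
        iprod (fun l => if l = k then 1 else
          S.ownWeight i e s ‖D.pos i k ω‖ (D.pos i l ω) (D.mark i l ω)) *
        iprod (fun l => openIndicator (e' (D.mark o l ω).1) (D.pos o l ω)
          (S.powerRadius i o ‖D.pos i k ω‖))) := by
  classical
  have hpos : 0 < ‖D.pos i k ω‖ := norm_pos_iff.2 h0
  by_cases hr : S.InRange i ‖D.pos i k ω‖
  swap
  · have h1 : ¬ (i = 0 ∨ ‖D.pos i k ω‖ ≤ S.RL) := fun h => hr ⟨hpos, h⟩
    rw [Set.indicator_of_notMem fun h => hr h.2.1, rangeIndicator, if_neg h1, zero_mul]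
  rw [rangeIndicator, if_pos hr.2, one_mul]
  have hown : iprod (fun l => if l = k then 1 else
      S.ownWeight i e s ‖D.pos i k ω‖ (D.pos i l ω) (D.mark i l ω)) =
      (if ∀ l, l ≠ k → e (D.cache i l ω) = true →
        ¬ (0 < ‖D.pos i l ω‖ ∧ ‖D.pos i l ω‖ ≤ ‖D.pos i k ω‖) then 1 else 0) *
      expNeg (D.neededGain S 0 s i k ω) := by
    rw [neededGain_eq_tsum hS hs hr, expNeg_tsum, ← iprod_indicator, ← iprod_mul]
    · congr 1
      ext1 l
      by_cases hl : l = k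
      · simp [hl, expNeg_zero]
      · rw [if_neg hl, if_neg hl, ownWeight]
        by_cases hb : e (D.cache i l ω) = true ∧ 0 < ‖D.pos i l ω‖ ∧ ‖D.pos i l ω‖ ≤ ‖D.pos i k ω‖
        · have h1 : openIndicator (e (D.mark i l ω).1) (D.pos i l ω) ‖D.pos i k ω‖ = 0 := if_pos hb
          rw [h1, if_neg fun h => h hl hb.1 hb.2, zero_mul, zero_mul]
        · have h1 : openIndicator (e (D.mark i l ω).1) (D.pos i l ω) ‖D.pos i k ω‖ = 1 := if_neg hb
          rw [h1, if_pos fun _ h1 h2 => hb ⟨h1, h2⟩]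
          rfl
    · intro l; split_ifs <;> simp
    · intro l; exact expNeg_le_one _
  have hcross : iprod (fun l => openIndicator (e' (D.mark o l ω).1) (D.pos o l ω)
      (S.powerRadius i o ‖D.pos i k ω‖)) =
      if ∀ l, e' (D.cache o l ω) = true →
      ¬ (0 < ‖D.pos o l ω‖ ∧ ‖D.pos o l ω‖ ≤ S.powerRadius i o ‖D.pos i k ω‖) then 1 else 0 := by
    rw [← iprod_indicator]
    congr 1
    ext1 l
    by_cases hb : e' (D.cache o l ω) = true ∧ 0 < ‖D.pos o l ω‖ ∧
        ‖D.pos o l ω‖ ≤ S.powerRadius i o ‖D.pos i k ω‖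
    · rw [if_neg fun h => h hb.1 hb.2]
      exact if_pos hb
    · rw [if_pos fun h1 h2 => hb ⟨h1, h2⟩]
      exact if_neg hb
  rw [hown, hcross]
  by_cases hsel : D.Selected S i o e e' k ω
  · rw [Set.indicator_of_mem (s := {ω | D.Selected S i o e e' k ω}) hsel, if_pos hsel.2.2.1, if_pos hsel.2.2.2]
    have : e (D.mark i k ω).1 = true := hsel.1
    simp [this]
  · rw [Set.indicator_of_notMem (s := {ω | D.Selected S i o e e' k ω}) hsel]
    by_cases h1 : e (D.mark i k ω).1 = true
    · by_cases h2 : ∀ l, l ≠ k → e (D.cache i l ω) = true →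
        ¬ (0 < ‖D.pos i l ω‖ ∧ ‖D.pos i l ω‖ ≤ ‖D.pos i k ω‖)
      · rw [if_neg (c := ∀ l, e' (D.cache o l ω) = true → _) fun h3 => hsel ⟨h1, hr, h2, h3⟩,
          mul_zero]
      · rw [if_neg h2]; simp
    · rw [if_neg h1]; simp

end Deployment

variable [MeasurableSpace Ω] {μ : Measure Ω} [IsProbabilityMeasure μ]
  {D : Deployment Ω}

lemma measurable_openProb (p : ℝ≥0∞) {α : Type*} [MeasurableSpace α] {y r : α → ℝ}
    (hy : Measurable y) (hr : Measurable r) : Measurable fun z => openProb p (y z) (r z) :=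
  Measurable.ite ((measurableSet_lt measurable_const hy).inter (measurableSet_le hy hr))
    measurable_const measurable_const

lemma measurable_meanWeight (hS : S.Valid) (i : Fin 2) (p : ℝ≥0∞) (s : ℝ) :
    Measurable fun z : ℝ × ℝ => S.meanWeight i p s z.1 z.2 := by
  have := isProbabilityMeasure_angleLaw hS
  have hG : Measurable fun z : ℝ × ℝ => S.arrayGain i z.2 :=
    (Deployment.measurable_arrayGain S i).comp measurable_snd
  have h1 : Measurable fun z : ℝ × ℝ => ENNReal.ofReal
      ((1 + z.1 * S.arrayGain i z.2 / S.nakOf i) ^ (-(S.nakOf i : ℝ))) := by fun_prop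
  have h2 : Measurable (S.markLaplace i) := h1.lintegral_prod_right'
  exact (measurable_openProb p measurable_snd measurable_fst).mul
    (h2.comp (S.measurable_relLoss i s))

lemma lintegral_openIndicator {c : Ω → ℕ → Bool} (hc : Measurable c) {e : (ℕ → Bool) → Bool}
    (he : Measurable e) {p : ℝ≥0∞} (hp : μ {ω | e (c ω) = true} = p) (y : Plane) (r : ℝ) :
    ∫⁻ ω, openIndicator (e (c ω)) y r ∂μ = openProb p ‖y‖ r := by
  unfold openProb
  split_ifs with h
  · have hm : MeasurableSet {ω | e (c ω) = true} :=
      measurableSet_eq_fun (he.comp hc) measurable_const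
    have h1 : ∀ ω, openIndicator (e (c ω)) y r = {ω | e (c ω) = true}ᶜ.indicator 1 ω := by
      intro ω
      by_cases hb : e (c ω) = true <;> simp [openIndicator, h, hb]
    rw [lintegral_congr h1, lintegral_indicator_one hm.compl, prob_compl_eq_one_sub hm, hp]
  · have h1 : ∀ ω, openIndicator (e (c ω)) y r = 1 := fun ω => if_neg fun h' => h h'.2
    rw [lintegral_congr h1]; simp

namespace Deployment

lemma lintegral_fadingFactor (hS : S.Valid) (i : Fin 2) {c : ℝ} (hc : 0 ≤ c) (w : ℝ) :
    ∫⁻ g, S.fadingFactor i c g w ∂(gammaMeasure (S.nakOf i) (S.nakOf i)) =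
      ENNReal.ofReal ((1 + c * S.arrayGain i w / S.nakOf i) ^ (-(S.nakOf i : ℝ))) := by
  rw [← lintegral_expNeg_gammaMeasure (hS.nakOf_pos i) (mul_nonneg hc (arrayGain_nonneg S i w))]
  refine lintegral_congr fun g => ?_
  rw [fadingFactor, ← ENNReal.ofReal_mul hc]
  ring_nf

lemma Law.lintegral_fadingFactor_gain (hS : S.Valid) (hD : D.Law S μ) (i : Fin 2) (l : ℕ) {c : ℝ}
    (hc : 0 ≤ c) :
    ∫⁻ ω, S.fadingFactor i c (D.gain i l ω) (D.aod i l ω) ∂μ = S.markLaplace i c := by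
  have hm := hD.isMeasurable
  have hF : Measurable (Function.uncurry fun w g => S.fadingFactor i c g w) :=
    (S.measurable_fadingFactor i).comp_three measurable_const measurable_snd measurable_fst
  have h2 := lintegral_indepFun (hm.aod i l) (hm.gain i l) (hD.indep_gain_aod i l).symm hF
  have hG := measurable_arrayGain S i
  rw [h2, markLaplace, angleLaw, ← hD.aod_law i l, lintegral_map (by fun_prop) (hm.aod i l)]
  refine lintegral_congr fun ω => ?_
  have hFw : Measurable fun g => S.fadingFactor i c g (D.aod i l ω) :=
    (S.measurable_fadingFactor i).comp_three measurable_const measurable_id measurable_const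
  rw [← lintegral_fadingFactor hS i hc, ← hD.gain_law i l, lintegral_map hFw (hm.gain i l)]

lemma Law.lintegral_ownWeight (hS : S.Valid) (hD : D.Law S μ) (i : Fin 2)
    {e : (ℕ → Bool) → Bool} (he : Measurable e) {p : ℝ≥0∞}
    (hp : ∀ k, μ {ω | e (D.cache i k ω) = true} = p) {s : ℝ} (hs : 0 ≤ s) (l : ℕ) {r : ℝ}
    (hr : 0 ≤ r) (y : Plane) :
    ∫⁻ m, S.ownWeight i e s r y m ∂(μ.map (D.mark i l)) = S.meanWeight i p s r ‖y‖ := by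
  have hm := hD.isMeasurable
  have hmk : Measurable fun m : (ℕ → Bool) × ℝ × ℝ => (r, y, m) := by fun_prop
  have hw : Measurable (S.ownWeight i e s r y) := (S.measurable_ownWeight i he s).comp hmk
  have hc := relLoss_nonneg hS i hs hr (norm_nonneg y)
  rw [lintegral_map hw (hm.mark i l), meanWeight,
    ← hD.lintegral_fadingFactor_gain hS i l hc, ← lintegral_openIndicator (hm.cache i l) he (hp l)]
  have hO : Measurable fun b : ℕ → Bool => openIndicator (e b) y r :=
    measurable_openIndicator he measurable_const measurable_const
  have hE : Measurable fun z : ℝ × ℝ => S.fadingFactor i (S.relLoss i s r ‖y‖) z.1 z.2 :=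
    (S.measurable_fadingFactor i).comp_three measurable_const measurable_fst measurable_snd
  have hF : Measurable (Function.uncurry fun b (z : ℝ × ℝ) => openIndicator (e b) y r *
      S.fadingFactor i (S.relLoss i s r ‖y‖) z.1 z.2) :=
    (hO.comp measurable_fst).mul (hE.comp measurable_snd)
  have h1 := lintegral_indepFun (hm.cache i l) ((hm.gain i l).prodMk (hm.aod i l))
    (hD.indep_cache i l) hF
  have hEm : Measurable fun ω => S.fadingFactor i (S.relLoss i s r ‖y‖) (D.gain i l ω)
      (D.aod i l ω) :=
    (S.measurable_fadingFactor i).comp_three measurable_const (hm.gain i l) (hm.aod i l)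
  refine h1.trans ?_
  simp only [lintegral_const_mul _ hEm]
  exact lintegral_mul_const _ (hO.comp (hm.cache i l))

/-- The factorization `selected_indicator_eq` is fed into `lintegral_tsum_marked`, and polar
coordinates reduce all plane integrals to radial ones. The required monotonicity in the serving
distance holds because a farther server is blocked more easily and suffers more relative
interference. -/
theorem Law.lintegral_selected (hS : S.Valid) (hD : D.Law S μ) {i o : Fin 2} (hio : o ≠ i)
    {e e' : (ℕ → Bool) → Bool} (he : Measurable e) (he' : Measurable e') {p p' : ℝ≥0∞}
    (hp : ∀ k, μ {ω | e (D.cache i k ω) = true} = p)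
    (hp' : ∀ k, μ {ω | e' (D.cache o k ω) = true} = p') {s : ℝ} (hs : 0 ≤ s) :
    ∫⁻ ω, ∑' k, {ω | D.Selected S i o e e' k ω}.indicator
        (fun ω => expNeg (D.neededGain S 0 s i k ω)) ω ∂μ =
      p * ENNReal.ofReal (S.lam i) * ∫⁻ r in Set.Ioi (0 : ℝ), ENNReal.ofReal (2 * Real.pi * r) *
        (rangeIndicator S i r *
        expNeg (ENNReal.ofReal (S.lam o) * ∫⁻ y in Set.Ioi (0 : ℝ),
          ENNReal.ofReal (2 * Real.pi * y) * (1 - openProb p' y (S.powerRadius i o r))) *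
        expNeg (ENNReal.ofReal (S.lam i) * ∫⁻ y in Set.Ioi (0 : ℝ),
          ENNReal.ofReal (2 * Real.pi * y) * (1 - S.meanWeight i p s r y))) := by
  have hm := hD.isMeasurable
  have ha : Measurable fun m : (ℕ → Bool) × ℝ × ℝ => if e m.1 = true then (1 : ℝ≥0∞) else 0 :=
    Measurable.ite (measurableSet_eq_fun (he.comp measurable_fst) measurable_const)
      measurable_const measurable_const
  -- The mean of the weight is demanded for every real `r`, but is computed for `r ≥ 0` only.
  -- Replacing `r` by `max r 0` does not change anything at distances.
  have hmax : Measurable fun z : ℝ × Plane × (ℕ → Bool) × ℝ × ℝ => (max z.1 0, z.2) := by fun_prop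
  have hw : Measurable fun z : ℝ × Plane × (ℕ → Bool) × ℝ × ℝ =>
      S.ownWeight i e s (max z.1 0) z.2.1 z.2.2 := (S.measurable_ownWeight i he s).comp hmax
  have hρ : Measurable fun z : ℝ × Plane × (ℕ → Bool) × ℝ × ℝ => S.powerRadius i o z.1 :=
    (S.measurable_powerRadius i o).comp measurable_fst
  have he2 : Measurable fun z : ℝ × Plane × (ℕ → Bool) × ℝ × ℝ => e' z.2.2.1 :=
    he'.comp (by fun_prop)
  have hw' : Measurable fun z : ℝ × Plane × (ℕ → Bool) × ℝ × ℝ =>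
      openIndicator (e' z.2.2.1) z.2.1 (S.powerRadius i o z.1) :=
    measurable_openIndicator he2 (by fun_prop) hρ
  have key := lintegral_tsum_marked (hD.poisson i) (hS.lam_pos i).le (hD.poisson o)
    (hS.lam_pos o).le (hm.mark i) (hm.mark o) (hD.indep_marks i) (hD.indep_marks o)
    (hD.indep_pos_marks i) (hD.indep_pos_marks o) (hD.indep_tiers_of_ne hio)
    (measurable_rangeIndicator S i) (ψ := rangeIndicator S i)
    (by unfold rangeIndicator; split_ifs <;> simp) ((rangeIndicator_antitone S i).antitoneOn _)
    (a := fun m => if e m.1 = true then 1 else 0) ha (fun m => by split_ifs <;> simp)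
    (A := p) (fun l => by
      rw [lintegral_map ha (hm.mark i l)]
      have hms : MeasurableSet {ω | e (D.cache i l ω) = true} :=
        measurableSet_eq_fun (he.comp (hm.cache i l)) measurable_const
      rw [← hp l, ← lintegral_indicator_one hms]
      refine lintegral_congr fun ω => ?_
      by_cases h : e (D.cache i l ω) = true <;> simp [h, mark])
    (w := fun r y m => S.ownWeight i e s (max r 0) y m)
    (w' := fun r y m => openIndicator (e' m.1) y (S.powerRadius i o r)) hw hw'
    (fun r y m => ownWeight_le_one S i e s _ y m) (fun r y m => openIndicator_le_one _ _ _)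
    (fun y m r hr r' hr' hrr => by
      simp only [max_eq_left (Set.mem_Ici.1 hr), max_eq_left (Set.mem_Ici.1 hr')]
      exact ownWeight_antitone hS i e hs y m hr hr' hrr)
    (fun y m r hr r' hr' hrr => openIndicator_antitone _ _ (powerRadius_monotone hS i o hr hr' hrr))
    (v := fun r y => S.meanWeight i p s (max r 0) ‖y‖)
    (v' := fun r y => openProb p' ‖y‖ (S.powerRadius i o r))
    (fun l r y => hD.lintegral_ownWeight hS i he hp hs l (le_max_right _ _) y)
    (fun l r y => by
      have hO : Measurable fun m : (ℕ → Bool) × ℝ × ℝ =>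
          openIndicator (e' m.1) y (S.powerRadius i o r) :=
        measurable_openIndicator (he'.comp measurable_fst) measurable_const measurable_const
      rw [lintegral_map hO (hm.mark o l)]
      exact lintegral_openIndicator (hm.cache o l) he' (hp' l) y _)
  simp only [max_eq_left (norm_nonneg _)] at key
  have hmw := measurable_meanWeight hS i p s
  have hown : ∀ r, ∫⁻ y : Plane, (1 - S.meanWeight i p s r ‖y‖) =
      ∫⁻ y in Set.Ioi (0 : ℝ), ENNReal.ofReal (2 * Real.pi * y) * (1 - S.meanWeight i p s r y) :=
    fun r => lintegral_norm_plane _ ((hmw.comp measurable_prodMk_left).const_sub 1)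
  have hcross : ∀ r, ∫⁻ y : Plane, (1 - openProb p' ‖y‖ (S.powerRadius i o r)) =
      ∫⁻ y in Set.Ioi (0 : ℝ), ENNReal.ofReal (2 * Real.pi * y) *
        (1 - openProb p' y (S.powerRadius i o r)) :=
    fun r => lintegral_norm_plane (fun y => 1 - openProb p' y (S.powerRadius i o r))
      ((measurable_openProb p' measurable_id measurable_const).const_sub 1)
  simp only [hown, hcross] at key
  rw [lintegral_norm_plane (fun r => rangeIndicator S i r *
        expNeg (ENNReal.ofReal (S.lam o) * ∫⁻ y in Set.Ioi (0 : ℝ),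
          ENNReal.ofReal (2 * Real.pi * y) * (1 - openProb p' y (S.powerRadius i o r))) *
        expNeg (ENNReal.ofReal (S.lam i) * ∫⁻ y in Set.Ioi (0 : ℝ),
          ENNReal.ofReal (2 * Real.pi * y) * (1 - S.meanWeight i p s r y)))] at key
  · rw [← key]
    refine lintegral_congr_ae ?_
    filter_upwards [hD.ae_pos_ne_zero hS i] with ω hω
    exact tsum_congr fun k => selected_indicator_eq hS D i o e e' hs (hω k)
  · have h2 : Measurable fun z : ℝ × ℝ => ENNReal.ofReal (2 * Real.pi * z.2) := by fun_prop
    have hρ' : Measurable fun z : ℝ × ℝ => S.powerRadius i o z.1 :=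
      (S.measurable_powerRadius i o).comp measurable_fst
    have h3 : Measurable fun z : ℝ × ℝ => ENNReal.ofReal (2 * Real.pi * z.2) *
        (1 - openProb p' z.2 (S.powerRadius i o z.1)) :=
      h2.mul ((measurable_openProb p' measurable_snd hρ').const_sub 1)
    have h4 : Measurable fun z : ℝ × ℝ => ENNReal.ofReal (2 * Real.pi * z.2) *
        (1 - S.meanWeight i p s z.1 z.2) := h2.mul (hmw.const_sub 1)
    exact ((measurable_rangeIndicator S i).mul (measurable_expNeg.comp
      (h3.lintegral_prod_right'.const_mul _))).mul (measurable_expNeg.comp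
      (h4.lintegral_prod_right'.const_mul _))

end Deployment

end HetNet

/-! ### Radial integrals with thinning inside the serving distance -/

namespace IsRadialPrimitive

variable {α : ℝ} {N : ℕ} {D : ℝ} {Ψ : ℝ → ℝ}

lemma radial_monotoneOn (h : IsRadialPrimitive α N D Ψ) (hα : 0 < α) {X : ℝ} (hX : 0 ≤ X) :
    MonotoneOn (fun y => y ^ 2 * (1 + Ψ (X * y ^ (-α)))) (Set.Ioi 0) := by
  refine monotoneOn_of_hasDerivWithinAt_nonneg (convex_Ioi 0)
    (fun y hy => (h.hasDerivAt_radial hα hX hy).continuousAt.continuousWithinAt)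
    (fun y hy => (h.hasDerivAt_radial hα hX (interior_subset hy)).hasDerivWithinAt)
    fun y hy => one_sub_nonneg hX (interior_subset hy)

/-- The radial primitive increases in `y` from its limit at `0`. The sign is needed to add values of
`ENNReal.ofReal`. -/
lemma radial_add_nonneg (h : IsRadialPrimitive α N D Ψ) (hα : 0 < α) {X : ℝ} (hX : 0 ≤ X) {b : ℝ}
    (hb : 0 < b) : 0 ≤ b ^ 2 * (1 + Ψ (X * b ^ (-α))) + D * X ^ (2 / α) := by
  have h1 := le_of_tendsto (h.tendsto_zero hα hX) (b := b ^ 2 * (1 + Ψ (X * b ^ (-α)))) (by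
    filter_upwards [Ioc_mem_nhdsGT hb] with y hy
    exact h.radial_monotoneOn hα hX hy.1 hb hy.2)
  linarith

end IsRadialPrimitive

namespace HetNet

section Thinned

variable {α : ℝ} {N : ℕ} {D : ℝ} {Ψ : ℝ → ℝ} {p X r : ℝ}

lemma one_sub_openProb_of_lt {y : ℝ} (hy : r < y) (hX : 0 ≤ X) (hy0 : 0 < y) :
    ENNReal.ofReal (2 * Real.pi * y) * (1 - openProb (ENNReal.ofReal p) y r *
      ENNReal.ofReal ((1 + X * y ^ (-α)) ^ (-(N : ℝ)))) =
      ENNReal.ofReal Real.pi *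
        ENNReal.ofReal (2 * y * (1 - (1 + X * y ^ (-α)) ^ (-(N : ℝ)))) := by
  have h1 : 0 ≤ (1 + X * y ^ (-α)) ^ (-(N : ℝ)) :=
    Real.rpow_nonneg (by have := mul_nonneg hX (Real.rpow_pos_of_pos hy0 (-α)).le; linarith) _
  rw [openProb, if_neg fun h => absurd h.2 (not_le.2 hy), one_mul, ← ENNReal.ofReal_one,
    ← ENNReal.ofReal_sub _ h1, ← ENNReal.ofReal_mul (by positivity),
    ← ENNReal.ofReal_mul Real.pi_pos.le]
  ring_nf

/-- Inside the serving distance `1 - (1 - p) φ = p + (1 - p) (1 - φ)`: blocking by caching BSs plus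
interference from the remaining ones. -/
lemma one_sub_openProb_of_le {y : ℝ} (hy : y ≤ r) (hX : 0 ≤ X) (hy0 : 0 < y) (hp0 : 0 ≤ p)
    (hp1 : p ≤ 1) :
    ENNReal.ofReal (2 * Real.pi * y) * (1 - openProb (ENNReal.ofReal p) y r *
      ENNReal.ofReal ((1 + X * y ^ (-α)) ^ (-(N : ℝ)))) =
      ENNReal.ofReal (Real.pi * p) * ENNReal.ofReal (2 * y) + ENNReal.ofReal (Real.pi * (1 - p)) *
        ENNReal.ofReal (2 * y * (1 - (1 + X * y ^ (-α)) ^ (-(N : ℝ)))) := by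
  have h1 : 0 ≤ (1 + X * y ^ (-α)) ^ (-(N : ℝ)) :=
    Real.rpow_nonneg (by have := mul_nonneg hX (Real.rpow_pos_of_pos hy0 (-α)).le; linarith) _
  have h2 := IsRadialPrimitive.one_sub_nonneg (α := α) (N := N) hX hy0
  have hp : 0 ≤ 1 - p := by linarith
  have hpi := Real.pi_pos
  rw [openProb, if_pos ⟨hy0, hy⟩, ← ENNReal.ofReal_one, ← ENNReal.ofReal_sub _ hp0,
    ← ENNReal.ofReal_mul hp, ← ENNReal.ofReal_sub _ (by positivity),
    ← ENNReal.ofReal_mul (by positivity), ← ENNReal.ofReal_mul (by positivity),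
    ← ENNReal.ofReal_mul (by positivity), ← ENNReal.ofReal_add (by positivity) (by positivity)]
  ring_nf

lemma lintegral_two_mul {b : ℝ} (hb : 0 ≤ b) :
    ∫⁻ y in Set.Ioc 0 b, ENNReal.ofReal (2 * y) = ENNReal.ofReal (b ^ 2) := by
  have := lintegral_Ioc_deriv (g := fun y => y ^ 2) (g' := fun y => 2 * y) hb (by fun_prop)
    (fun y _ => by simpa using hasDerivAt_pow 2 y) (fun y hy => by have := hy.1; positivity)
  simpa using this

lemma lintegral_thinned_near (h : IsRadialPrimitive α N D Ψ) (hα : 0 < α) (hX : 0 ≤ X)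
    (hr : 0 < r) (hp0 : 0 ≤ p) (hp1 : p ≤ 1) :
    ∫⁻ y in Set.Ioc 0 r, ENNReal.ofReal (2 * Real.pi * y) * (1 - openProb (ENNReal.ofReal p) y r *
      ENNReal.ofReal ((1 + X * y ^ (-α)) ^ (-(N : ℝ)))) =
      ENNReal.ofReal (Real.pi * (p * r ^ 2 + (1 - p) *
        (r ^ 2 * (1 + Ψ (X * r ^ (-α))) + D * X ^ (2 / α)))) := by
  have hn := h.radial_add_nonneg hα hX hr
  have hp : 0 ≤ 1 - p := by linarith
  have hpi := Real.pi_pos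
  rw [setLIntegral_congr_fun measurableSet_Ioc fun y hy =>
    one_sub_openProb_of_le hy.2 hX hy.1 hp0 hp1, lintegral_add_left (by fun_prop),
    lintegral_const_mul _ (by fun_prop), lintegral_const_mul _ (by fun_prop),
    lintegral_two_mul hr.le, h.lintegral_Ioc_zero hα hX hr, ← ENNReal.ofReal_mul (by positivity),
    ← ENNReal.ofReal_mul (by positivity), ← ENNReal.ofReal_add (by positivity) (by positivity)]
  ring_nf

lemma lintegral_thinned_Ioc (h : IsRadialPrimitive α N D Ψ) (hα : 0 < α) (hX : 0 ≤ X)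
    (hr : 0 < r) (hp0 : 0 ≤ p) (hp1 : p ≤ 1) {b : ℝ} (hrb : r ≤ b) :
    ∫⁻ y in Set.Ioc 0 b, ENNReal.ofReal (2 * Real.pi * y) * (1 - openProb (ENNReal.ofReal p) y r *
      ENNReal.ofReal ((1 + X * y ^ (-α)) ^ (-(N : ℝ)))) =
      ENNReal.ofReal (Real.pi * (b ^ 2 * (1 + Ψ (X * b ^ (-α))) + (1 - p) * (D * X ^ (2 / α)) -
        p * (r ^ 2 * Ψ (X * r ^ (-α))))) := by
  have hn := h.radial_add_nonneg hα hX hr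
  have hm : 0 ≤ b ^ 2 * (1 + Ψ (X * b ^ (-α))) - r ^ 2 * (1 + Ψ (X * r ^ (-α))) :=
    sub_nonneg.2 (h.radial_monotoneOn hα hX hr (hr.trans_le hrb) hrb)
  have hp : 0 ≤ 1 - p := by linarith
  have hpi := Real.pi_pos
  rw [← Set.Ioc_union_Ioc_eq_Ioc hr.le hrb, lintegral_union measurableSet_Ioc
    (Set.Ioc_disjoint_Ioc_of_le le_rfl), lintegral_thinned_near h hα hX hr hp0 hp1,
    setLIntegral_congr_fun measurableSet_Ioc fun y hy =>
      one_sub_openProb_of_lt hy.1 hX (hr.trans hy.1), lintegral_const_mul _ (by fun_prop),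
    h.lintegral_Ioc hα hX hr hrb, ← ENNReal.ofReal_mul hpi.le,
    ← ENNReal.ofReal_add (by positivity) (by positivity)]
  ring_nf

lemma lintegral_thinned_Ioi (h : IsRadialPrimitive α N D Ψ) (hα : 0 < α)
    (h0 : Tendsto (fun z => z ^ (-(2 / α)) * (1 + Ψ z)) (𝓝[>] 0) (𝓝 0)) (hX : 0 < X)
    (hr : 0 < r) (hp0 : 0 ≤ p) (hp1 : p ≤ 1) :
    ∫⁻ y in Set.Ioi 0, ENNReal.ofReal (2 * Real.pi * y) * (1 - openProb (ENNReal.ofReal p) y r *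
      ENNReal.ofReal ((1 + X * y ^ (-α)) ^ (-(N : ℝ)))) =
      ENNReal.ofReal (Real.pi * ((1 - p) * (D * X ^ (2 / α)) -
        p * (r ^ 2 * Ψ (X * r ^ (-α))))) := by
  have hn := h.radial_add_nonneg hα hX.le hr
  have hm : 0 ≤ -(r ^ 2 * (1 + Ψ (X * r ^ (-α)))) := by
    have := ge_of_tendsto (IsRadialPrimitive.tendsto_infty hα h0 hX)
      (b := r ^ 2 * (1 + Ψ (X * r ^ (-α)))) (by
        filter_upwards [eventually_ge_atTop r] with y hy
        exact h.radial_monotoneOn hα hX.le hr (hr.trans_le hy) hy)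
    linarith
  have hp : 0 ≤ 1 - p := by linarith
  have hpi := Real.pi_pos
  rw [← Set.Ioc_union_Ioi_eq_Ioi hr.le, lintegral_union measurableSet_Ioi
    (Set.disjoint_left.2 fun y hy hy' => absurd hy.2 (not_le.2 hy')),
    lintegral_thinned_near h hα hX.le hr hp0 hp1,
    setLIntegral_congr_fun measurableSet_Ioi fun y hy =>
      one_sub_openProb_of_lt hy hX.le (hr.trans hy), lintegral_const_mul _ (by fun_prop),
    h.lintegral_Ioi hα h0 hX hr, ← ENNReal.ofReal_mul hpi.le,
    ← ENNReal.ofReal_add (by positivity) (by positivity)]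
  ring_nf

lemma lintegral_one_sub_openProb (hp0 : 0 ≤ p) (hp1 : p ≤ 1) (hr : 0 ≤ r) :
    ∫⁻ y in Set.Ioi (0 : ℝ), ENNReal.ofReal (2 * Real.pi * y) *
      (1 - openProb (ENNReal.ofReal p) y r) = ENNReal.ofReal (Real.pi * p * r ^ 2) := by
  have hpi := Real.pi_pos
  have h1 : ∀ y, ENNReal.ofReal (2 * Real.pi * y) * (1 - openProb (ENNReal.ofReal p) y r) =
      (Set.Ioc 0 r).indicator (fun y => ENNReal.ofReal (Real.pi * p) * ENNReal.ofReal (2 * y)) y := by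
    intro y
    by_cases h : 0 < y ∧ y ≤ r
    · have := h.1
      rw [Set.indicator_of_mem (Set.mem_Ioc.2 h), openProb, if_pos h, ENNReal.sub_sub_cancel
        ENNReal.one_ne_top (ENNReal.ofReal_le_one.2 hp1), ← ENNReal.ofReal_mul (by positivity),
        ← ENNReal.ofReal_mul (by positivity)]
      ring_nf
    · rw [Set.indicator_of_notMem (mt Set.mem_Ioc.1 h), openProb, if_neg h]; simp
  rw [lintegral_congr h1, lintegral_indicator measurableSet_Ioc,
    Measure.restrict_restrict measurableSet_Ioc, Set.inter_eq_self_of_subset_left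
    Set.Ioc_subset_Ioi_self, lintegral_const_mul _ (by fun_prop), lintegral_two_mul hr,
    ← ENNReal.ofReal_mul (by positivity)]

end Thinned

/-- Tonelli. The bounds by one keep truncated subtraction from losing mass, so that it commutes with
the average. -/
lemma lintegral_one_sub_mul_average {ν : Measure ℝ} [IsProbabilityMeasure ν] {ρ : Measure ℝ}
    [SFinite ρ] {k o : ℝ → ℝ≥0∞} (hk : Measurable k) (ho : Measurable o) (ho1 : ∀ y, o y ≤ 1)
    {φ : ℝ → ℝ → ℝ≥0∞} (hφ : Measurable (Function.uncurry φ)) (hφ1 : ∀ᵐ y ∂ρ, ∀ w, φ y w ≤ 1) :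
    ∫⁻ y, k y * (1 - o y * ∫⁻ w, φ y w ∂ν) ∂ρ = ∫⁻ w, ∫⁻ y, k y * (1 - o y * φ y w) ∂ρ ∂ν := by
  have hm : Measurable fun z : ℝ × ℝ => k z.1 * (1 - o z.1 * φ z.1 z.2) :=
    (hk.comp measurable_fst).mul (((ho.comp measurable_fst).mul hφ).const_sub 1)
  rw [← lintegral_lintegral_swap (f := fun y w => k y * (1 - o y * φ y w)) hm.aemeasurable]
  refine lintegral_congr_ae ?_
  filter_upwards [hφ1] with y hy
  have hφy : Measurable (φ y) := hφ.comp measurable_prodMk_left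
  have h1 : ∀ w, o y * φ y w ≤ 1 := fun w => mul_le_one' (ho1 y) (hy w)
  have h2 : ∫⁻ w, o y * φ y w ∂ν ≠ ⊤ := by
    refine ne_top_of_le_ne_top ENNReal.one_ne_top ?_
    calc _ ≤ ∫⁻ _, 1 ∂ν := lintegral_mono h1
      _ = 1 := by simp
  rw [lintegral_const_mul _ ((hφy.const_mul _).const_sub 1),
    lintegral_sub (hφy.const_mul _) h2 (ae_of_all _ h1), lintegral_const_mul _ hφy]
  simp

variable {S : HetNet}

/-- The mass removed by the own tier, as an average over the angle offset. -/
lemma lintegral_one_sub_meanWeight (hS : S.Valid) (i : Fin 2) (p : ℝ≥0∞) {s r : ℝ}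
    (hs : 0 ≤ s) (hr : 0 ≤ r) :
    ∫⁻ y in Set.Ioi (0 : ℝ), ENNReal.ofReal (2 * Real.pi * y) * (1 - S.meanWeight i p s r y) =
      ∫⁻ w, (∫⁻ y in Set.Ioi (0 : ℝ), ENNReal.ofReal (2 * Real.pi * y) * (1 - openProb p y r *
        ENNReal.ofReal ((1 + S.relLoss i s r y * S.arrayGain i w / S.nakOf i) ^
          (-(S.nakOf i : ℝ))))) ∂S.angleLaw := by
  have := isProbabilityMeasure_angleLaw hS
  have hL : Measurable fun y => S.relLoss i s r y :=
    (S.measurable_relLoss i s).comp measurable_prodMk_left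
  refine lintegral_one_sub_mul_average (φ := fun y w => ENNReal.ofReal
      ((1 + S.relLoss i s r y * S.arrayGain i w / S.nakOf i) ^ (-(S.nakOf i : ℝ)))) (by fun_prop)
    (measurable_openProb p measurable_id measurable_const)
    (fun y => by unfold openProb; split_ifs <;> simp) ?_ ?_
  · have h1 : Measurable fun z : ℝ × ℝ => S.relLoss i s r z.1 := hL.comp measurable_fst
    have h2 : Measurable fun z : ℝ × ℝ => S.arrayGain i z.2 :=
      (Deployment.measurable_arrayGain S i).comp measurable_snd
    unfold Function.uncurry
    fun_prop
  · filter_upwards [self_mem_ae_restrict measurableSet_Ioi] with y (hy0 : 0 < y) w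
    refine ENNReal.ofReal_le_one.2 (Real.rpow_le_one_of_one_le_of_nonpos ?_ (by simp))
    have h2 := relLoss_nonneg hS i hs hr hy0.le
    have h3 := arrayGain_nonneg S i w
    have : 0 ≤ S.relLoss i s r y * S.arrayGain i w / S.nakOf i := by positivity
    linarith

end HetNet

namespace HetNet

variable {S : HetNet}

lemma hypS_eq_pfaff (S : HetNet) (i : Fin 2) {z : ℝ} (hz : 0 ≤ z) :
    S.hypS i z = pfaff (2 / S.alpha i) (S.nakOf i) z := gaussHyp_eq_pfaff _ _ hz

lemma relLoss_of_inRange (hS : S.Valid) {i : Fin 2} {y : ℝ} (hy : S.InRange i y) (s r : ℝ) :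
    S.relLoss i s r y = s * r ^ S.alpha i * y ^ (-S.alpha i) := by
  rw [relLoss, pathLoss_of_inRange hy, mul_div_cancel_left₀ _ (hS.inter_pos i).ne']

/-- Rate of the void and Laplace functionals of the first tier. -/
def firstRate (S : HetNet) (p s : ℝ) : ℝ := p * S.hypS 0 s + (1 - p) * S.Del 0 s

lemma nakOf_zero (S : HetNet) : S.nakOf 0 = 1 := rfl

lemma one_le_hypS (hS : S.Valid) {s : ℝ} (hs : 0 ≤ s) : 1 ≤ S.hypS 0 s := by
  rw [hypS_eq_pfaff S 0 hs]
  exact one_le_pfaff hS.alpha_first (hS.nakOf_pos 0) hs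

lemma firstRate_nonneg (hS : S.Valid) {p s : ℝ} (hp0 : 0 ≤ p) (hp1 : p ≤ 1) (hs : 0 ≤ s) :
    0 ≤ S.firstRate p s := by
  have h1 := one_le_hypS hS hs
  have hα := hS.alpha_pos 0
  have hα2 := hS.alpha_first
  have h2 : 2 / S.alpha 0 < 1 := (div_lt_one hα).2 hα2
  have h3 : 0 < Real.Gamma (1 - 2 / S.alpha 0) := Real.Gamma_pos_of_pos (by linarith)
  have h4 : 0 < Real.Gamma (S.nakOf 0 + 2 / S.alpha 0) := Real.Gamma_pos_of_pos (by positivity)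
  have h5 : 0 < Real.Gamma (S.nakOf 0) := Real.Gamma_pos_of_pos (by
    exact_mod_cast hS.nakOf_pos 0)
  have h6 : 0 ≤ 1 - p := by linarith
  unfold firstRate Del
  positivity

/-- With `X = s * r ^ α` one has `X * r ^ (-α) = s` and `X ^ (2 / α) = s ^ (2 / α) * r ^ 2`, so the
exponent is quadratic in the serving distance. -/
lemma lintegral_first_own (hS : S.Valid) {p s r : ℝ} (hp0 : 0 ≤ p) (hp1 : p ≤ 1) (hs : 0 < s)
    (hr : 0 < r) :
    ∫⁻ y in Set.Ioi (0 : ℝ), ENNReal.ofReal (2 * Real.pi * y) *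
      (1 - S.meanWeight 0 (ENNReal.ofReal p) s r y) =
      ENNReal.ofReal (Real.pi * (S.firstRate p s * r ^ 2)) := by
  have := isProbabilityMeasure_angleLaw hS
  have hα := hS.alpha_pos 0
  have hrα : 0 < r ^ S.alpha 0 := Real.rpow_pos_of_pos hr _
  have hX : 0 < s * r ^ S.alpha 0 := by positivity
  rw [lintegral_one_sub_meanWeight hS 0 _ hs.le hr.le]
  have h1 : ∀ w, (∫⁻ y in Set.Ioi (0 : ℝ), ENNReal.ofReal (2 * Real.pi * y) *
      (1 - openProb (ENNReal.ofReal p) y r *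
        ENNReal.ofReal ((1 + S.relLoss 0 s r y * S.arrayGain 0 w / S.nakOf 0) ^
          (-(S.nakOf 0 : ℝ))))) = ENNReal.ofReal (Real.pi * (S.firstRate p s * r ^ 2)) := by
    intro w
    have h2 := lintegral_thinned_Ioi (isRadialPrimitive_pfaff hS.alpha_first (hS.nakOf_pos 0)) hα
      (tendsto_pfaff_zero hS.alpha_first (hS.nakOf_pos 0)) hX hr hp0 hp1
    have e1 : s * r ^ S.alpha 0 * r ^ (-S.alpha 0) = s := by
      rw [Real.rpow_neg hr.le]; field_simp
    have e2 : (s * r ^ S.alpha 0) ^ (2 / S.alpha 0) = s ^ (2 / S.alpha 0) * r ^ 2 := by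
      rw [Real.mul_rpow hs.le hrα.le, ← Real.rpow_mul hr.le, mul_div_cancel₀ _ hα.ne',
        Real.rpow_two]
    rw [e1, e2, ← hypS_eq_pfaff S 0 hs.le] at h2
    refine Eq.trans (setLIntegral_congr_fun measurableSet_Ioi fun y (hy : 0 < y) => ?_)
      (h2.trans ?_)
    · rw [relLoss_of_inRange hS ⟨hy, Or.inl rfl⟩, arrayGain_zero, nakOf_zero, Nat.cast_one,
        mul_one, div_one]
    · congr 2
      rw [firstRate, Del]
      ring
  rw [lintegral_congr h1]
  simp

variable {Ω : Type*} [MeasurableSpace Ω] {μ : Measure Ω} [IsProbabilityMeasure μ]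
  {D : Deployment Ω}

namespace Deployment

theorem Law.toReal_lintegral_selected_first (hS : S.Valid) (hD : D.Law S μ)
    {e e' : (ℕ → Bool) → Bool} (he : Measurable e) (he' : Measurable e') {p p' : ℝ}
    (hp : ∀ k, μ {ω | e (D.cache 0 k ω) = true} = ENNReal.ofReal p)
    (hp' : ∀ k, μ {ω | e' (D.cache 1 k ω) = true} = ENNReal.ofReal p')
    (hp0 : 0 ≤ p) (hp1 : p ≤ 1) (hp0' : 0 ≤ p') (hp1' : p' ≤ 1) {s : ℝ} (hs : 0 < s) :
    (∫⁻ ω, ∑' k, {ω | D.Selected S 0 1 e e' k ω}.indicator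
        (fun ω => expNeg (D.neededGain S 0 s 0 k ω)) ω ∂μ).toReal =
      ∫ r in Set.Ioi (0 : ℝ), 2 * Real.pi * p * S.lam 0 * r *
        Real.exp (-(Real.pi * S.lam 1 * p' * S.powerRadius 0 1 r ^ 2)) *
        Real.exp (-(Real.pi * S.lam 0 * (S.firstRate p s * r ^ 2))) := by
  have hl0 := hS.lam_pos 0
  have hl1 := hS.lam_pos 1
  have hpi := Real.pi_pos
  have hK := firstRate_nonneg hS hp0 hp1 hs.le
  have hρ := S.measurable_powerRadius 0 1
  rw [hD.lintegral_selected hS (by decide) he he' hp hp' hs.le, ← lintegral_const_mul' _ _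
    (by finiteness), integral_eq_lintegral_of_nonneg_ae]
  · congr 1
    refine setLIntegral_congr_fun measurableSet_Ioi fun r (hr : 0 < r) => ?_
    rw [lintegral_first_own hS hp0 hp1 hs hr, lintegral_one_sub_openProb hp0' hp1'
      (powerRadius_nonneg hS 0 1 hr.le), rangeIndicator, if_pos (Or.inl rfl), one_mul,
      ← ENNReal.ofReal_mul hl1.le, ← ENNReal.ofReal_mul hl0.le, expNeg_ofReal (by positivity),
      expNeg_ofReal (by positivity), ← ENNReal.ofReal_mul hp0, ← ENNReal.ofReal_mul (by positivity),
      ← ENNReal.ofReal_mul (by positivity), ← ENNReal.ofReal_mul (by positivity)]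
    ring_nf
  · filter_upwards [self_mem_ae_restrict measurableSet_Ioi] with r (hr : 0 < r)
    simp only [Pi.zero_apply]
    positivity
  · exact (Measurable.mul (by fun_prop) (by fun_prop)).aestronglyMeasurable

end Deployment

/-! ### The first tier -/

lemma powRatio_mul_swap (hS : S.Valid) (i j : Fin 2) : S.powRatio i j * S.powRatio j i = 1 := by
  have h1 := hS.powRatio_pos i j
  have h : S.powRatio j i = (S.powRatio i j)⁻¹ := by rw [powRatio, powRatio, inv_div]
  rw [h, mul_inv_cancel₀ h1.ne']

/-- `Rr` is the serving distance at which the power radius towards the second tier reaches `RL`; it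
decides which term of the minimum in `powerRadius` is active. -/
lemma le_Rr_iff (hS : S.Valid) {r : ℝ} (hr : 0 ≤ r) :
    r ≤ S.Rr ↔ S.powRatio 1 0 * r ^ S.alpha 0 ≤ S.RL ^ S.alpha 1 := by
  have h1 := hS.powRatio_pos 0 1
  have h2 := hS.powRatio_pos 1 0
  have h3 := powRatio_mul_swap hS 1 0
  have hL := hS.RL_pos
  have h4 : 0 < S.RL ^ S.alpha 1 := Real.rpow_pos_of_pos hL _
  rw [Rr, one_div, Real.le_rpow_inv_iff_of_pos hr (by positivity) (hS.alpha_pos 0)]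
  constructor <;> intro h
  · have := mul_le_mul_of_nonneg_left h h2.le
    rwa [← mul_assoc, h3, one_mul] at this
  · have := mul_le_mul_of_nonneg_left h h1.le
    rwa [← mul_assoc, mul_comm (S.powRatio 0 1), h3, one_mul] at this

lemma powerRadius_zero_one_of_le (hS : S.Valid) {r : ℝ} (hr : 0 ≤ r) (h : r ≤ S.Rr) :
    S.powerRadius 0 1 r ^ 2 = S.powRatio 1 0 ^ (2 / S.alpha 1) * r ^ (2 / S.alphaRatio 1 0) := by
  have h1 := hS.powRatio_pos 1 0
  have h2 : 0 ≤ r ^ S.alpha 0 := Real.rpow_nonneg hr _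
  have hα := hS.alpha_pos 0
  have hα1 := hS.alpha_pos 1
  rw [powerRadius, if_neg (by decide), min_eq_right]
  · rw [← Real.rpow_two, ← Real.rpow_mul (by positivity), Real.mul_rpow h1.le h2,
      ← Real.rpow_mul hr, alphaRatio]
    congr 2 <;> field_simp
  · rw [one_div, Real.rpow_inv_le_iff_of_pos (by positivity) hS.RL_pos.le hα1]
    exact (le_Rr_iff hS hr).1 h

lemma powerRadius_zero_one_of_ge (hS : S.Valid) {r : ℝ} (hr : 0 ≤ r) (h : S.Rr ≤ r) :
    S.powerRadius 0 1 r = S.RL := by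
  have h1 := hS.powRatio_pos 1 0
  have h2 : 0 ≤ r ^ S.alpha 0 := Real.rpow_nonneg hr _
  rw [powerRadius, if_neg (by decide), min_eq_left]
  rw [one_div, Real.le_rpow_inv_iff_of_pos hS.RL_pos.le (by positivity) (hS.alpha_pos 1)]
  rcases h.eq_or_lt with h | h
  · have h3 : 0 ≤ S.powRatio 0 1 * S.RL ^ S.alpha 1 :=
      mul_nonneg (hS.powRatio_pos 0 1).le (Real.rpow_nonneg hS.RL_pos.le _)
    rw [← h, Rr, ← Real.rpow_mul h3, one_div_mul_cancel (hS.alpha_pos 0).ne', Real.rpow_one,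
      ← mul_assoc, powRatio_mul_swap hS, one_mul]
  · exact (not_le.1 (mt (le_Rr_iff hS hr).2 (not_le.2 h))).le

lemma unitStep_of_nonneg {x : ℝ} (hx : 0 ≤ x) : unitStep x = 1 := if_pos hx

lemma unitStep_of_neg {x : ℝ} (hx : x < 0) : unitStep x = 0 := if_neg (not_le.2 hx)

/-- The two branches of the density are the two cases of the power radius, and the term `-1` in the
definition of `Theta1` is absorbed by the factor `exp (-π p λ r²)` of the density. -/
lemma Theta1_eq (hS : S.Valid) (f : ℕ) (t : ℝ) :
    S.Theta1 f t = ∫ r in Set.Ioi (0 : ℝ), 2 * Real.pi * S.p 0 f * S.lam 0 * r *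
        Real.exp (-(Real.pi * S.lam 1 * S.p 1 f * S.powerRadius 0 1 r ^ 2)) *
        Real.exp (-(Real.pi * S.lam 0 * (S.firstRate (S.p 0 f) t * r ^ 2))) := by
  refine setIntegral_congr_ae measurableSet_Ioi ?_
  -- At `r = Rr` both unit steps equal one and the density is counted twice, so this single point is
  -- discarded.
  filter_upwards [compl_mem_ae_iff.2 (measure_singleton (μ := volume) S.Rr)] with r hr (h0 : 0 < r)
  have hne : r ≠ S.Rr := hr
  have e00 : (2 : ℝ) / S.alphaRatio 0 0 = 2 := by
    rw [alphaRatio, div_self (hS.alpha_pos 0).ne', div_one]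
  rw [dens1, Fin.sum_univ_two, e00, powRatio_self hS, Real.one_rpow, Real.rpow_two, firstRate]
  rcases hne.lt_or_gt with h | h
  · rw [unitStep_of_nonneg (by linarith), unitStep_of_neg (by linarith),
      powerRadius_zero_one_of_le hS h0.le h.le, mul_zero, add_zero, mul_one, mul_left_comm,
      ← Real.exp_add, mul_assoc (2 * Real.pi * S.p 0 f * S.lam 0 * r), ← Real.exp_add]
    ring_nf
  · rw [unitStep_of_nonneg (x := r - S.Rr) (by linarith),
      unitStep_of_neg (x := S.Rr - r) (by linarith), powerRadius_zero_one_of_ge hS h0.le h.le, mul_zero, zero_add, mul_one, mul_left_comm,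
      ← Real.exp_add, mul_assoc (2 * Real.pi * S.p 0 f * S.lam 0 * r), ← Real.exp_add]
    ring_nf

lemma integral_mul_exp_neg_mul_sq {b : ℝ} (hb : 0 < b) :
    ∫ r in Set.Ioi (0 : ℝ), 2 * b * r * Real.exp (-(b * r ^ 2)) = 1 := by
  have h := integral_Ioi_of_hasDerivAt_of_nonneg' (g := fun r => -Real.exp (-(b * r ^ 2)))
    (g' := fun r => 2 * b * r * Real.exp (-(b * r ^ 2))) (a := 0) (l := 0)
    (fun r _ => ?_) (fun r (hr : 0 < r) => by positivity) ?_
  · simpa using h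
  · have h1 : HasDerivAt (fun r : ℝ => -(b * r ^ 2)) (-(b * (2 * r))) r := by
      simpa using ((hasDerivAt_pow 2 r).const_mul b).fun_neg
    exact h1.exp.fun_neg.congr_deriv (by ring)
  · rw [← neg_zero]
    refine (Real.tendsto_exp_neg_atTop_nhds_zero.comp ?_).neg
    exact (tendsto_pow_atTop two_ne_zero).const_mul_atTop hb

namespace Deployment

/-- With Rayleigh fading the tail is an exponential, so no approximation enters. -/
theorem Law.measureReal_rateEvent_first (hS : S.Valid) (hD : D.Law S μ) {R : ℝ} (hR : 0 < R)
    (f : ℕ) : μ.real (D.rateEvent S 0 R 0 f) = S.Theta1 f (S.threshold 0 R) := by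
  have he : Measurable fun c : ℕ → Bool => c f := measurable_pi_apply f
  have h1 := hD.measure_exists_lt_rate hS hR 0 1 he he 0
  have h2 := hD.toReal_lintegral_selected_first hS he he (hD.cache_law 0 · f) (hD.cache_law 1 · f)
    (hS.p_nonneg 0 f) (hS.p_le_one 0 f) (hS.p_nonneg 1 f) (hS.p_le_one 1 f)
    (threshold_pos hS 0 hR)
  rw [Theta1_eq hS, ← h2, measureReal_def]
  simp only [nakOf_zero, gammaTail_one, Pi.zero_apply] at h1
  rw [← h1]
  simp only [rateEvent, serves_iff hS (by decide : (1 : Fin 2) ≠ 0)]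

theorem Law.serverSuccess_eq (hS : S.Valid) (hD : D.Law S μ) {R : ℝ} (hR : 0 < R) :
    D.serverSuccess S μ 0 R = S.serverExpr R := by
  have hτ := threshold_pos hS 0 hR
  -- Nearest-BS service is the case `p = 1`, `p' = 0`; the distance integral is then Gaussian and
  -- equals the reciprocal of `hypS`.
  have h1 := hD.measure_exists_lt_rate hS hR 0 1 (e := fun _ => true) (e' := fun _ => false)
    measurable_const measurable_const 0
  have h2 := hD.toReal_lintegral_selected_first hS (e := fun _ => true) (e' := fun _ => false)
    measurable_const measurable_const (p := 1) (p' := 0) (by simp) (by simp)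
    zero_le_one le_rfl le_rfl zero_le_one hτ
  simp only [nakOf_zero, gammaTail_one, Pi.zero_apply] at h1
  rw [← h1, ← measureReal_def] at h2
  have hq := one_le_hypS hS hτ.le
  have hq0 : 0 < S.hypS 0 (S.threshold 0 R) := by linarith
  have hl := hS.lam_pos 0
  have h3 : μ.real {ω | ∃ k, D.Nearest k ω ∧ (R : EReal) < D.rate S 0 0 k ω} =
      1 / S.hypS 0 (S.threshold 0 R) := by
    have hb : 0 < Real.pi * S.lam 0 * S.hypS 0 (S.threshold 0 R) := by
      have := Real.pi_pos
      positivity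
    rw [measureReal_congr (t := {ω | ∃ k, D.Selected S 0 1 (fun _ => true) (fun _ => false) k ω ∧
      (R : EReal) < D.rate S 0 0 k ω}), h2]
    · rw [eq_div_iff hq0.ne', ← integral_mul_const]
      refine Eq.trans ?_ (integral_mul_exp_neg_mul_sq hb)
      congr 1
      ext r
      simp only [firstRate, mul_zero, zero_mul, neg_zero, Real.exp_zero, mul_one, sub_self, one_mul,
        add_zero]
      ring_nf
    · filter_upwards [hD.ae_pos_ne_zero hS 0] with ω h0
      refine propext (exists_congr fun k => ?_)
      rw [nearest_iff (S := S) h0]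
  unfold serverSuccess serverExpr coverFirst
  by_cases hC : R ≤ S.Cbh
  · simp only [hC, true_and]
    rw [h3, unitStep_of_nonneg (sub_nonneg.2 hC), one_mul]
    by_cases hN : S.Hc + 1 ≤ S.Nc
    · have : (S.Hc : ℝ) + 1 ≤ S.Nc := by exact_mod_cast hN
      rw [unitStep_of_nonneg (by linarith), one_mul]
    -- If all files are cached, the sum is empty and the second unit step has no effect.
    · rw [Finset.Icc_eq_empty hN]
      simp
  · simp [hC, unitStep_of_neg (sub_neg.2 (not_le.1 hC))]

end Deployment

end HetNet

namespace HetNet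

variable {S : HetNet}

/-! ### Laplace functional of the second tier -/

lemma nakOf_one : S.nakOf 1 = S.nak := rfl

/-- Radial primitive of the second tier. -/
def radialPrim (S : HetNet) : ℝ → ℝ :=
  if S.alpha 1 = 2 then criticalPrim S.nak else fun z => -pfaff (2 / S.alpha 1) S.nak z

/-- Constant of the radial primitive of the second tier. -/
def radialConst (S : HetNet) : ℝ :=
  if S.alpha 1 = 2 then 0 else Real.Gamma (1 - 2 / S.alpha 1) *
    Real.Gamma (S.nak + 2 / S.alpha 1) * (Real.Gamma S.nak)⁻¹

lemma isRadialPrimitive_radialPrim (hS : S.Valid) :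
    IsRadialPrimitive (S.alpha 1) S.nak S.radialConst S.radialPrim := by
  unfold radialConst radialPrim
  split_ifs with h
  · rw [h]
    exact isRadialPrimitive_critical hS.nak_pos
  · exact isRadialPrimitive_pfaff (lt_of_le_of_ne hS.alpha_second (Ne.symm h)) hS.nak_pos

/-- Exponent of the Laplace functional of the second tier for an interferer at angle offset `w`,
when the serving BS is at distance `r`. -/
def weight (S : HetNet) (p c r w : ℝ) : ℝ :=
  S.RL ^ 2 * S.radialPrim (c * r ^ S.alpha 1 * S.arrayGain 1 w / S.RL ^ S.alpha 1) +
    (1 - p) * (S.radialConst * (c * r ^ S.alpha 1 * S.arrayGain 1 w) ^ (2 / S.alpha 1)) -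
    p * (r ^ 2 * S.radialPrim (c * S.arrayGain 1 w))

/-- With `X = c * r ^ α * G`, the argument of the primitive at the serving distance is `c * G`,
without division by `r`. Hence the weight is continuous up to `r = 0`, as uniform quadrature on a
compact interval requires. -/
lemma continuousOn_weight (hS : S.Valid) (p : ℝ) {c : ℝ} (hc : 0 ≤ c) :
    ContinuousOn (Function.uncurry (S.weight p c)) (Set.Ici 0 ×ˢ Set.univ) := by
  have hα := hS.alpha_pos 1
  have hL := Real.rpow_pos_of_pos hS.RL_pos (S.alpha 1)
  have hG : Continuous fun x : ℝ × ℝ => S.arrayGain 1 x.2 :=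
    (continuous_arrayGain (hS.ant_pos 1) 1).comp continuous_snd
  have hr : Continuous fun x : ℝ × ℝ => x.1 ^ S.alpha 1 :=
    (Real.continuous_rpow_const hα.le).comp continuous_fst
  have hΨ := (isRadialPrimitive_radialPrim hS).continuousOn
  have h1 : ContinuousOn (fun x : ℝ × ℝ => S.radialPrim
      (c * x.1 ^ S.alpha 1 * S.arrayGain 1 x.2 / S.RL ^ S.alpha 1)) (Set.Ici 0 ×ˢ Set.univ) := by
    refine hΨ.comp (Continuous.continuousOn (by fun_prop)) fun x hx => ?_
    have h0 : (0 : ℝ) ≤ x.1 := hx.1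
    have := arrayGain_nonneg S 1 x.2
    exact Set.mem_Ici.2 (by positivity)
  have h2 : ContinuousOn (fun x : ℝ × ℝ => S.radialPrim (c * S.arrayGain 1 x.2))
      (Set.Ici 0 ×ˢ Set.univ) := by
    refine hΨ.comp (Continuous.continuousOn (by fun_prop)) fun x hx => ?_
    have := arrayGain_nonneg S 1 x.2
    exact Set.mem_Ici.2 (by positivity)
  have h3 : Continuous fun x : ℝ × ℝ =>
      (c * x.1 ^ S.alpha 1 * S.arrayGain 1 x.2) ^ (2 / S.alpha 1) :=
    (Real.continuous_rpow_const (by positivity)).comp (by fun_prop)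
  exact ((h1.const_smul (S.RL ^ 2)).add
    (Continuous.continuousOn (by fun_prop : Continuous fun x : ℝ × ℝ => (1 - p) *
      (S.radialConst * (c * x.1 ^ S.alpha 1 * S.arrayGain 1 x.2) ^ (2 / S.alpha 1))))).sub
    (((continuous_fst.pow 2).continuousOn.mul h2).const_smul p)

lemma integral_angleLaw (hS : S.Valid) (g : ℝ → ℝ) :
    ∫ w, g w ∂S.angleLaw = (∫ x in (-1 : ℝ)..1, g (x * S.spacing / S.wavelength)) / 2 := by
  have h : 0 < S.spacing / S.wavelength := div_pos hS.spacing_pos hS.wavelength_pos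
  simp only [mul_div_assoc]
  rw [intervalIntegral.integral_comp_mul_right (fun w => g w) h.ne', angleLaw,
    ProbabilityTheory.cond, integral_smul_measure, Real.volume_Icc, neg_one_mul, one_mul,
    intervalIntegral.integral_of_le (by linarith), integral_Icc_eq_integral_Ioc,
    ENNReal.toReal_inv, ENNReal.toReal_ofReal (by linarith)]
  simp only [smul_eq_mul]
  field_simp
  ring

lemma lintegral_angleLaw (hS : S.Valid) {g : ℝ → ℝ} (hg : Continuous g) (h0 : ∀ w, 0 ≤ g w) :
    ∫⁻ w, ENNReal.ofReal (g w) ∂S.angleLaw =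
      ENNReal.ofReal ((∫ x in (-1 : ℝ)..1, g (x * S.spacing / S.wavelength)) / 2) := by
  rw [← integral_angleLaw hS, ofReal_integral_eq_lintegral_ofReal _ (ae_of_all _ h0)]
  have h1 : IntegrableOn g (Set.Icc (-(S.spacing / S.wavelength)) (S.spacing / S.wavelength)) :=
    hg.continuousOn.integrableOn_compact isCompact_Icc
  refine h1.smul_measure ?_
  have h : 0 < S.spacing / S.wavelength := div_pos hS.spacing_pos hS.wavelength_pos
  rw [Real.volume_Icc]
  simpa using h

lemma relLoss_of_RL_lt (hS : S.Valid) {y : ℝ} (hy : S.RL < y) (s r : ℝ) :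
    S.relLoss 1 s r y = 0 := by
  rw [relLoss, pathLoss_of_not_inRange hS (hS.RL_pos.trans hy).le, zero_div, mul_zero]
  rintro ⟨-, h⟩
  exact (h.resolve_left (by decide)).not_gt hy

/-- Beyond `RL` the path loss is zero and nothing is removed; up to `RL` the thinned radial integral
applies. -/
lemma lintegral_second_own_angle (hS : S.Valid) {p s r : ℝ} (hp0 : 0 ≤ p) (hp1 : p ≤ 1)
    (hs : 0 ≤ s) (hr : 0 < r) (hrL : r ≤ S.RL) (w : ℝ) :
    ∫⁻ y in Set.Ioi (0 : ℝ), ENNReal.ofReal (2 * Real.pi * y) *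
      (1 - openProb (ENNReal.ofReal p) y r *
        ENNReal.ofReal ((1 + S.relLoss 1 s r y * S.arrayGain 1 w / S.nakOf 1) ^
          (-(S.nakOf 1 : ℝ)))) =
      ENNReal.ofReal (Real.pi * (S.RL ^ 2 + S.weight p (s / S.nak) r w)) := by
  have hG := arrayGain_nonneg S 1 w
  have hrα : 0 < r ^ S.alpha 1 := Real.rpow_pos_of_pos hr _
  have hN : (0 : ℝ) < S.nak := by exact_mod_cast hS.nak_pos
  have h2 := lintegral_thinned_Ioc (isRadialPrimitive_radialPrim hS) (hS.alpha_pos 1)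
    (X := s / S.nak * r ^ S.alpha 1 * S.arrayGain 1 w) (by positivity) hr hp0 hp1 hrL
  rw [← Set.Ioc_union_Ioi_eq_Ioi hS.RL_pos.le, lintegral_union measurableSet_Ioi
    (Set.disjoint_left.2 fun y hy hy' => absurd hy.2 (not_le.2 hy'))]
  rw [setLIntegral_congr_fun (g := 0) measurableSet_Ioi fun y (hy : S.RL < y) => ?_]
  · simp only [Pi.zero_apply, lintegral_zero, add_zero]
    refine Eq.trans (setLIntegral_congr_fun measurableSet_Ioc fun y hy => ?_) (h2.trans ?_)
    · rw [relLoss_of_inRange hS ⟨hy.1, Or.inr hy.2⟩, nakOf_one]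
      ring_nf
    · rw [weight, Real.rpow_neg hS.RL_pos.le, Real.rpow_neg hr.le, ← div_eq_mul_inv,
        ← div_eq_mul_inv, mul_right_comm, mul_div_cancel_right₀ _ hrα.ne']
      ring_nf
  · rw [relLoss_of_RL_lt hS hy, openProb, if_neg fun h => absurd h.2 (not_le.2 (hrL.trans_lt hy))]
    simp

lemma neg_RL_sq_le_weight (hS : S.Valid) {p c r : ℝ} (hp0 : 0 ≤ p) (hp1 : p ≤ 1)
    (hc : 0 ≤ c) (hr : 0 < r) (hrL : r ≤ S.RL) (w : ℝ) :
    0 ≤ S.RL ^ 2 + S.weight p c r w := by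
  have h := isRadialPrimitive_radialPrim hS
  have hα := hS.alpha_pos 1
  have hG := arrayGain_nonneg S 1 w
  have hrα : 0 < r ^ S.alpha 1 := Real.rpow_pos_of_pos hr _
  have hX : 0 ≤ c * r ^ S.alpha 1 * S.arrayGain 1 w := by positivity
  have h1 := h.radial_add_nonneg hα hX hr
  have h2 := h.radial_monotoneOn hα hX hr hS.RL_pos hrL
  simp only [Real.rpow_neg hS.RL_pos.le, Real.rpow_neg hr.le, ← div_eq_mul_inv] at h1 h2
  rw [mul_right_comm, mul_div_cancel_right₀ _ hrα.ne', mul_right_comm] at h1 h2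
  have hp : 0 ≤ 1 - p := by linarith
  have h3 := mul_nonneg hp h1
  have h4 := mul_nonneg hp0 (sq_nonneg r)
  rw [weight]
  linarith

lemma continuous_weight (hS : S.Valid) (p : ℝ) {c r : ℝ} (hc : 0 ≤ c) (hr : 0 ≤ r) :
    Continuous (S.weight p c r) := by
  rw [← continuousOn_univ]
  exact (continuousOn_weight hS p hc).comp (f := fun w => (r, w)) (by fun_prop)
    fun w _ => ⟨hr, Set.mem_univ _⟩

/-- Average of `weight` over the angle offset, multiplied by two. -/
def angleWeight (S : HetNet) (p c r : ℝ) : ℝ :=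
  ∫ x in (-1 : ℝ)..1, S.weight p c r (x * S.spacing / S.wavelength)

lemma integral_add_weight (hS : S.Valid) (p : ℝ) {c r : ℝ} (hc : 0 ≤ c) (hr : 0 ≤ r) :
    ∫ x in (-1 : ℝ)..1, (S.RL ^ 2 + S.weight p c r (x * S.spacing / S.wavelength)) =
      2 * S.RL ^ 2 + S.angleWeight p c r := by
  have hw : Continuous fun x => S.weight p c r (x * S.spacing / S.wavelength) :=
    (continuous_weight hS p hc hr).comp (by fun_prop)
  rw [intervalIntegral.integral_add (by simp) (hw.intervalIntegrable _ _), angleWeight]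
  norm_num

lemma lintegral_second_own (hS : S.Valid) {p s r : ℝ} (hp0 : 0 ≤ p) (hp1 : p ≤ 1)
    (hs : 0 ≤ s) (hr : 0 < r) (hrL : r ≤ S.RL) :
    ∫⁻ y in Set.Ioi (0 : ℝ), ENNReal.ofReal (2 * Real.pi * y) *
      (1 - S.meanWeight 1 (ENNReal.ofReal p) s r y) =
      ENNReal.ofReal (Real.pi * (S.RL ^ 2 + S.angleWeight p (s / S.nak) r / 2)) := by
  have hN : (0 : ℝ) < S.nak := by exact_mod_cast hS.nak_pos
  have hc : 0 ≤ s / S.nak := by positivity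
  have hpi := Real.pi_pos
  have hw := continuous_weight hS p hc hr.le
  rw [lintegral_one_sub_meanWeight hS 1 _ hs hr.le]
  simp only [lintegral_second_own_angle hS hp0 hp1 hs hr hrL]
  rw [lintegral_angleLaw hS (by fun_prop) fun w => mul_nonneg hpi.le
    (neg_RL_sq_le_weight hS hp0 hp1 hc hr hrL w), intervalIntegral.integral_const_mul,
    integral_add_weight hS p hc hr.le]
  congr 1
  ring

/-- Quadrature of `angleWeight` with `u` nodes. -/
def quadWeight (S : HetNet) (p c : ℝ) (u : ℕ) (r : ℝ) : ℝ :=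
  Real.pi / u * ∑ k ∈ Finset.Icc 1 u,
    S.weight p c r (chebNode u k * S.spacing / S.wavelength) * √(1 - chebNode u k ^ 2)

lemma tendstoUniformlyOn_quadWeight (hS : S.Valid) (p : ℝ) {c : ℝ} (hc : 0 ≤ c) :
    TendstoUniformlyOn (S.quadWeight p c) (S.angleWeight p c) atTop (Set.Icc 0 S.RL) := by
  refine tendstoUniformlyOn_chebyshev isCompact_Icc
    (F := fun r x => S.weight p c r (x * S.spacing / S.wavelength)) ?_
  exact (continuousOn_weight hS p hc).comp
    (f := fun z : ℝ × ℝ => (z.1, z.2 * S.spacing / S.wavelength)) (by fun_prop)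
    fun z hz => ⟨hz.1.1, Set.mem_univ _⟩

lemma continuousOn_quadWeight (hS : S.Valid) (p : ℝ) {c : ℝ} (hc : 0 ≤ c) (u : ℕ) :
    ContinuousOn (S.quadWeight p c u) (Set.Icc 0 S.RL) := by
  refine continuousOn_const.mul (continuousOn_finsetSum _ fun k _ => ContinuousOn.mul ?_
    continuousOn_const)
  exact (continuousOn_weight hS p hc).comp
    (f := fun r : ℝ => (r, chebNode u k * S.spacing / S.wavelength)) (by fun_prop)
    fun z hz => ⟨hz.1, Set.mem_univ _⟩

/-- A uniform limit of its own quadratures, which are continuous. -/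
lemma continuousOn_angleWeight (hS : S.Valid) (p : ℝ) {c : ℝ} (hc : 0 ≤ c) :
    ContinuousOn (S.angleWeight p c) (Set.Icc 0 S.RL) :=
  (tendstoUniformlyOn_quadWeight hS p hc).continuousOn
    (Eventually.frequently (Eventually.of_forall fun u => continuousOn_quadWeight hS p hc u))

/-- Joint density of the serving distance `r` and of coverage in the second tier, when the Laplace
functional has the exponent `q`. -/
def secondKernel (S : HetNet) (p p' r q : ℝ) : ℝ :=
  2 * Real.pi * p * S.lam 1 * r * Real.exp (-(Real.pi * S.lam 0 * p' * S.powerRadius 1 0 r ^ 2)) *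
    Real.exp (-(Real.pi * S.lam 1 * (S.RL ^ 2 + q / 2)))

lemma continuous_powerRadius_zero (hS : S.Valid) (i : Fin 2) : Continuous (S.powerRadius i 0) := by
  have h1 : Continuous fun r : ℝ => r ^ S.alpha i :=
    Real.continuous_rpow_const (hS.alpha_pos i).le
  have h2 : Continuous fun r : ℝ => (S.powRatio 0 i * r ^ S.alpha i) ^ (1 / S.alpha 0) :=
    (Real.continuous_rpow_const (by have := hS.alpha_pos 0; positivity)).comp (by fun_prop)
  exact h2

lemma continuous_secondKernel (hS : S.Valid) (p p' : ℝ) :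
    Continuous fun z : ℝ × ℝ => S.secondKernel p p' z.1 z.2 := by
  have h := (continuous_powerRadius_zero hS 1).comp (continuous_fst (X := ℝ) (Y := ℝ))
  simp only [Function.comp_def] at h
  unfold secondKernel
  fun_prop

variable {Ω : Type*} [MeasurableSpace Ω] {μ : Measure Ω} [IsProbabilityMeasure μ]
  {D : Deployment Ω}

namespace Deployment

theorem Law.toReal_lintegral_selected_second (hS : S.Valid) (hD : D.Law S μ)
    {e e' : (ℕ → Bool) → Bool} (he : Measurable e) (he' : Measurable e') {p p' : ℝ}
    (hp : ∀ k, μ {ω | e (D.cache 1 k ω) = true} = ENNReal.ofReal p)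
    (hp' : ∀ k, μ {ω | e' (D.cache 0 k ω) = true} = ENNReal.ofReal p')
    (hp0 : 0 ≤ p) (hp1 : p ≤ 1) (hp0' : 0 ≤ p') (hp1' : p' ≤ 1) {s : ℝ} (hs : 0 ≤ s) :
    (∫⁻ ω, ∑' k, {ω | D.Selected S 1 0 e e' k ω}.indicator
        (fun ω => expNeg (D.neededGain S 0 s 1 k ω)) ω ∂μ).toReal =
      ∫ r in (0 : ℝ)..S.RL, S.secondKernel p p' r (S.angleWeight p (s / S.nak) r) := by
  have hl0 := hS.lam_pos 0
  have hl1 := hS.lam_pos 1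
  have hpi := Real.pi_pos
  have hN : (0 : ℝ) < S.nak := by exact_mod_cast hS.nak_pos
  have hc : 0 ≤ s / S.nak := by positivity
  have hcont : ContinuousOn (fun r => S.secondKernel p p' r (S.angleWeight p (s / S.nak) r))
      (Set.Icc 0 S.RL) :=
    (continuous_secondKernel hS p p').comp_continuousOn
      (continuousOn_id.prodMk (continuousOn_angleWeight hS p hc))
  rw [hD.lintegral_selected hS (by decide) he he' hp hp' hs, ← lintegral_const_mul' _ _
    (by finiteness), intervalIntegral.integral_of_le hS.RL_pos.le,
    integral_eq_lintegral_of_nonneg_ae]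
  · congr 1
    -- The range indicator kills serving distances beyond `RL`.
    have hsplit : ∀ F : ℝ → ℝ≥0∞, ∫⁻ r in Set.Ioi 0, F r =
        (∫⁻ r in Set.Ioc 0 S.RL, F r) + ∫⁻ r in Set.Ioi S.RL, F r := fun F => by
      rw [← Set.Ioc_union_Ioi_eq_Ioi hS.RL_pos.le, lintegral_union measurableSet_Ioi
        (Set.disjoint_left.2 fun y hy hy' => absurd hy.2 (not_le.2 hy'))]
    rw [hsplit, setLIntegral_congr_fun (g := 0) measurableSet_Ioi fun r (hr : S.RL < r) => ?_]
    · simp only [Pi.zero_apply, lintegral_zero, add_zero]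
      refine setLIntegral_congr_fun measurableSet_Ioc fun r hr => ?_
      have hr0 := hr.1
      have hq : 0 ≤ S.RL ^ 2 + S.angleWeight p (s / S.nak) r / 2 := by
        have h1 := integral_angleLaw hS fun w => S.RL ^ 2 + S.weight p (s / S.nak) r w
        rw [integral_add_weight hS p hc hr0.le] at h1
        have h2 : 0 ≤ ∫ w, S.RL ^ 2 + S.weight p (s / S.nak) r w ∂S.angleLaw :=
          integral_nonneg fun w => neg_RL_sq_le_weight hS hp0 hp1 hc hr0 hr.2 w
        rw [h1] at h2
        linarith
      rw [lintegral_second_own hS hp0 hp1 hs hr0 hr.2, lintegral_one_sub_openProb hp0' hp1'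
        (powerRadius_nonneg hS 1 0 hr0.le), rangeIndicator, if_pos (Or.inr hr.2), one_mul,
        ← ENNReal.ofReal_mul hl1.le, ← ENNReal.ofReal_mul hl0.le, expNeg_ofReal (by positivity),
        expNeg_ofReal (by positivity), ← ENNReal.ofReal_mul hp0,
        ← ENNReal.ofReal_mul (by positivity), ← ENNReal.ofReal_mul (by positivity),
        ← ENNReal.ofReal_mul (by positivity), secondKernel]
      ring_nf
    · rw [rangeIndicator, if_neg fun h => (h.resolve_left (by decide)).not_gt hr]
      simp
  · filter_upwards [self_mem_ae_restrict measurableSet_Ioc] with r hr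
    have hr0 := hr.1
    simp only [Pi.zero_apply, secondKernel]
    positivity
  · exact (hcont.mono Set.Ioc_subset_Icc_self).aestronglyMeasurable measurableSet_Ioc

end Deployment

end HetNet

/-! ### Joint convergence of the nested quadratures of the second tier -/

namespace HetNet

lemma tendsto_chebyshev {h : ℝ → ℝ} (hh : ContinuousOn h (Set.Icc (-1) 1)) :
    Tendsto (fun u : ℕ => Real.pi / u * ∑ k ∈ Finset.Icc 1 u, h (chebNode u k) *
      √(1 - chebNode u k ^ 2)) atTop (𝓝 (∫ x in (-1 : ℝ)..1, h x)) :=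
  (tendstoUniformlyOn_chebyshev (K := {0}) isCompact_singleton (F := fun _ => h)
    (hh.comp continuousOn_snd fun _ hz => hz.2)).tendsto_at (Set.mem_singleton 0)

lemma abs_chebyshev_sub_le {g h : ℝ → ℝ} {u : ℕ} {ε : ℝ} (hε : 0 ≤ ε)
    (hgh : ∀ x ∈ Set.Ioo (-1 : ℝ) 1, |g x - h x| ≤ ε) :
    |Real.pi / u * (∑ k ∈ Finset.Icc 1 u, g (chebNode u k) * √(1 - chebNode u k ^ 2)) -
      Real.pi / u * ∑ k ∈ Finset.Icc 1 u, h (chebNode u k) * √(1 - chebNode u k ^ 2)| ≤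
      Real.pi * ε := by
  rw [← mul_sub, ← Finset.sum_sub_distrib, abs_mul, abs_of_nonneg (by positivity)]
  have h1 : |∑ k ∈ Finset.Icc 1 u, (g (chebNode u k) * √(1 - chebNode u k ^ 2) -
      h (chebNode u k) * √(1 - chebNode u k ^ 2))| ≤ u * ε := by
    refine (Finset.abs_sum_le_sum_abs _ _).trans ?_
    have h2 : ∀ k ∈ Finset.Icc 1 u, |g (chebNode u k) * √(1 - chebNode u k ^ 2) -
        h (chebNode u k) * √(1 - chebNode u k ^ 2)| ≤ ε := fun k hk => by
      rw [← sub_mul, abs_mul, abs_of_nonneg (Real.sqrt_nonneg _)]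
      calc _ ≤ ε * 1 := mul_le_mul (hgh _ (chebNode_mem_Ioo hk)) (sqrt_one_sub_chebNode_le u k)
            (Real.sqrt_nonneg _) hε
        _ = ε := mul_one ε
    simpa using Finset.sum_le_sum h2
  rcases Nat.eq_zero_or_pos u with rfl | hu
  · simpa using mul_nonneg Real.pi_pos.le hε
  · have hu' : (0 : ℝ) < u := by exact_mod_cast hu
    calc _ ≤ Real.pi / u * (u * ε) := mul_le_mul_of_nonneg_left h1 (by positivity)
      _ = Real.pi * ε := by field_simp

/-- Gauss-Chebyshev quadrature of a uniformly convergent sequence of functions. -/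
theorem tendsto_chebyshev_prod {H : ℕ → ℝ → ℝ} {h : ℝ → ℝ} (hh : ContinuousOn h (Set.Icc (-1) 1))
    (hH : TendstoUniformlyOn H h atTop (Set.Ioo (-1) 1)) :
    Tendsto (fun u : ℕ × ℕ => Real.pi / u.2 * ∑ k ∈ Finset.Icc 1 u.2, H u.1 (chebNode u.2 k) *
      √(1 - chebNode u.2 k ^ 2)) atTop (𝓝 (∫ x in (-1 : ℝ)..1, h x)) := by
  have hpi := Real.pi_pos
  have h1 := (tendsto_chebyshev hh).comp (tendsto_snd (f := (atTop : Filter ℕ)))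
  rw [prod_atTop_atTop_eq] at h1
  refine h1.congr_dist ?_
  rw [Metric.tendsto_nhds]
  intro ε hε
  rw [Metric.tendstoUniformlyOn_iff] at hH
  have h2 := (hH (ε / (2 * Real.pi)) (by positivity)).prod_inl (atTop : Filter ℕ)
  rw [prod_atTop_atTop_eq] at h2
  filter_upwards [h2] with u hu
  simp only [Function.comp_apply, Real.dist_eq, sub_zero, abs_abs]
  refine lt_of_le_of_lt (abs_chebyshev_sub_le (ε := ε / (2 * Real.pi)) (by positivity)
    fun x hx => (hu x hx).le) ?_
  field_simp
  linarith

variable {S : HetNet}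

/-- For `α = 2`, `X * Fy (X / b ^ 2)` is `b ^ 2` times the critical primitive, and the prescribed
value at `X = 0` is its value `-1` there. For `α > 2` the weight is the given expression with `Ψ`
equal to minus the hypergeometric function. -/
lemma Wf_eq_weight (hS : S.Valid) (f : ℕ) {r b t : ℝ} (hr : 0 < r) (hb : 0 ≤ b) (ht : 0 ≤ t)
    (w : ℝ) : S.Wf f r w (b * r ^ S.alpha 1 / G0) t = S.weight (S.p 1 f) (b * t / S.nak) r w := by
  have hG := arrayGain_nonneg S 1 w
  have hα := hS.alpha_pos 1
  have hrα : 0 < r ^ S.alpha 1 := Real.rpow_pos_of_pos hr _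
  have hLα : 0 < S.RL ^ S.alpha 1 := Real.rpow_pos_of_pos hS.RL_pos _
  have hN : (0 : ℝ) < S.nak := by exact_mod_cast hS.nak_pos
  have hX : b * r ^ S.alpha 1 / G0 * S.arrayGain 1 w * t / S.nak =
      b * t / S.nak * r ^ S.alpha 1 * S.arrayGain 1 w := by
    rw [G0]; ring
  have hY : b * t / S.nak * S.arrayGain 1 w =
      b * t / S.nak * r ^ S.alpha 1 * S.arrayGain 1 w / r ^ S.alpha 1 := by
    field_simp
  have hX0 : 0 ≤ b * t / S.nak * r ^ S.alpha 1 * S.arrayGain 1 w := by positivity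
  simp only [Wf, weight, hX, hY]
  generalize b * t / S.nak * r ^ S.alpha 1 * S.arrayGain 1 w = X at hX0
  by_cases h2 : S.alpha 1 = 2
  · have e : ∀ x : ℝ, x ^ S.alpha 1 = x ^ 2 := fun x => by rw [h2, Real.rpow_two]
    rw [if_pos h2, radialConst, if_pos h2, radialPrim, if_pos h2, e, e]
    split_ifs with h0
    · have h3 := (isRadialPrimitive_critical hS.nak_pos).zero
      rw [h0, zero_div, zero_div, h3]
      ring
    · have hXp : 0 < X := lt_of_le_of_ne hX0 (Ne.symm h0)
      have hL := hS.RL_pos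
      rw [← mul_Fy (div_pos hXp (pow_pos hL 2)), ← mul_Fy (div_pos hXp (pow_pos hr 2))]
      field_simp
      ring
  · rw [if_neg h2, radialConst, if_neg h2, radialPrim, if_neg h2,
      hypS_eq_pfaff S 1 (by positivity), hypS_eq_pfaff S 1 (by positivity), Del, nakOf_one]
    ring

lemma dens2_of_mem (hS : S.Valid) (f : ℕ) {r : ℝ} (hr : 0 < r) (hrL : r ≤ S.RL) :
    S.dens2 f r = 2 * Real.pi * S.p 1 f * S.lam 1 * r *
      Real.exp (-(Real.pi * S.lam 0 * S.p 0 f * S.powerRadius 1 0 r ^ 2) -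
        Real.pi * S.lam 1 * S.p 1 f * r ^ 2) := by
  have hα := hS.alpha_pos 0
  have hα1 := hS.alpha_pos 1
  have h2 : 0 ≤ r ^ S.alpha 1 := Real.rpow_nonneg hr.le _
  have e : (2 : ℝ) / S.alphaRatio 1 1 = 2 := by
    rw [alphaRatio, div_self hα1.ne', div_one]
  have h : S.powerRadius 1 0 r ^ 2 =
      S.powRatio 0 1 ^ (2 / S.alpha 0) * r ^ (2 / S.alphaRatio 0 1) := by
    have h1 := hS.powRatio_pos 0 1
    rw [powerRadius, if_pos rfl, ← Real.rpow_two, ← Real.rpow_mul (by positivity),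
      Real.mul_rpow h1.le h2, ← Real.rpow_mul hr.le, alphaRatio]
    congr 2 <;> field_simp
  rw [dens2, Fin.sum_univ_two, e, powRatio_self hS, Real.one_rpow, Real.rpow_two,
    unitStep_of_nonneg (by linarith), h]
  ring_nf

/-- The factor `exp (-π λ p r²)` of the density cancels the term `p r²` in the exponent of the
Laplace functional, and `π² / (2 u)` is half of `π` times the quadrature factor `π / u`. -/
lemma FR_eq (hS : S.Valid) (u f n : ℕ) {r t : ℝ} (hr : 0 < r) (hrL : r ≤ S.RL) (ht : 0 ≤ t) :
    S.FR u f n r t = S.secondKernel (S.p 1 f) (S.p 0 f) r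
      (S.quadWeight (S.p 1 f) (n * etaL S.nak * t / S.nak) u r) := by
  have hη := etaL_pos hS.nak_pos
  rw [FR, laplace2, dens2_of_mem hS f hr hrL, secondKernel, quadWeight]
  simp only [Wf_eq_weight hS f hr (by positivity : 0 ≤ n * etaL S.nak) ht]
  rw [mul_left_comm, ← Real.exp_add, mul_assoc _ (Real.exp _), ← Real.exp_add]
  generalize ∑ k ∈ Finset.Icc 1 u, S.weight (S.p 1 f) (n * etaL S.nak * t / S.nak) r
    (chebNode u k * S.spacing / S.wavelength) * √(1 - chebNode u k ^ 2) = Q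
  ring_nf

/-- The kernel is uniformly continuous on compact sets, so uniform convergence of the exponents
carries over. -/
lemma tendstoUniformlyOn_secondKernel (hS : S.Valid) (p p' : ℝ) {c : ℝ} (hc : 0 ≤ c) :
    TendstoUniformlyOn (fun u r => S.secondKernel p p' r (S.quadWeight p c u r))
      (fun r => S.secondKernel p p' r (S.angleWeight p c r)) atTop (Set.Icc 0 S.RL) := by
  have hq := tendstoUniformlyOn_quadWeight hS p hc
  obtain ⟨M, hM⟩ := isCompact_Icc.exists_bound_of_continuousOn (continuousOn_angleWeight hS p hc)
  -- The limit is bounded by `M`; the margin `1` contains all quadratures that are within distance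
  -- one of it.
  have hK : IsCompact (Set.Icc 0 S.RL ×ˢ Metric.closedBall (0 : ℝ) (M + 1)) :=
    isCompact_Icc.prod (isCompact_closedBall _ _)
  have hu := hK.uniformContinuousOn_of_continuous (continuous_secondKernel hS p p').continuousOn
  rw [Metric.tendstoUniformlyOn_iff] at hq ⊢
  rw [Metric.uniformContinuousOn_iff] at hu
  intro ε hε
  obtain ⟨δ, hδ, h⟩ := hu ε hε
  filter_upwards [hq δ hδ, hq 1 one_pos] with u h1 h2 r hr
  have h3 := hM r hr
  have h4 := h1 r hr
  have h5 := h2 r hr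
  refine h (r, S.angleWeight p c r) ⟨hr, ?_⟩ (r, S.quadWeight p c u r) ⟨hr, ?_⟩ ?_
  · rw [mem_closedBall_zero_iff]; linarith
  · rw [mem_closedBall_zero_iff]
    rw [dist_eq_norm] at h5
    have := norm_sub_norm_le (S.quadWeight p c u r) (S.angleWeight p c r)
    rw [norm_sub_rev] at this
    linarith
  · rw [Prod.dist_eq, dist_self]
    exact max_lt hδ h4

theorem tendsto_Theta2 (hS : S.Valid) (f : ℕ) {t : ℝ} (ht : 0 ≤ t) :
    Tendsto (fun u : ℕ × ℕ => S.Theta2 u.1 u.2 f t) atTop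
      (𝓝 (∑ n ∈ Finset.Icc 1 S.nak, (-1 : ℝ) ^ (n + 1) * (S.nak.choose n : ℝ) *
        ∫ r in (0 : ℝ)..S.RL, S.secondKernel (S.p 1 f) (S.p 0 f) r
          (S.angleWeight (S.p 1 f) (n * etaL S.nak * t / S.nak) r))) := by
  have hη := etaL_pos hS.nak_pos
  have hL := hS.RL_pos
  have h : ∀ u : ℕ × ℕ, S.Theta2 u.1 u.2 f t = ∑ n ∈ Finset.Icc 1 S.nak,
      (-1 : ℝ) ^ (n + 1) * (S.nak.choose n : ℝ) * (S.RL / 2 * (Real.pi / u.2 *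
        ∑ k ∈ Finset.Icc 1 u.2, S.FR u.1 f n ((chebNode u.2 k + 1) * S.RL / 2) t *
          √(1 - chebNode u.2 k ^ 2))) := by
    intro u
    rw [Theta2, Finset.mul_sum]
    refine Finset.sum_congr rfl fun n _ => ?_
    ring
  simp only [h]
  refine tendsto_finsetSum _ fun n _ => Tendsto.const_mul _ ?_
  have hc : 0 ≤ n * etaL S.nak * t / S.nak := by positivity
  have hmap : Set.MapsTo (fun x : ℝ => (x + 1) * S.RL / 2) (Set.Icc (-1) 1) (Set.Icc 0 S.RL) :=
    fun x hx => ⟨by nlinarith [hx.1], by nlinarith [hx.2]⟩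
  have hcont : ContinuousOn (fun r => S.secondKernel (S.p 1 f) (S.p 0 f) r
      (S.angleWeight (S.p 1 f) (n * etaL S.nak * t / S.nak) r)) (Set.Icc 0 S.RL) :=
    (continuous_secondKernel hS _ _).comp_continuousOn
      (continuousOn_id.prodMk (continuousOn_angleWeight hS _ hc))
  have hunif := ((tendstoUniformlyOn_secondKernel hS (S.p 1 f) (S.p 0 f) hc).comp
    fun x : ℝ => (x + 1) * S.RL / 2).mono
      (fun x hx => hmap (Set.Ioo_subset_Icc_self hx) :
        Set.Ioo (-1) 1 ⊆ (fun x : ℝ => (x + 1) * S.RL / 2) ⁻¹' Set.Icc 0 S.RL)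
  have hlim := (tendsto_chebyshev_prod (hcont.comp (by fun_prop) hmap) hunif).const_mul (S.RL / 2)
  have hint : S.RL / 2 * (∫ x in (-1 : ℝ)..1, ((fun r => S.secondKernel (S.p 1 f) (S.p 0 f) r
      (S.angleWeight (S.p 1 f) (n * etaL S.nak * t / S.nak) r)) ∘
        fun x : ℝ => (x + 1) * S.RL / 2) x) =
      ∫ r in (0 : ℝ)..S.RL, S.secondKernel (S.p 1 f) (S.p 0 f) r
        (S.angleWeight (S.p 1 f) (n * etaL S.nak * t / S.nak) r) := by
    have e : ∀ x : ℝ, (x + 1) * S.RL / 2 = S.RL / 2 * x + S.RL / 2 := fun x => by ring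
    simp only [Function.comp_def, e]
    rw [intervalIntegral.mul_integral_comp_mul_add (f := fun r =>
      S.secondKernel (S.p 1 f) (S.p 0 f) r
        (S.angleWeight (S.p 1 f) (n * etaL S.nak * t / S.nak) r))]
    congr 1 <;> ring
  rw [hint] at hlim
  refine hlim.congr fun u => ?_
  congr 2
  refine Finset.sum_congr rfl fun k hk => ?_
  -- The nodes are interior, so the serving distance is positive, as `FR_eq` requires.
  have hx := chebNode_mem_Ioo hk
  rw [FR_eq hS _ _ _ (by nlinarith [hx.1]) (by nlinarith [hx.2]) ht]
  rfl

end HetNet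

/-! ### Coverage of the second tier with the approximate tail -/

namespace HetNet

/-- Binomial expansion, in which the term `n = 0` cancels the leading one. It turns the approximate
tail into a combination of exponentials, accessible to the Laplace functional. -/
lemma one_sub_gammaApprox (N : ℕ) (x : ℝ) :
    1 - gammaApprox N x = ∑ n ∈ Finset.Icc 1 N, (-1 : ℝ) ^ (n + 1) * (N.choose n : ℝ) *
      Real.exp (-(n * etaL N * x)) := by
  have h : gammaApprox N x = ∑ n ∈ Finset.range (N + 1), (-1 : ℝ) ^ n * (N.choose n : ℝ) *
      Real.exp (-(n * etaL N * x)) := by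
    rw [gammaApprox, sub_eq_neg_add, add_pow]
    refine Finset.sum_congr rfl fun n _ => ?_
    rw [one_pow, neg_pow, ← Real.exp_nat_mul]
    ring_nf
  rw [h, Finset.range_eq_Ico, Finset.sum_eq_sum_Ico_succ_bot (by omega),
    show Finset.Ico (0 + 1) (N + 1) = Finset.Icc 1 N from rfl]
  simp only [pow_zero, Nat.choose_zero_right, Nat.cast_one, Nat.cast_zero, zero_mul, neg_zero,
    Real.exp_zero, mul_one, sub_add_cancel_left, ← Finset.sum_neg_distrib]
  refine Finset.sum_congr rfl fun n _ => ?_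
  ring

lemma measurable_gammaApprox (N : ℕ) : Measurable (gammaApprox N) := by
  unfold gammaApprox
  fun_prop

variable {S : HetNet} {Ω : Type*} {D : Deployment Ω}

namespace Deployment

lemma tsum_indicator_selected {i o : Fin 2} {e e' : (ℕ → Bool) → Bool} {k : ℕ} {ω : Ω}
    (h : D.Selected S i o e e' k ω) (φ : ℕ → Ω → ℝ≥0∞) :
    ∑' l, {ω | D.Selected S i o e e' l ω}.indicator (φ l) ω = φ k ω := by
  rw [tsum_eq_single k, Set.indicator_of_mem (s := {ω | D.Selected S i o e e' k ω}) h]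
  intro l hl
  exact Set.indicator_of_notMem (s := {ω | D.Selected S i o e e' l ω})
    (fun hl' => hl (Selected.unique hl' h)) _

lemma tsum_indicator_of_not_selected {i o : Fin 2} {e e' : (ℕ → Bool) → Bool} {ω : Ω}
    (h : ∀ k, ¬ D.Selected S i o e e' k ω) (φ : ℕ → Ω → ℝ≥0∞) :
    ∑' l, {ω | D.Selected S i o e e' l ω}.indicator (φ l) ω = 0 :=
  ENNReal.tsum_eq_zero.2 fun l =>
    Set.indicator_of_notMem (s := {ω | D.Selected S i o e e' l ω}) (h l) _

lemma neededGain_of_inRange (hS : S.Valid) {R : ℝ} (hR : 0 < R) {k : ℕ} {ω : Ω}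
    (hr : S.InRange 1 ‖D.pos 1 k ω‖) (hI : D.interference S 1 k ω ≠ ⊤) {a : ℝ} (ha : 0 ≤ a) :
    D.neededGain S 0 (a * S.threshold 1 R) 1 k ω =
      ENNReal.ofReal (a * D.requiredGain S R k ω) := by
  have h1 := pathLoss_pos hS hr
  have h2 := hS.pow_pos 1
  have h4 : (0 : ℝ) < S.ant 1 := by exact_mod_cast hS.ant_pos 1
  have hq : 0 < S.pow 1 * S.pathLoss 1 ‖D.pos 1 k ω‖ * G0 * S.ant 1 := by unfold G0; positivity
  have hτ := threshold_pos hS 1 hR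
  rw [neededGain, requiredGain, ENNReal.ofReal_zero, zero_add, ← mul_div_assoc,
    ENNReal.ofReal_div_of_pos hq, ← mul_assoc, ENNReal.ofReal_mul (mul_nonneg ha hτ.le),
    ENNReal.ofReal_toReal hI]

lemma requiredGain_nonneg (hS : S.Valid) {R : ℝ} (hR : 0 < R) (k : ℕ) (ω : Ω) :
    0 ≤ D.requiredGain S R k ω := by
  have h1 := pathLoss_nonneg hS 1 (norm_nonneg (D.pos 1 k ω))
  have h2 := hS.pow_pos 1
  have hτ := threshold_pos hS 1 hR
  unfold requiredGain G0
  positivity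

variable [MeasurableSpace Ω] {μ : Measure Ω} [IsProbabilityMeasure μ]

lemma IsMeasurable.requiredGain (hD : D.IsMeasurable) (S : HetNet) (R : ℝ) (k : ℕ) :
    Measurable (D.requiredGain S R k) := by
  have h1 := (S.measurable_pathLoss 1).comp (hD.pos 1 k).norm
  exact ((hD.interference S 1 k).ennreal_toReal.const_mul _).div
    (((h1.const_mul _).mul_const _).mul_const _)

lemma IsMeasurable.tsum_indicator_selected (hD : D.IsMeasurable) (S : HetNet) (i o : Fin 2)
    {e e' : (ℕ → Bool) → Bool} (he : Measurable e) (he' : Measurable e') {φ : ℕ → Ω → ℝ≥0∞}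
    (hφ : ∀ k, Measurable (φ k)) :
    Measurable fun ω => ∑' k, {ω | D.Selected S i o e e' k ω}.indicator (φ k) ω :=
  Measurable.tsum fun k => (hφ k).indicator (hD.selected S i o he he' k)

lemma tsum_indicator_selected_le {i o : Fin 2} {e e' : (ℕ → Bool) → Bool} {φ : ℕ → Ω → ℝ≥0∞}
    {c : ℝ≥0∞} (hφ : ∀ k ω, φ k ω ≤ c) (ω : Ω) :
    ∑' k, {ω | D.Selected S i o e e' k ω}.indicator (φ k) ω ≤ c := by
  by_cases h : ∃ k, D.Selected S i o e e' k ω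
  · obtain ⟨k, hk⟩ := h
    rw [tsum_indicator_selected hk]
    exact hφ k ω
  · rw [tsum_indicator_of_not_selected (not_exists.1 h)]
    exact zero_le

/-- The expansion is made at each outcome, where at most one BS serves, and each exponential is
integrated separately. The interference is almost surely finite, so the real required gain agrees
with the extended one. -/
theorem Law.approxCovered_eq (hS : S.Valid) (hD : D.Law S μ) {R : ℝ} (hR : 0 < R) (f : ℕ) :
    D.approxCovered S μ R f = ∑ n ∈ Finset.Icc 1 S.nak, (-1 : ℝ) ^ (n + 1) *
      (S.nak.choose n : ℝ) * ∫ r in (0 : ℝ)..S.RL, S.secondKernel (S.p 1 f) (S.p 0 f) r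
        (S.angleWeight (S.p 1 f) (n * etaL S.nak * S.threshold 1 R / S.nak) r) := by
  have he : Measurable fun c : ℕ → Bool => c f := measurable_pi_apply f
  have hη := etaL_pos hS.nak_pos
  have hτ := threshold_pos hS 1 hR
  have hM := hD.isMeasurable
  let T : ℕ → Ω → ℝ≥0∞ := fun n ω => ∑' k,
    {ω | D.Selected S 1 0 (fun c => c f) (fun c => c f) k ω}.indicator
      (fun ω => expNeg (D.neededGain S 0 (n * etaL S.nak * S.threshold 1 R) 1 k ω)) ω
  have hT : ∀ n, Measurable (T n) := fun n => hM.tsum_indicator_selected S 1 0 he he fun k =>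
    measurable_expNeg.comp (hM.neededGain S 0 _ 1 k)
  have hT1 : ∀ n ω, T n ω ≤ 1 := fun n => tsum_indicator_selected_le fun k ω => expNeg_le_one _
  have hTint : ∀ n, ∫ ω, (T n ω).toReal ∂μ = ∫ r in (0 : ℝ)..S.RL,
      S.secondKernel (S.p 1 f) (S.p 0 f) r
        (S.angleWeight (S.p 1 f) (n * etaL S.nak * S.threshold 1 R / S.nak) r) := fun n => by
    rw [integral_toReal (hT n).aemeasurable
      (ae_of_all _ fun ω => (hT1 n ω).trans_lt ENNReal.one_lt_top)]
    exact hD.toReal_lintegral_selected_second hS he he (hD.cache_law 1 · f) (hD.cache_law 0 · f)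
      (hS.p_nonneg 1 f) (hS.p_le_one 1 f) (hS.p_nonneg 0 f) (hS.p_le_one 0 f) (by positivity)
  have hTi : ∀ n, Integrable (fun ω => (T n ω).toReal) μ := fun n =>
    Integrable.of_bound (hT n).ennreal_toReal.aestronglyMeasurable 1 (ae_of_all _ fun ω => by
      rw [Real.norm_of_nonneg ENNReal.toReal_nonneg]
      exact ENNReal.toReal_mono ENNReal.one_ne_top (hT1 n ω))
  have h0 : ∀ k ω, ENNReal.ofReal (1 - gammaApprox S.nak (D.requiredGain S R k ω)) ≤ 1 :=
    fun k ω => ENNReal.ofReal_le_one.2 (by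
      have := gammaApprox_nonneg hS.nak_pos (requiredGain_nonneg (D := D) hS hR k ω)
      linarith)
  have hγ : ∀ k, Measurable fun ω =>
      ENNReal.ofReal (1 - gammaApprox S.nak (D.requiredGain S R k ω)) := fun k =>
    (measurable_const.sub
      ((measurable_gammaApprox S.nak).comp (hM.requiredGain S R k))).ennreal_ofReal
  simp only [approxCovered, serves_iff hS (by decide : (0 : Fin 2) ≠ 1)]
  rw [← integral_toReal (Measurable.aemeasurable (hM.tsum_indicator_selected S 1 0 he he hγ))
    (ae_of_all _ fun ω => (tsum_indicator_selected_le h0 ω).trans_lt ENNReal.one_lt_top)]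
  simp only [← hTint, ← integral_const_mul]
  rw [← integral_finsetSum _ fun n _ => (hTi n).const_mul _]
  refine integral_congr_ae ?_
  filter_upwards [hD.ae_interference_ne_top hS] with ω hω
  by_cases h : ∃ k, D.Selected S 1 0 (fun c => c f) (fun c => c f) k ω
  · obtain ⟨k, hk⟩ := h
    have hx := requiredGain_nonneg (D := D) hS hR k ω
    rw [tsum_indicator_selected hk, ENNReal.toReal_ofReal
      (sub_nonneg.2 (gammaApprox_le_one hS.nak_pos hx)), one_sub_gammaApprox]
    refine Finset.sum_congr rfl fun n _ => ?_
    simp only [T]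
    rw [tsum_indicator_selected hk, neededGain_of_inRange hS hR hk.2.1 (hω k) (by positivity),
      expNeg_ofReal (by positivity), ENNReal.toReal_ofReal (Real.exp_nonneg _)]
  · simp only [T, tsum_indicator_of_not_selected (not_exists.1 h)]
    simp

/-! ### Error of the approximation of the tail -/

lemma Law.measurableSet_assocEvent (hS : S.Valid) (hD : D.Law S μ) (i : Fin 2) (f : ℕ) :
    MeasurableSet (D.assocEvent S i f) := by
  have he : Measurable fun c : ℕ → Bool => c f := measurable_pi_apply f
  obtain ⟨o, ho⟩ := exists_ne i
  have h : D.assocEvent S i f = ⋃ k, {ω | D.Selected S i o (fun c => c f) (fun c => c f) k ω} := by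
    ext ω
    simp [assocEvent, serves_iff hS ho]
  rw [h]
  exact MeasurableSet.iUnion fun k => hD.isMeasurable.selected S i o he he k

/-- The rate event is part of the association event, so the product undoes the conditioning, even if
the association has probability zero. -/
lemma Law.assocProb_mul_cond (hS : S.Valid) (hD : D.Law S μ) (noise : Fin 2 → ℝ) (R : ℝ)
    (i : Fin 2) (f : ℕ) :
    D.assocProb S μ i f * (cond μ (D.assocEvent S i f)).real (D.rateEvent S noise R i f) =
      μ.real (D.rateEvent S noise R i f) := by
  have h : D.rateEvent S noise R i f ⊆ D.assocEvent S i f := fun ω ⟨k, hk, _⟩ => ⟨k, hk⟩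
  rw [assocProb, measureReal_def, measureReal_def, measureReal_def, ← ENNReal.toReal_mul, mul_comm,
    cond_mul_eq_inter (hD.measurableSet_assocEvent hS i f), Set.inter_eq_self_of_subset_right h]

lemma gammaTail_neededGain (hS : S.Valid) {R : ℝ} (hR : 0 < R) {k : ℕ} {ω : Ω}
    (hr : S.InRange 1 ‖D.pos 1 k ω‖) (hI : D.interference S 1 k ω ≠ ⊤) :
    gammaTail S.nak (D.neededGain S 0 (S.threshold 1 R) 1 k ω) =
      ENNReal.ofReal (1 - (gammaMeasure S.nak S.nak).real (Set.Iic (D.requiredGain S R k ω))) := by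
  have h := neededGain_of_inRange hS hR hr hI zero_le_one
  rw [one_mul, one_mul] at h
  rw [h, gammaTail_eq hS.nak_pos ENNReal.ofReal_ne_top,
    ENNReal.toReal_ofReal (requiredGain_nonneg hS hR k ω)]

/-- At each outcome the approximate tail exceeds the true one by an amount between `0`, by Alzer's
inequality, and `gammaError`; the latter counts only where the second tier serves. -/
theorem Law.approxCovered_bounds (hS : S.Valid) (hD : D.Law S μ) {R : ℝ} (hR : 0 < R) (f : ℕ) :
    μ.real (D.rateEvent S 0 R 1 f) ≤ D.approxCovered S μ R f ∧
      D.approxCovered S μ R f ≤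
        μ.real (D.rateEvent S 0 R 1 f) + gammaError S.nak * D.assocProb S μ 1 f := by
  have he : Measurable fun c : ℕ → Bool => c f := measurable_pi_apply f
  have hM := hD.isMeasurable
  have h1 := hD.measure_exists_lt_rate hS hR 1 0 he he 0
  have h2 : D.rateEvent S 0 R 1 f = {ω | ∃ k, D.Selected S 1 0 (fun c => c f) (fun c => c f) k ω ∧
      (R : EReal) < D.rate S 0 1 k ω} := by
    simp only [rateEvent, serves_iff hS (by decide : (0 : Fin 2) ≠ 1)]
  have h0 : ∀ k ω, ENNReal.ofReal (1 - gammaApprox S.nak (D.requiredGain S R k ω)) ≤ 1 :=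
    fun k ω => ENNReal.ofReal_le_one.2 (by
      have := gammaApprox_nonneg hS.nak_pos (requiredGain_nonneg (D := D) hS hR k ω)
      linarith)
  have hfin : (∫⁻ ω, ∑' k, {ω | D.Selected S 1 0 (fun c => c f) (fun c => c f) k ω}.indicator
      (fun ω => ENNReal.ofReal (1 - gammaApprox S.nak (D.requiredGain S R k ω))) ω ∂μ) ≠ ⊤ := by
    refine ((lintegral_mono fun ω => tsum_indicator_selected_le h0 ω).trans_lt ?_).ne
    simp
  have hA := hD.measurableSet_assocEvent hS 1 f
  rw [← h2, nakOf_one, Pi.zero_apply] at h1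
  simp only [approxCovered, serves_iff hS (by decide : (0 : Fin 2) ≠ 1)]
  have hε := gammaError_nonneg S.nak
  constructor
  · rw [measureReal_def, h1]
    refine ENNReal.toReal_mono hfin (lintegral_mono_ae ?_)
    filter_upwards [hD.ae_interference_ne_top hS] with ω hω
    refine ENNReal.tsum_le_tsum fun k => ?_
    refine Set.indicator_rel_indicator le_rfl fun hk => ?_
    replace hk : D.Selected S 1 0 (fun c => c f) (fun c => c f) k ω := hk
    have hx := requiredGain_nonneg (D := D) hS hR k ω
    rw [gammaTail_neededGain hS hR hk.2.1 (hω k)]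
    exact ENNReal.ofReal_le_ofReal
      (sub_le_sub_left (gammaApprox_le_gammaMeasure hS.nak_pos hx) _)
  · have h3 : (∫⁻ ω, ∑' k, {ω | D.Selected S 1 0 (fun c => c f) (fun c => c f) k ω}.indicator
        (fun ω => ENNReal.ofReal (1 - gammaApprox S.nak (D.requiredGain S R k ω))) ω ∂μ) ≤
        μ (D.rateEvent S 0 R 1 f) + ENNReal.ofReal (gammaError S.nak) *
          μ (D.assocEvent S 1 f) := by
      rw [h1, ← lintegral_indicator_const hA, ← lintegral_add_right _ (measurable_const.indicator hA)]
      refine lintegral_mono_ae ?_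
      filter_upwards [hD.ae_interference_ne_top hS] with ω hω
      by_cases h : ∃ k, D.Selected S 1 0 (fun c => c f) (fun c => c f) k ω
      · obtain ⟨k, hk⟩ := h
        have hx := requiredGain_nonneg (D := D) hS hR k ω
        have hmem : ω ∈ D.assocEvent S 1 f :=
          ⟨k, (serves_iff hS (by decide : (0 : Fin 2) ≠ 1) k f ω).2 hk⟩
        have hG : (gammaMeasure S.nak S.nak).real (Set.Iic (D.requiredGain S R k ω)) ≤ 1 := by
          have hN : (0 : ℝ) < S.nak := by exact_mod_cast hS.nak_pos
          have := isProbabilityMeasure_gammaMeasure hN hN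
          exact measureReal_le_one
        rw [tsum_indicator_selected hk, tsum_indicator_selected hk, Set.indicator_of_mem hmem,
          gammaTail_neededGain hS hR hk.2.1 (hω k),
          ← ENNReal.ofReal_add (sub_nonneg.2 hG) hε]
        refine ENNReal.ofReal_le_ofReal ?_
        have := le_gammaError hS.nak_pos hx
        linarith
      · rw [tsum_indicator_of_not_selected (not_exists.1 h)]
        exact zero_le
    have h4 := ENNReal.toReal_mono (by finiteness) h3
    rwa [ENNReal.toReal_add (by finiteness) (by finiteness), ENNReal.toReal_mul,
      ENNReal.toReal_ofReal hε] at h4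

/-! ### Vanishing noise -/

lemma IsMeasurable.lt_rate (hD : D.IsMeasurable) (hS : S.Valid) {R : ℝ} (hR : 0 < R)
    (noise : Fin 2 → ℝ) (i : Fin 2) (k : ℕ) :
    MeasurableSet {ω | (R : EReal) < D.rate S noise i k ω} := by
  simp only [lt_rate_iff_lt_sinr hS hR]
  refine measurableSet_lt measurable_const ?_
  have h1 := (S.measurable_pathLoss i).comp (hD.pos i k).norm
  exact (((((h1.const_mul _).mul_const _).mul_const _).mul (hD.gain i k)).ennreal_ofReal).div
    ((hD.interference S i k).const_add _)

/-- Noise only lowers the rate; a negative value is read as zero by `ENNReal.ofReal`, so no sign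
condition arises. -/
lemma rate_le_rate_zero (hS : S.Valid) {R : ℝ} (hR : 0 < R) (noise : Fin 2 → ℝ) (i : Fin 2) (k : ℕ)
    (ω : Ω) (h : (R : EReal) < D.rate S noise i k ω) : (R : EReal) < D.rate S 0 i k ω := by
  rw [lt_rate_iff_lt_sinr hS hR] at h ⊢
  refine h.trans_le (ENNReal.div_le_div_left ?_ _)
  simp

lemma eventually_lt_rate (hS : S.Valid) {R : ℝ} (hR : 0 < R) (i : Fin 2) (k : ℕ) (ω : Ω)
    (h : (R : EReal) < D.rate S 0 i k ω) :
    ∀ᶠ noise : Fin 2 → ℝ in 𝓝 0, (R : EReal) < D.rate S noise i k ω := by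
  simp only [lt_rate_iff_lt_sinr hS hR] at h ⊢
  have h1 : Tendsto (fun noise : Fin 2 → ℝ => ENNReal.ofReal (noise i) + D.interference S i k ω)
      (𝓝 0) (𝓝 (ENNReal.ofReal ((0 : Fin 2 → ℝ) i) + D.interference S i k ω)) :=
    (ENNReal.tendsto_ofReal ((continuous_apply i).tendsto 0)).add_const _
  exact (ENNReal.Tendsto.const_div h1 (Or.inr ENNReal.ofReal_ne_top)).eventually_const_lt h

/-- The indicators converge at every outcome: the strict inequality persists for small noise if it
holds without noise, and otherwise never holds. -/
lemma IsMeasurable.tendsto_measureReal_lt_rate (hD : D.IsMeasurable) (hS : S.Valid) {R : ℝ}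
    (hR : 0 < R) (i : Fin 2) {A : ℕ → Set Ω} (hA : ∀ k, MeasurableSet (A k)) :
    Tendsto (fun noise : Fin 2 → ℝ => μ.real {ω | ∃ k, ω ∈ A k ∧
      (R : EReal) < D.rate S noise i k ω}) (𝓝 0)
      (𝓝 (μ.real {ω | ∃ k, ω ∈ A k ∧ (R : EReal) < D.rate S 0 i k ω})) := by
  have hm : ∀ noise : Fin 2 → ℝ, MeasurableSet {ω | ∃ k, ω ∈ A k ∧
      (R : EReal) < D.rate S noise i k ω} := fun noise => by
    have : {ω | ∃ k, ω ∈ A k ∧ (R : EReal) < D.rate S noise i k ω} =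
        ⋃ k, A k ∩ {ω | (R : EReal) < D.rate S noise i k ω} := by ext; simp
    rw [this]
    exact MeasurableSet.iUnion fun k => (hA k).inter (hD.lt_rate hS hR noise i k)
  refine (ENNReal.tendsto_toReal (measure_ne_top _ _)).comp
    (tendsto_measure_of_tendsto_indicator_of_isFiniteMeasure _ μ hm fun ω => ?_)
  by_cases h : ∃ k, ω ∈ A k ∧ (R : EReal) < D.rate S 0 i k ω
  · obtain ⟨k, hk, hlt⟩ := h
    filter_upwards [eventually_lt_rate hS hR i k ω hlt] with noise hn
    exact iff_of_true ⟨k, hk, hn⟩ ⟨k, hk, hlt⟩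
  · refine Eventually.of_forall fun noise => iff_of_false ?_ h
    rintro ⟨k, hk, hlt⟩
    exact h ⟨k, hk, rate_le_rate_zero hS hR noise i k ω hlt⟩

lemma IsMeasurable.nearest (hD : D.IsMeasurable) (k : ℕ) : MeasurableSet {ω | D.Nearest k ω} := by
  have h : {ω | D.Nearest k ω} = ⋂ l, ⋂ _ : l ≠ k, {ω | ‖D.pos 0 k ω‖ < ‖D.pos 0 l ω‖} := by
    ext; simp [Nearest]
  rw [h]
  exact MeasurableSet.iInter fun l => MeasurableSet.iInter fun _ =>
    measurableSet_lt (hD.pos 0 k).norm (hD.pos 0 l).norm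

lemma success_eq (hS : S.Valid) (hD : D.Law S μ) (noise : Fin 2 → ℝ) (R : ℝ) :
    D.success S μ noise R = (∑ f ∈ Finset.Icc 1 S.Hc, ∑ i : Fin 2, S.zipf f *
      μ.real (D.rateEvent S noise R i f)) + D.serverSuccess S μ noise R := by
  simp only [success, hD.assocProb_mul_cond hS]

theorem Law.tendsto_success (hS : S.Valid) (hD : D.Law S μ) {R : ℝ} (hR : 0 < R) :
    Tendsto (fun noise : Fin 2 → ℝ => D.success S μ noise R) (𝓝 0) (𝓝 (D.success S μ 0 R)) := by
  simp only [success_eq hS hD]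
  have hM := hD.isMeasurable
  refine Tendsto.add (tendsto_finsetSum _ fun f _ => tendsto_finsetSum _ fun i _ =>
    Tendsto.const_mul _ ?_) (tendsto_finsetSum _ fun f _ => Tendsto.const_mul _ ?_)
  · obtain ⟨o, ho⟩ := exists_ne i
    have he : Measurable fun c : ℕ → Bool => c f := measurable_pi_apply f
    simp only [rateEvent, serves_iff hS ho]
    exact hM.tendsto_measureReal_lt_rate hS hR i fun k => hM.selected S i o he he k
  · by_cases hC : R ≤ S.Cbh
    · simp only [hC, true_and]
      exact hM.tendsto_measureReal_lt_rate hS hR 0 fun k => hM.nearest k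
    · simp [hC]

/-! ### The success probability -/

lemma zipf_nonneg (S : HetNet) (f : ℕ) : 0 ≤ S.zipf f := by
  unfold zipf
  positivity

lemma tailSuccess_eq (hS : S.Valid) (hD : D.Law S μ) (R : ℝ) :
    D.tailSuccess S μ R = (∑ f ∈ Finset.Icc 1 S.Hc, S.zipf f *
      (μ.real (D.rateEvent S 0 R 0 f) + D.approxCovered S μ R f)) +
        D.serverSuccess S μ 0 R := by
  simp only [tailSuccess, hD.assocProb_mul_cond hS]

lemma tailSuccess_sub_success (hS : S.Valid) (hD : D.Law S μ) (R : ℝ) :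
    D.tailSuccess S μ R - D.success S μ 0 R = ∑ f ∈ Finset.Icc 1 S.Hc, S.zipf f *
      (D.approxCovered S μ R f - μ.real (D.rateEvent S 0 R 1 f)) := by
  rw [tailSuccess_eq hS hD, success_eq hS hD, add_sub_add_right_eq_sub, ← Finset.sum_sub_distrib]
  refine Finset.sum_congr rfl fun f _ => ?_
  rw [Fin.sum_univ_two]
  ring

end Deployment

end HetNet

end

theorem theorem3 {Ω : Type*} [MeasurableSpace Ω] (μ : Measure Ω) [IsProbabilityMeasure μ]
    (S : HetNet) (hS : S.Valid) (D : HetNet.Deployment Ω) (hD : D.Law S μ)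
    (R : ℝ) (hR : 0 < R) :
    -- the expression computes the noise-free success probability, up to quadrature
    -- and the approximation of the Gamma tail of the serving mmWave link
    Tendsto (fun u : ℕ × ℕ => S.successExpr u.1 u.2 R) atTop (𝓝 (D.tailSuccess S μ R)) ∧
    -- the error that is caused by the approximation of the tail
    D.success S μ 0 R ≤ D.tailSuccess S μ R ∧
    D.tailSuccess S μ R - D.success S μ 0 R ≤
      HetNet.gammaError S.nak *
        ∑ f ∈ Finset.Icc 1 S.Hc, S.zipf f * D.assocProb S μ 1 f ∧
    -- the noise is negligible in the limit of small noise powers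
    Tendsto (fun noise : Fin 2 → ℝ => D.success S μ noise R) (𝓝[{noise | 0 ≤ noise}] 0)
      (𝓝 (D.success S μ 0 R)) := by
  have hsub := HetNet.Deployment.tailSuccess_sub_success hS hD R
  refine ⟨?_, ?_, ?_, (hD.tendsto_success hS hR).mono_left nhdsWithin_le_nhds⟩
  · rw [HetNet.Deployment.tailSuccess_eq hS hD, hD.serverSuccess_eq hS hR]
    refine Tendsto.add (tendsto_finsetSum _ fun f _ => ?_) tendsto_const_nhds
    -- Only the second-tier term depends on the numbers of nodes.
    rw [hD.measureReal_rateEvent_first hS hR, hD.approxCovered_eq hS hR, mul_add]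
    exact ((HetNet.tendsto_Theta2 hS f (HetNet.threshold_pos hS 1 hR).le).const_mul _).const_add _
  · refine sub_nonneg.1 (hsub ▸ Finset.sum_nonneg fun f _ => mul_nonneg
      (HetNet.Deployment.zipf_nonneg S f)
      (sub_nonneg.2 (hD.approxCovered_bounds hS hR f).1))
  · rw [hsub, Finset.mul_sum]
    refine Finset.sum_le_sum fun f _ => ?_
    rw [mul_left_comm]
    exact mul_le_mul_of_nonneg_left (sub_le_iff_le_add'.2 (hD.approxCovered_bounds hS hR f).2)
      (HetNet.Deployment.zipf_nonneg S f)
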